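/- **Conventions.** Let $k$ be a field of characteristic $0$. Let $(\mathsf V,\mathsf F,\iota)$ be a Feynman category in the sense of Kaufmann–Ward: $\mathsf V$ is a groupoid, $\mathsf F$ a symmetric monoidal category, $\iota:\mathsf V\to\mathsf F$ a functor such that the induced functor $\iota^\otimes:\mathsf V^\otimes\to \mathrm{Iso}(\mathsf F)$ from the free symmetric monoidal category is an equivalence, the induced functor $\mathrm{Iso}(\mathsf F\downarrow\mathsf V)^\otimes\to \mathrm{Iso}(\mathsf F\downarrow \mathsf F)$ is an equivalence, and all slice categories $\mathsf F\downarrow \iota(v)$ are essentially small. Assume that every $\mathrm{Hom}_{\mathsf F}(X,Y)$ is finite and that $\mathsf F$ is *cubical*, that is, equipped with: * a function $\deg:\mathrm{Mor}(\mathsf F)\to\mathbb Z_{\ge 0}$, additive under $\otimes$ and $\circ$, with $\deg f=0$ if and only if $f$ is an isomorphism, and such that every basic morphism $v_1\otimes\dots\otimes v_n\to v_0$ ($v_i\in\mathsf V$) is a composite of morphisms of degree $\le 1$; * free $S_n$-actions on the sets $C_n(X,Y)$ of chains of composable morphisms from $X$ to $Y$, of which exactly $n$ have non-zero degree, modulo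 composing with morphisms of degree $0$. The actions are compatible with concatenation, $C_n\times C_m\to C_{n+m}$ along $S_n\times S_m\subset S_{n+m}$, they preserve the set $C_n^+(X,Y)$ of chains all of whose constituents have degree $\le 1$, and composition of morphisms induces a bijection $C_n^+(X,Y)/S_n\cong\{f\in \mathrm{Hom}_{\mathsf F}(X,Y):\deg f=n\}$. A (graded) $\mathsf T_{\mathsf V}$-op is a functor $\mathcal P$ on the groupoid $\mathsf{Cor}_{\mathsf V}$ of $\mathsf V$-coloured corollas $(v_1,\dots,v_n;v_0)$ with values in graded $k$-vector spaces, together with associative, unital and equivariant compositions along $\mathsf V$-coloured rooted trees, with Koszul signs (a graded unital operad coloured by the groupoid $\mathsf V$). The *linearization* $\mathbb F$ is the $\mathsf T_{\mathsf V}$-op, in degree $0$, with $\mathbb F(v_1,\dots,v_n;v_0)=k[\mathrm{Hom}_{\mathsf F}(v_1\otimes\dots\otimes v_n,v_0)]$. Let $A$ be the $\mathsf{Cor}_{\mathsf V}$-module spanned by the basic morphisms of degree $1$, let $Fr(A)$ be the free $\mathsf T_{\mathsf V}$-op on $A$, whose trees without vertices account for the isomorphisms of $\mathsf V$, graded by weight,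 the number of vertices; and let $\pi:Fr(A)\to\mathbb F$ be the morphism that composes morphisms along trees. A chain $\gamma\in C_n^+(v_1\otimes\dots\otimes v_m,v_0)$ gives, as a flow chart, a tree in $Fr(A)(v_1,\dots,v_m;v_0)$ decorated by basic morphisms of degree $1$, which is again written $\gamma$. **Lemma.** Let $\mathsf F$ be a cubical Feynman category with finite morphism sets. 1. $\mathbb F$ is quadratic: $\pi$ is a surjective morphism of $\mathsf T_{\mathsf V}$-ops, and $\ker\pi$ is the operadic ideal generated by its elements of weight $2$. 2. $\ker \pi$ is generated by the elements $\tau\gamma-\gamma$ for all $n$, all $\gamma\in C_n^+(v_1\otimes\dots\otimes v_m,v_0)$ and all transpositions $\tau\in S_n$. It is also generated by those with $n=2$ and $\tau=(1\,2)$. Thus $\mathbb F\cong Fr(A)/\langle\tau\gamma-\gamma\rangle$. 3. Let $\mathbb F^!$ be the quadratic dual, that is, the quotient of the free graded $\mathsf T_{\mathsf V}$-op $Fr(\Sigma^{-1}A^*)$ on the objectwise dual of $A$, placed in degree $-1$, by the ideal generated by the functionals on the weight $2$ part of $Fr(A)$ that vanish on every $\tau\gamma-\gamma$ with $\gamma$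 of length $2$. (Such a functional $\xi$ is regarded as the element $\sum_{\gamma\in C_2^+}\xi(\gamma)\,\gamma^*$ of weight $2$ of $Fr(\Sigma^{-1}A^*)$, where $\gamma^*$ is the tree $\gamma$ with its decorations replaced by their dual basis vectors.) Let $\mathbb F_{\mathfrak K}$ be the $\mathfrak K$-twist: $$\mathbb F_{\mathfrak K}(v_1,\dots,v_m;v_0)=\bigoplus_{n\ge 0}\bigl(k[C_n^+(v_1\otimes\dots\otimes v_m,v_0)]\otimes \mathrm{sgn}_n\bigr)_{S_n},$$ with the $n$-th summand in degree $-n$. Then composition of chains induces a well-defined structure of a graded $\mathsf T_{\mathsf V}$-op on $\mathbb F_{\mathfrak K}$, and there is an isomorphism of graded $\mathsf T_{\mathsf V}$-ops $\mathbb F^!\cong\mathbb F_{\mathfrak K}$ that sends the generator $\varphi^*$ dual to a basic morphism $\varphi$ of degree $1$ to the class of the one-term chain $\varphi$. -/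

import Mathlib

open CategoryTheory MonoidalCategory

universe v₁ v₂ u₁ u₂ w w'

/-! ### The free symmetric monoidal category -/

/-- Objects of the free symmetric monoidal category `D^⊗` on a category `D`: formal (bracketed)
tensor words in the objects of `D`. -/
inductive FreeSym (D : Type u₁) : Type u₁
  | of : D → FreeSym D
  | unit : FreeSym D
  | tensor : FreeSym D → FreeSym D → FreeSym D

namespace FreeSym

section Construction

variable {D : Type u₁} [Category.{v₁} D]

/-- Formal morphisms: generated by the morphisms of `D` and the structure maps of a symmetric
monoidal category. -/
inductive PreHom : FreeSym D → FreeSym D → Type (max u₁ v₁)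
  | of {x y : D} (f : x ⟶ y) : PreHom (of x) (of y)
  | id (X) : PreHom X X
  | comp {X Y Z} (f : PreHom X Y) (g : PreHom Y Z) : PreHom X Z
  | whiskerLeft (X) {Y Z} (f : PreHom Y Z) : PreHom (tensor X Y) (tensor X Z)
  | whiskerRight {X Y} (f : PreHom X Y) (Z) : PreHom (tensor X Z) (tensor Y Z)
  | assocHom (X Y Z) : PreHom (tensor (tensor X Y) Z) (tensor X (tensor Y Z))
  | assocInv (X Y Z) : PreHom (tensor X (tensor Y Z)) (tensor (tensor X Y) Z)
  | leftHom (X) : PreHom (tensor unit X) X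
  | leftInv (X) : PreHom X (tensor unit X)
  | rightHom (X) : PreHom (tensor X unit) X
  | rightInv (X) : PreHom X (tensor X unit)
  | braid (X Y) : PreHom (tensor X Y) (tensor Y X)

open PreHom in
/-- The congruence generated by functoriality of `D → D^⊗` and the axioms of a symmetric monoidal
category. -/
inductive HomRel : ∀ {X Y : FreeSym D}, PreHom X Y → PreHom X Y → Prop
  | refl {X Y} (f : PreHom X Y) : HomRel f f
  | symm {X Y} {f g : PreHom X Y} : HomRel f g → HomRel g f
  | trans {X Y} {f g h : PreHom X Y} : HomRel f g → HomRel g h → HomRel f h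
  | comp {X Y Z} {f f' : PreHom X Y} {g g' : PreHom Y Z} :
      HomRel f f' → HomRel g g' → HomRel (f.comp g) (f'.comp g')
  | whiskerLeft (X) {Y Z} {f f' : PreHom Y Z} :
      HomRel f f' → HomRel (f.whiskerLeft X) (f'.whiskerLeft X)
  | whiskerRight {Y Z} {f f' : PreHom Y Z} (X) :
      HomRel f f' → HomRel (f.whiskerRight X) (f'.whiskerRight X)
  | of_id (x : D) : HomRel (PreHom.of (𝟙 x)) (PreHom.id _)
  | of_comp {x y z : D} (f : x ⟶ y) (g : y ⟶ z) :
      HomRel (PreHom.of (f ≫ g)) ((PreHom.of f).comp (PreHom.of g))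
  | id_comp {X Y} (f : PreHom X Y) : HomRel ((PreHom.id X).comp f) f
  | comp_id {X Y} (f : PreHom X Y) : HomRel (f.comp (PreHom.id Y)) f
  | assoc {W X Y Z} (f : PreHom W X) (g : PreHom X Y) (h : PreHom Y Z) :
      HomRel ((f.comp g).comp h) (f.comp (g.comp h))
  | whiskerLeft_id (X Y) : HomRel ((PreHom.id Y).whiskerLeft X) (PreHom.id (tensor X Y))
  | id_whiskerRight (X Y) : HomRel ((PreHom.id X).whiskerRight Y) (PreHom.id (tensor X Y))
  | whiskerLeft_comp (W) {X Y Z} (f : PreHom X Y) (g : PreHom Y Z) :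
      HomRel ((f.comp g).whiskerLeft W) ((f.whiskerLeft W).comp (g.whiskerLeft W))
  | comp_whiskerRight {X Y Z} (f : PreHom X Y) (g : PreHom Y Z) (W) :
      HomRel ((f.comp g).whiskerRight W) ((f.whiskerRight W).comp (g.whiskerRight W))
  | exchange {W X Y Z} (f : PreHom W X) (g : PreHom Y Z) :
      HomRel ((g.whiskerLeft W).comp (f.whiskerRight Z))
        ((f.whiskerRight Y).comp (g.whiskerLeft X))
  | assoc_hom_inv (X Y Z) : HomRel ((assocHom X Y Z).comp (assocInv X Y Z)) (PreHom.id _)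
  | assoc_inv_hom (X Y Z) : HomRel ((assocInv X Y Z).comp (assocHom X Y Z)) (PreHom.id _)
  | assoc_nat_left {X X'} (f : PreHom X X') (Y Z) :
      HomRel (((f.whiskerRight Y).whiskerRight Z).comp (assocHom X' Y Z))
        ((assocHom X Y Z).comp (f.whiskerRight (tensor Y Z)))
  | assoc_nat_middle (X) {Y Y'} (f : PreHom Y Y') (Z) :
      HomRel (((f.whiskerLeft X).whiskerRight Z).comp (assocHom X Y' Z))
        ((assocHom X Y Z).comp ((f.whiskerRight Z).whiskerLeft X))
  | assoc_nat_right (X Y) {Z Z'} (f : PreHom Z Z') :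
      HomRel ((f.whiskerLeft (tensor X Y)).comp (assocHom X Y Z'))
        ((assocHom X Y Z).comp ((f.whiskerLeft Y).whiskerLeft X))
  | left_hom_inv (X) : HomRel ((leftHom X).comp (leftInv X)) (PreHom.id _)
  | left_inv_hom (X) : HomRel ((leftInv X).comp (leftHom X)) (PreHom.id _)
  | left_nat {X Y} (f : PreHom X Y) :
      HomRel ((f.whiskerLeft unit).comp (leftHom Y)) ((leftHom X).comp f)
  | right_hom_inv (X) : HomRel ((rightHom X).comp (rightInv X)) (PreHom.id _)
  | right_inv_hom (X) : HomRel ((rightInv X).comp (rightHom X)) (PreHom.id _)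
  | right_nat {X Y} (f : PreHom X Y) :
      HomRel ((f.whiskerRight unit).comp (rightHom Y)) ((rightHom X).comp f)
  | pentagon (W X Y Z) :
      HomRel (((assocHom W X Y).whiskerRight Z).comp
          ((assocHom W (tensor X Y) Z).comp ((assocHom X Y Z).whiskerLeft W)))
        ((assocHom (tensor W X) Y Z).comp (assocHom W X (tensor Y Z)))
  | triangle (X Y) :
      HomRel ((assocHom X unit Y).comp ((leftHom Y).whiskerLeft X)) ((rightHom X).whiskerRight Y)
  | braid_nat_right (X) {Y Z} (f : PreHom Y Z) :
      HomRel ((f.whiskerLeft X).comp (braid X Z)) ((braid X Y).comp (f.whiskerRight X))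
  | braid_nat_left {X Y} (f : PreHom X Y) (Z) :
      HomRel ((f.whiskerRight Z).comp (braid Y Z)) ((braid X Z).comp (f.whiskerLeft Z))
  | hexagon_forward (X Y Z) :
      HomRel ((assocHom X Y Z).comp ((braid X (tensor Y Z)).comp (assocHom Y Z X)))
        (((braid X Y).whiskerRight Z).comp
          ((assocHom Y X Z).comp ((braid X Z).whiskerLeft Y)))
  | hexagon_reverse (X Y Z) :
      HomRel ((assocInv X Y Z).comp ((braid (tensor X Y) Z).comp (assocInv Z X Y)))
        (((braid Y Z).whiskerLeft X).comp
          ((assocInv X Z Y).comp ((braid X Z).whiskerRight Y)))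
  | symmetry (X Y) : HomRel ((braid X Y).comp (braid Y X)) (PreHom.id _)

instance homSetoid (X Y : FreeSym D) : Setoid (PreHom X Y) :=
  ⟨HomRel, ⟨HomRel.refl, HomRel.symm, HomRel.trans⟩⟩

instance : Category.{max u₁ v₁} (FreeSym D) where
  Hom X Y := Quotient (homSetoid X Y)
  id X := ⟦PreHom.id X⟧
  comp := Quotient.map₂ PreHom.comp (fun _ _ hf _ _ hg => HomRel.comp hf hg)
  id_comp := by rintro X Y ⟨f⟩; exact Quotient.sound (HomRel.id_comp f)
  comp_id := by rintro X Y ⟨f⟩; exact Quotient.sound (HomRel.comp_id f)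
  assoc := by rintro W X Y Z ⟨f⟩ ⟨g⟩ ⟨h⟩; exact Quotient.sound (HomRel.assoc f g h)

instance : MonoidalCategoryStruct (FreeSym D) where
  tensorObj := tensor
  whiskerLeft X _ _ f := Quotient.map (PreHom.whiskerLeft X) (fun _ _ h => HomRel.whiskerLeft X h) f
  whiskerRight f Z := Quotient.map (fun f => PreHom.whiskerRight f Z)
    (fun _ _ h => HomRel.whiskerRight Z h) f
  tensorUnit := unit
  associator X Y Z := ⟨⟦.assocHom X Y Z⟧, ⟦.assocInv X Y Z⟧,
    Quotient.sound (HomRel.assoc_hom_inv X Y Z), Quotient.sound (HomRel.assoc_inv_hom X Y Z)⟩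
  leftUnitor X := ⟨⟦.leftHom X⟧, ⟦.leftInv X⟧,
    Quotient.sound (HomRel.left_hom_inv X), Quotient.sound (HomRel.left_inv_hom X)⟩
  rightUnitor X := ⟨⟦.rightHom X⟧, ⟦.rightInv X⟧,
    Quotient.sound (HomRel.right_hom_inv X), Quotient.sound (HomRel.right_inv_hom X)⟩

theorem whiskerLeft_comp' (W : FreeSym D) {X Y Z : FreeSym D} (f : X ⟶ Y) (g : Y ⟶ Z) :
    W ◁ (f ≫ g) = W ◁ f ≫ W ◁ g := by
  induction f using Quotient.inductionOn
  induction g using Quotient.inductionOn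
  exact Quotient.sound (HomRel.whiskerLeft_comp _ _ _)

theorem comp_whiskerRight' {X Y Z : FreeSym D} (f : X ⟶ Y) (g : Y ⟶ Z) (W : FreeSym D) :
    (f ≫ g) ▷ W = f ▷ W ≫ g ▷ W := by
  induction f using Quotient.inductionOn
  induction g using Quotient.inductionOn
  exact Quotient.sound (HomRel.comp_whiskerRight _ _ _)

theorem exchange' {W X Y Z : FreeSym D} (f : W ⟶ X) (g : Y ⟶ Z) :
    W ◁ g ≫ f ▷ Z = f ▷ Y ≫ X ◁ g := by
  induction f using Quotient.inductionOn
  induction g using Quotient.inductionOn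
  exact Quotient.sound (HomRel.exchange _ _)

theorem assoc_nat_left' {X X' : FreeSym D} (f : X ⟶ X') (Y Z : FreeSym D) :
    f ▷ Y ▷ Z ≫ (α_ X' Y Z).hom = (α_ X Y Z).hom ≫ f ▷ (Y ⊗ Z) := by
  induction f using Quotient.inductionOn
  exact Quotient.sound (HomRel.assoc_nat_left _ _ _)

theorem assoc_nat_middle' (X : FreeSym D) {Y Y' : FreeSym D} (f : Y ⟶ Y') (Z : FreeSym D) :
    (X ◁ f) ▷ Z ≫ (α_ X Y' Z).hom = (α_ X Y Z).hom ≫ X ◁ (f ▷ Z) := by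
  induction f using Quotient.inductionOn
  exact Quotient.sound (HomRel.assoc_nat_middle _ _ _)

theorem assoc_nat_right' (X Y : FreeSym D) {Z Z' : FreeSym D} (f : Z ⟶ Z') :
    (X ⊗ Y) ◁ f ≫ (α_ X Y Z').hom = (α_ X Y Z).hom ≫ X ◁ (Y ◁ f) := by
  induction f using Quotient.inductionOn
  exact Quotient.sound (HomRel.assoc_nat_right _ _ _)

instance : MonoidalCategory (FreeSym D) where
  tensorHom_def _ _ := rfl
  id_tensorHom_id X Y := by
    change (𝟙 X) ▷ Y ≫ X ◁ (𝟙 Y) = 𝟙 (X ⊗ Y)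
    have h1 : (𝟙 X) ▷ Y = 𝟙 (X ⊗ Y) := Quotient.sound (HomRel.id_whiskerRight X Y)
    have h2 : X ◁ (𝟙 Y) = 𝟙 (X ⊗ Y) := Quotient.sound (HomRel.whiskerLeft_id X Y)
    rw [h1, h2, Category.comp_id]
  tensorHom_comp_tensorHom {X₁ Y₁ Z₁ X₂ Y₂ Z₂} f₁ f₂ g₁ g₂ := by
    change (f₁ ▷ X₂ ≫ Y₁ ◁ f₂) ≫ (g₁ ▷ Y₂ ≫ Z₁ ◁ g₂) = (f₁ ≫ g₁) ▷ X₂ ≫ Z₁ ◁ (f₂ ≫ g₂)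
    rw [comp_whiskerRight', whiskerLeft_comp', Category.assoc, Category.assoc,
      ← Category.assoc (Y₁ ◁ f₂), exchange', Category.assoc]
  whiskerLeft_id X Y := Quotient.sound (HomRel.whiskerLeft_id X Y)
  id_whiskerRight X Y := Quotient.sound (HomRel.id_whiskerRight X Y)
  associator_naturality {X₁ X₂ X₃ Y₁ Y₂ Y₃} f₁ f₂ f₃ := by
    change ((f₁ ▷ X₂ ≫ Y₁ ◁ f₂) ▷ X₃ ≫ (Y₁ ⊗ Y₂) ◁ f₃) ≫ _ = _ ≫ f₁ ▷ (X₂ ⊗ X₃) ≫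
      Y₁ ◁ (f₂ ▷ X₃ ≫ Y₂ ◁ f₃)
    rw [Category.assoc, comp_whiskerRight', whiskerLeft_comp', assoc_nat_right', Category.assoc,
      ← Category.assoc ((Y₁ ◁ f₂) ▷ X₃), assoc_nat_middle', Category.assoc,
      ← Category.assoc (f₁ ▷ X₂ ▷ X₃), assoc_nat_left', Category.assoc]
  leftUnitor_naturality := by rintro X Y ⟨f⟩; exact Quotient.sound (HomRel.left_nat f)
  rightUnitor_naturality := by rintro X Y ⟨f⟩; exact Quotient.sound (HomRel.right_nat f)
  pentagon W X Y Z := Quotient.sound (HomRel.pentagon W X Y Z)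
  triangle X Y := Quotient.sound (HomRel.triangle X Y)

instance : SymmetricCategory (FreeSym D) where
  braiding X Y := ⟨⟦.braid X Y⟧, ⟦.braid Y X⟧,
    Quotient.sound (HomRel.symmetry X Y), Quotient.sound (HomRel.symmetry Y X)⟩
  braiding_naturality_right := by
    rintro X Y Z ⟨f⟩; exact Quotient.sound (HomRel.braid_nat_right X f)
  braiding_naturality_left := by
    rintro X Y ⟨f⟩ Z; exact Quotient.sound (HomRel.braid_nat_left f Z)
  hexagon_forward X Y Z := Quotient.sound (HomRel.hexagon_forward X Y Z)
  hexagon_reverse X Y Z := Quotient.sound (HomRel.hexagon_reverse X Y Z)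
  symmetry X Y := Quotient.sound (HomRel.symmetry X Y)

/-- The morphism of `D^⊗` given by a morphism of `D`. -/
def ofMap {x y : D} (f : x ⟶ y) : of x ⟶ of y := ⟦PreHom.of f⟧

theorem ofMap_id (x : D) : ofMap (𝟙 x) = 𝟙 (of x) := Quotient.sound (HomRel.of_id x)

theorem ofMap_comp {x y z : D} (f : x ⟶ y) (g : y ⟶ z) : ofMap (f ≫ g) = ofMap f ≫ ofMap g :=
  Quotient.sound (HomRel.of_comp f g)

end Construction

section Lift

variable {D : Type u₁} [Category.{v₁} D]
  {C : Type u₂} [Category.{v₂} C] [MonoidalCategory C] [SymmetricCategory C]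

/-- The extension of a functor `G : D ⥤ C` to tensor words. -/
def liftObj (G : D ⥤ C) : FreeSym D → C
  | of x => G.obj x
  | unit => 𝟙_ C
  | tensor X Y => liftObj G X ⊗ liftObj G Y

/-- The extension of a functor `G : D ⥤ C` to formal morphisms. -/
def liftPre (G : D ⥤ C) : ∀ {X Y : FreeSym D}, PreHom X Y → (liftObj G X ⟶ liftObj G Y)
  | _, _, .of f => G.map f
  | _, _, .id _ => 𝟙 _
  | _, _, .comp f g => liftPre G f ≫ liftPre G g
  | _, _, .whiskerLeft X f => liftObj G X ◁ liftPre G f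
  | _, _, .whiskerRight f Z => liftPre G f ▷ liftObj G Z
  | _, _, .assocHom _ _ _ => (α_ _ _ _).hom
  | _, _, .assocInv _ _ _ => (α_ _ _ _).inv
  | _, _, .leftHom _ => (λ_ _).hom
  | _, _, .leftInv _ => (λ_ _).inv
  | _, _, .rightHom _ => (ρ_ _).hom
  | _, _, .rightInv _ => (ρ_ _).inv
  | _, _, .braid _ _ => (β_ _ _).hom

theorem liftPre_sound (G : D ⥤ C) {X Y : FreeSym D} {f g : PreHom X Y} (h : HomRel f g) :
    liftPre G f = liftPre G g := by
  induction h with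
  | refl => rfl
  | symm _ ih => exact ih.symm
  | trans _ _ ih₁ ih₂ => exact ih₁.trans ih₂
  | comp _ _ ih₁ ih₂ => dsimp only [liftPre]; rw [ih₁, ih₂]
  | whiskerLeft _ _ ih => dsimp only [liftPre]; rw [ih]
  | whiskerRight _ _ ih => dsimp only [liftPre]; rw [ih]
  | exchange f g => exact whisker_exchange (liftPre G f) (liftPre G g)
  | hexagon_forward X Y Z => exact BraidedCategory.hexagon_forward _ _ _
  | hexagon_reverse X Y Z => exact BraidedCategory.hexagon_reverse _ _ _
  | pentagon W X Y Z => exact MonoidalCategory.pentagon _ _ _ _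
  | triangle X Y => exact MonoidalCategory.triangle _ _
  | _ => dsimp only [liftPre, liftObj]; simp

/-- The symmetric monoidal functor `G^⊗ : D^⊗ ⥤ C` extending `G : D ⥤ C`. It is strict: on objects
`G^⊗ (X ⊗ Y)` is `G^⊗ X ⊗ G^⊗ Y` by definition. -/
def lift (G : D ⥤ C) : FreeSym D ⥤ C where
  obj := liftObj G
  map := Quotient.lift (liftPre G) (fun _ _ h => liftPre_sound G h)
  map_id _ := rfl
  map_comp := by rintro _ _ _ ⟨_⟩ ⟨_⟩; rfl

theorem lift_map_whiskerRight (G : D ⥤ C) {X Y : FreeSym D} (f : X ⟶ Y) (Z : FreeSym D) :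
    (lift G).map (f ▷ Z) = (lift G).map f ▷ (lift G).obj Z := by
  induction f using Quotient.inductionOn; rfl

theorem lift_map_whiskerLeft (G : D ⥤ C) (X : FreeSym D) {Y Z : FreeSym D} (f : Y ⟶ Z) :
    (lift G).map (X ◁ f) = (lift G).obj X ◁ (lift G).map f := by
  induction f using Quotient.inductionOn; rfl

theorem lift_map_tensorHom (G : D ⥤ C) {X Y X' Y' : FreeSym D} (f : X ⟶ Y) (g : X' ⟶ Y') :
    (lift G).map (f ⊗ₘ g) = ((lift G).map f ⊗ₘ (lift G).map g : (lift G).obj X ⊗ (lift G).obj X' ⟶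
      (lift G).obj Y ⊗ (lift G).obj Y') := by
  rw [MonoidalCategory.tensorHom_def, MonoidalCategory.tensorHom_def, Functor.map_comp,
    lift_map_whiskerRight, lift_map_whiskerLeft]
  rfl

/-- The components of the extension of a natural transformation to tensor words. -/
def liftNatApp {G G' : D ⥤ C} (η : G ⟶ G') : ∀ X : FreeSym D, liftObj G X ⟶ liftObj G' X
  | of x => η.app x
  | unit => 𝟙 _
  | tensor X Y => liftNatApp η X ⊗ₘ liftNatApp η Y

theorem liftNatApp_naturality {G G' : D ⥤ C} (η : G ⟶ G') {X Y : FreeSym D} (f : PreHom X Y) :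
    liftPre G f ≫ liftNatApp η Y = liftNatApp η X ≫ liftPre G' f := by
  induction f with
  | of f => exact η.naturality f
  | id X => simp [liftPre]
  | comp f g ihf ihg =>
    dsimp only [liftPre]; rw [Category.assoc, ihg, ← Category.assoc, ihf, Category.assoc]
  | @whiskerLeft X Y Z f ih =>
    change (liftObj G X ◁ liftPre G f) ≫ (liftNatApp η X ⊗ₘ liftNatApp η Z) =
      (liftNatApp η X ⊗ₘ liftNatApp η Y) ≫ (liftObj G' X ◁ liftPre G' f)
    rw [← id_tensorHom, ← id_tensorHom, tensorHom_comp_tensorHom, tensorHom_comp_tensorHom, ih,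
      Category.id_comp, Category.comp_id]
  | @whiskerRight X Y f Z ih =>
    change (liftPre G f ▷ liftObj G Z) ≫ (liftNatApp η Y ⊗ₘ liftNatApp η Z) =
      (liftNatApp η X ⊗ₘ liftNatApp η Z) ≫ (liftPre G' f ▷ liftObj G' Z)
    rw [← tensorHom_id, ← tensorHom_id, tensorHom_comp_tensorHom, tensorHom_comp_tensorHom, ih,
      Category.id_comp, Category.comp_id]
  | assocHom X Y Z =>
    exact (associator_naturality (liftNatApp η X) (liftNatApp η Y) (liftNatApp η Z)).symm
  | assocInv X Y Z =>
    exact (associator_inv_naturality (liftNatApp η X) (liftNatApp η Y) (liftNatApp η Z)).symm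
  | leftHom X =>
    change (λ_ (liftObj G X)).hom ≫ liftNatApp η X =
      (𝟙 _ ⊗ₘ liftNatApp η X) ≫ (λ_ (liftObj G' X)).hom
    simp
  | leftInv X =>
    change (λ_ (liftObj G X)).inv ≫ (𝟙 _ ⊗ₘ liftNatApp η X) =
      liftNatApp η X ≫ (λ_ (liftObj G' X)).inv
    simp
  | rightHom X =>
    change (ρ_ (liftObj G X)).hom ≫ liftNatApp η X =
      (liftNatApp η X ⊗ₘ 𝟙 _) ≫ (ρ_ (liftObj G' X)).hom
    simp
  | rightInv X =>
    change (ρ_ (liftObj G X)).inv ≫ (liftNatApp η X ⊗ₘ 𝟙 _) =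
      liftNatApp η X ≫ (ρ_ (liftObj G' X)).inv
    simp
  | braid X Y =>
    exact (BraidedCategory.braiding_naturality (liftNatApp η X) (liftNatApp η Y)).symm

/-- The (monoidal) extension `η^⊗ : G^⊗ ⟶ G'^⊗` of a natural transformation `η : G ⟶ G'`. -/
def liftNat {G G' : D ⥤ C} (η : G ⟶ G') : lift G ⟶ lift G' where
  app := liftNatApp η
  naturality := by rintro X Y ⟨f⟩; exact liftNatApp_naturality η f

end Lift

/-- If `D` is a groupoid, so is `D^⊗`. -/
instance isIso_of_groupoid {D : Type u₁} [Groupoid.{v₁} D] {X Y : FreeSym D} (f : X ⟶ Y) :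
    IsIso f := by
  induction f using Quotient.inductionOn with | _ f
  induction f with
  | of f =>
    refine ⟨ofMap (Groupoid.inv f), ?_, ?_⟩
    · change ofMap f ≫ ofMap _ = _
      rw [← ofMap_comp, Groupoid.comp_inv, ofMap_id]
    · change ofMap _ ≫ ofMap f = _
      rw [← ofMap_comp, Groupoid.inv_comp, ofMap_id]
  | id X => exact inferInstanceAs (IsIso (𝟙 X))
  | @comp X Y Z f g ihf ihg =>
    exact IsIso.comp_isIso' (X := X) (Y := Y) (Z := Z) (f := ⟦f⟧) (h := ⟦g⟧) ihf ihg
  | @whiskerLeft X Y Z f ih =>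
    exact @MonoidalCategory.whiskerLeft_isIso (FreeSym D) _ _ X Y Z ⟦f⟧ ih
  | @whiskerRight X Y f Z ih =>
    exact @MonoidalCategory.whiskerRight_isIso (FreeSym D) _ _ X Y ⟦f⟧ Z ih
  | assocHom X Y Z => exact inferInstanceAs (IsIso (α_ X Y Z).hom)
  | assocInv X Y Z => exact inferInstanceAs (IsIso (α_ X Y Z).inv)
  | leftHom X => exact inferInstanceAs (IsIso (λ_ X).hom)
  | leftInv X => exact inferInstanceAs (IsIso (λ_ X).inv)
  | rightHom X => exact inferInstanceAs (IsIso (ρ_ X).hom)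
  | rightInv X => exact inferInstanceAs (IsIso (ρ_ X).inv)
  | braid X Y => exact inferInstanceAs (IsIso (β_ X Y).hom)

end FreeSym

/-! ### Feynman categories -/

section Feynman

variable {V : Type u₁} [Groupoid.{v₁} V] {F : Type u₂} [Category.{v₂} F] [MonoidalCategory F]
  [SymmetricCategory F]

/-- The groupoid `Iso (F ↓ V)`: its objects are the morphisms `X ⟶ ι v` of `F`, its morphisms are
the isomorphisms of such arrows. -/
abbrev BasicArrows (ι : V ⥤ F) := Core (Comma (𝟭 F) ι)

/-- The source `X₁ ⊗ ⋯ ⊗ Xₘ` of a formal tensor product of arrows `Xⱼ ⟶ ι vⱼ`. -/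
abbrev arrowSource (ι : V ⥤ F) : FreeSym (BasicArrows ι) ⥤ F :=
  FreeSym.lift (Core.inclusion _ ⋙ Comma.fst (𝟭 F) ι)

/-- The target `ι v₁ ⊗ ⋯ ⊗ ι vₘ` of a formal tensor product of arrows `Xⱼ ⟶ ι vⱼ`. -/
abbrev arrowTarget (ι : V ⥤ F) : FreeSym (BasicArrows ι) ⥤ F :=
  FreeSym.lift (Core.inclusion _ ⋙ Comma.snd (𝟭 F) ι ⋙ ι)

/-- The tensor product in `F` of a formal tensor product of arrows `Xⱼ ⟶ ι vⱼ`. -/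
abbrev arrowTensor (ι : V ⥤ F) : arrowSource ι ⟶ arrowTarget ι :=
  FreeSym.liftNat (Functor.whiskerLeft (Core.inclusion _) (Comma.natTrans (𝟭 F) ι))

/-- `(V, F, ι)` is a Feynman category. -/
structure IsFeynman (ι : V ⥤ F) : Prop where
  /-- Isomorphism condition: `ι^⊗ : V^⊗ ⟶ Iso F` is essentially surjective ... -/
  exists_iso : ∀ X : F, ∃ L : FreeSym V, Nonempty ((FreeSym.lift ι).obj L ≅ X)
  /-- ... and fully faithful. -/
  iso_full : ∀ {L L' : FreeSym V} (f : (FreeSym.lift ι).obj L ≅ (FreeSym.lift ι).obj L'),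
    ∃! g : L ⟶ L', (FreeSym.lift ι).map g = f.hom
  /-- Hereditary condition: the functor `Iso (F ↓ V)^⊗ ⟶ Iso (F ↓ F)` is essentially
  surjective ... -/
  exists_decomposition : ∀ {X Y : F} (f : X ⟶ Y), ∃ (W : FreeSym (BasicArrows ι))
    (p : (arrowSource ι).obj W ≅ X) (q : (arrowTarget ι).obj W ≅ Y),
    (arrowTensor ι).app W ≫ q.hom = p.hom ≫ f
  /-- ... and fully faithful. -/
  decomposition_full : ∀ {W W' : FreeSym (BasicArrows ι)}
    (p : (arrowSource ι).obj W ≅ (arrowSource ι).obj W')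
    (q : (arrowTarget ι).obj W ≅ (arrowTarget ι).obj W'),
    (arrowTensor ι).app W ≫ q.hom = p.hom ≫ (arrowTensor ι).app W' →
    ∃! g : W ⟶ W', (arrowSource ι).map g = p.hom ∧ (arrowTarget ι).map g = q.hom
  /-- Size condition. -/
  small : ∀ v : V, EssentiallySmall.{v₂} (Over (ι.obj v))

/-- A proper degree function on the morphisms of `F`. Basic morphisms are the morphisms
`v₁ ⊗ ⋯ ⊗ vₙ ⟶ v₀`. -/
structure ProperDegree (ι : V ⥤ F) where
  deg : ∀ {X Y : F}, (X ⟶ Y) → ℕ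
  deg_tensor : ∀ {X Y X' Y' : F} (f : X ⟶ Y) (g : X' ⟶ Y'), deg (f ⊗ₘ g) = deg f + deg g
  deg_comp : ∀ {X Y Z : F} (f : X ⟶ Y) (g : Y ⟶ Z), deg (f ≫ g) = deg f + deg g
  deg_eq_zero : ∀ {X Y : F} (f : X ⟶ Y), deg f = 0 ↔ IsIso f
  basic_generated : ∀ {L : FreeSym V} {v : V} (f : (FreeSym.lift ι).obj L ⟶ ι.obj v),
    MorphismProperty.multiplicativeClosure (fun _ _ g => deg g ≤ 1) f

namespace ProperDegree

variable {ι : V ⥤ F} (d : ProperDegree ι)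

theorem deg_id (X : F) : d.deg (𝟙 X) = 0 := (d.deg_eq_zero _).2 inferInstance

theorem deg_whiskerRight {X Y : F} (f : X ⟶ Y) (B : F) : d.deg (f ▷ B) = d.deg f := by
  rw [← tensorHom_id, d.deg_tensor, d.deg_id, add_zero]

/-- The number of morphisms of non-zero degree in a sequence of composable morphisms. -/
def pathLength {X : F} : ∀ {Y : F}, Quiver.Path X Y → ℕ
  | _, .nil => 0
  | _, .cons p f => pathLength p + if d.deg f = 0 then 0 else 1

/-- All morphisms of the sequence have degree `0` or `1`. -/
def PathPlus {X : F} : ∀ {Y : F}, Quiver.Path X Y → Prop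
  | _, .nil => True
  | _, .cons p f => PathPlus p ∧ d.deg f ≤ 1

theorem pathLength_comp {X Y Z : F} (p : Quiver.Path X Y) (q : Quiver.Path Y Z) :
    d.pathLength (p.comp q) = d.pathLength p + d.pathLength q := by
  induction q with
  | nil => rfl
  | cons q f ih => simp [pathLength, ih, add_assoc]

theorem pathPlus_comp {X Y Z : F} (p : Quiver.Path X Y) (q : Quiver.Path Y Z) :
    d.PathPlus (p.comp q) ↔ d.PathPlus p ∧ d.PathPlus q := by
  induction q with
  | nil => simp [PathPlus]
  | cons q f ih => simp [PathPlus, ih, and_assoc]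

/-- Tensoring all morphisms of a sequence with the identity of `B`. -/
def whiskerPath (B : F) {X : F} : ∀ {Y : F}, Quiver.Path X Y → Quiver.Path (X ⊗ B) (Y ⊗ B)
  | _, .nil => .nil
  | _, .cons p f => (whiskerPath B p).cons (f ▷ B)

theorem whiskerPath_comp (B : F) {X Y Z : F} (p : Quiver.Path X Y) (q : Quiver.Path Y Z) :
    whiskerPath B (p.comp q) = (whiskerPath B p).comp (whiskerPath B q) := by
  induction q with
  | nil => rfl
  | cons q f ih => simp [whiskerPath, ih]

/-- The elementary moves: deleting an identity, and composing two consecutive morphisms one of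
which has degree `0`. -/
inductive PathRel {X Y : F} : Quiver.Path X Y → Quiver.Path X Y → Prop
  | delete {A : F} (p : Quiver.Path X A) (q : Quiver.Path A Y) :
      PathRel ((p.cons (𝟙 A)).comp q) (p.comp q)
  | merge {A B C : F} (p : Quiver.Path X A) (f : A ⟶ B) (g : B ⟶ C) (q : Quiver.Path C Y)
      (h : d.deg f = 0 ∨ d.deg g = 0) :
      PathRel (((p.cons f).cons g).comp q) ((p.cons (f ≫ g)).comp q)

/-- Chains of composable morphisms from `X` to `Y`, in the order in which they are executed, modulo
the equivalence relation induced by composing morphisms of degree `0`. -/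
def Chain (X Y : F) := Quot (d.PathRel (X := X) (Y := Y))

namespace Chain

variable {d} {X Y Z : F}

/-- The number of morphisms of non-zero degree. -/
def length : d.Chain X Y → ℕ := Quot.lift d.pathLength (by
  rintro _ _ (⟨p, q⟩ | ⟨p, f, g, q, h⟩)
  · simp [pathLength_comp, pathLength, d.deg_id]
  · simp only [pathLength_comp, pathLength, d.deg_comp]
    rcases h with h | h <;> simp [h])

/-- All constituents have degree `0` or `1`. -/
def IsPlus : d.Chain X Y → Prop := Quot.lift d.PathPlus (by
  rintro _ _ (⟨p, q⟩ | ⟨p, f, g, q, h⟩)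
  · simp [pathPlus_comp, PathPlus, d.deg_id]
  · simp only [pathPlus_comp, PathPlus, d.deg_comp]
    rcases h with h | h <;> simp [h])

/-- The composition of the morphisms of a chain. -/
def value : d.Chain X Y → (X ⟶ Y) := Quot.lift composePath (by
  rintro _ _ (⟨p, q⟩ | ⟨p, f, g, q, h⟩) <;> simp)

variable (d) in
/-- The empty chain, which represents identity morphisms. -/
def nil (X : F) : d.Chain X X := Quot.mk _ .nil

variable (d) in
/-- The chain consisting of one morphism. -/
def single (f : X ⟶ Y) : d.Chain X Y := Quot.mk _ (Quiver.Path.nil.cons f)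

/-- Composition (concatenation) of chains. -/
def comp : d.Chain X Y → d.Chain Y Z → d.Chain X Z :=
  Quot.map₂ Quiver.Path.comp
    (by
      rintro p _ _ (⟨p', q⟩ | ⟨p', f, g, q, h⟩)
      · rw [← Quiver.Path.comp_assoc, ← Quiver.Path.comp_assoc]
        exact PathRel.delete (p.comp p') q
      · rw [← Quiver.Path.comp_assoc, ← Quiver.Path.comp_assoc]
        exact PathRel.merge (p.comp p') f g q h)
    (by
      rintro _ _ r (⟨p', q⟩ | ⟨p', f, g, q, h⟩)
      · simpa using PathRel.delete (d := d) p' (q.comp r)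
      · simpa using PathRel.merge (d := d) p' f g (q.comp r) h)

/-- The chain `γ ⊗ B`, all of whose constituents are tensored with the identity of `B`. -/
def whiskerRight (γ : d.Chain X Y) (B : F) : d.Chain (X ⊗ B) (Y ⊗ B) :=
  Quot.map (whiskerPath B)
    (by
      rintro _ _ (⟨p, q⟩ | ⟨p, f, g, q, h⟩)
      · rw [whiskerPath_comp, whiskerPath_comp, whiskerPath, id_whiskerRight]
        exact PathRel.delete _ _
      · rw [whiskerPath_comp, whiskerPath_comp, whiskerPath, whiskerPath, whiskerPath,
          comp_whiskerRight]
        exact PathRel.merge _ _ _ _ (by simpa only [d.deg_whiskerRight] using h)) γ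

theorem length_comp (γ : d.Chain X Y) (δ : d.Chain Y Z) :
    (γ.comp δ).length = γ.length + δ.length := by
  induction γ using Quot.ind
  induction δ using Quot.ind
  exact d.pathLength_comp _ _

theorem IsPlus.comp {γ : d.Chain X Y} {δ : d.Chain Y Z} (hγ : γ.IsPlus) (hδ : δ.IsPlus) :
    (γ.comp δ).IsPlus := by
  induction γ using Quot.ind
  induction δ using Quot.ind
  exact (d.pathPlus_comp _ _).2 ⟨hγ, hδ⟩

theorem IsPlus.nil : (Chain.nil d X).IsPlus := trivial

theorem IsPlus.single {f : X ⟶ Y} (hf : d.deg f ≤ 1) : (Chain.single d f).IsPlus := ⟨trivial, hf⟩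

theorem IsPlus.whiskerRight {γ : d.Chain X Y} (hγ : γ.IsPlus) (B : F) :
    (γ.whiskerRight B).IsPlus := by
  induction γ using Quot.ind with | _ p
  change d.PathPlus p at hγ
  change d.PathPlus (whiskerPath B p)
  induction p with
  | nil => trivial
  | cons p f ih => exact ⟨ih hγ.1, (d.deg_whiskerRight f B).trans_le hγ.2⟩

end Chain

/-- The set `Cₙ(X, Y)` of chains with `n` morphisms of non-zero degree. -/
abbrev ChainN (n : ℕ) (X Y : F) := {γ : d.Chain X Y // γ.length = n}

/-- Composition of chains `Cₙ(X, Y) × Cₘ(Y, Z) → Cₙ₊ₘ(X, Z)`. -/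
def ChainN.comp {d : ProperDegree ι} {n m : ℕ} {X Y Z : F} (γ : d.ChainN n X Y)
    (δ : d.ChainN m Y Z) : d.ChainN (n + m) X Z :=
  ⟨γ.1.comp δ.1, by rw [Chain.length_comp, γ.2, δ.2]⟩

end ProperDegree

/-- The inclusion `Sₙ × Sₘ → Sₙ₊ₘ`. -/
def permSum {n m : ℕ} (σ : Equiv.Perm (Fin n)) (τ : Equiv.Perm (Fin m)) :
    Equiv.Perm (Fin (n + m)) :=
  finSumFinEquiv.permCongr (Equiv.sumCongr σ τ)

/-- The two additional structures of a cubical Feynman category: a proper degree function, and free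
actions of `Sₙ` on the sets `Cₙ(X, Y)` which are compatible with composition of chains, restrict to
the sets `Cₙ⁺(X, Y)`, and for which composition of morphisms is a bijection from
`Cₙ⁺(X, Y) / Sₙ` to the set of morphisms `X ⟶ Y` of degree `n`. -/
structure CubicalStructure (ι : V ⥤ F) extends ProperDegree ι where
  permute : ∀ {n : ℕ} {X Y : F}, Equiv.Perm (Fin n) → toProperDegree.ChainN n X Y →
    toProperDegree.ChainN n X Y
  one_permute : ∀ {n : ℕ} {X Y : F} (γ : toProperDegree.ChainN n X Y), permute 1 γ = γ
  mul_permute : ∀ {n : ℕ} {X Y : F} (σ τ : Equiv.Perm (Fin n))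
    (γ : toProperDegree.ChainN n X Y), permute (σ * τ) γ = permute σ (permute τ γ)
  permute_free : ∀ {n : ℕ} {X Y : F} (σ : Equiv.Perm (Fin n))
    (γ : toProperDegree.ChainN n X Y), permute σ γ = γ → σ = 1
  permute_comp : ∀ {n m : ℕ} {X Y Z : F} (σ : Equiv.Perm (Fin n)) (τ : Equiv.Perm (Fin m))
    (γ : toProperDegree.ChainN n X Y) (δ : toProperDegree.ChainN m Y Z),
    (permute σ γ).comp (permute τ δ) = permute (permSum σ τ) (γ.comp δ)
  isPlus_permute : ∀ {n : ℕ} {X Y : F} (σ : Equiv.Perm (Fin n))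
    (γ : toProperDegree.ChainN n X Y), γ.1.IsPlus → (permute σ γ).1.IsPlus
  value_permute : ∀ {n : ℕ} {X Y : F} (σ : Equiv.Perm (Fin n))
    (γ : toProperDegree.ChainN n X Y), γ.1.IsPlus → (permute σ γ).1.value = γ.1.value
  value_injective : ∀ {n : ℕ} {X Y : F} (γ δ : toProperDegree.ChainN n X Y),
    γ.1.IsPlus → δ.1.IsPlus → γ.1.value = δ.1.value → ∃ σ, permute σ γ = δ
  value_surjective : ∀ {n : ℕ} {X Y : F} (f : X ⟶ Y), deg f = n →
    ∃ γ : toProperDegree.ChainN n X Y, γ.1.IsPlus ∧ γ.1.value = f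

end Feynman

/-! ### `T_V`-ops in graded vector spaces -/

section TreeOps

variable (k : Type w') [Field k] (V : Type u₁) [Groupoid.{v₁} V]

/-- The operations of a `T_V`-op `P` in graded vector spaces. The value of `P` on the corolla
`(v₁, …, vₙ; v₀)` is `P (v₁ ⊗ ⋯ ⊗ vₙ) v₀`, where `v₁ ⊗ ⋯ ⊗ vₙ` is an object of `V^⊗`. -/
structure TreeOpData (P : FreeSym V → V → Type w) [∀ X v, AddCommGroup (P X v)]
    [∀ X v, Module k (P X v)] where
  /-- The homogeneous elements of a given degree. -/
  homog : ∀ X v, ℤ → Submodule k (P X v)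
  /-- The action of the groupoid `Cor_V`: permutations of the leaves and isomorphisms of `V` on
  the leaves (`g`), and isomorphisms of `V` on the root (`h`). -/
  act : ∀ {X X' : FreeSym V} {v v' : V}, (X' ⟶ X) → (v ⟶ v') → P X v →ₗ[k] P X' v'
  /-- The value of the tree without vertices. -/
  one : ∀ v, P (.of v) v
  /-- Composition along a tree with one internal edge: the root of the second corolla is grafted
  to the first leaf of the first one. (The other leaves are reached by means of `act`.) -/
  comp : ∀ {B C : FreeSym V} {w v : V}, P (.of w ⊗ B) v →ₗ[k] P C w →ₗ[k] P (C ⊗ B) v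

/-- The morphism `X ⊗ (Y ⊗ Z) ⟶ Y ⊗ (X ⊗ Z)` which exchanges `X` and `Y`. -/
def leftComm {C : Type u₂} [Category.{v₂} C] [MonoidalCategory C] [SymmetricCategory C]
    (X Y Z : C) : X ⊗ (Y ⊗ Z) ⟶ Y ⊗ (X ⊗ Z) :=
  (α_ X Y Z).inv ≫ (β_ X Y).hom ▷ Z ≫ (α_ Y X Z).hom

theorem leftComm_naturality {C : Type u₂} [Category.{v₂} C] [MonoidalCategory C]
    [SymmetricCategory C] {X X' : C} (f : X ⟶ X') (Y Z : C) :
    f ▷ (Y ⊗ Z) ≫ leftComm X' Y Z = leftComm X Y Z ≫ Y ◁ (f ▷ Z) := by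
  simp only [leftComm, Category.assoc]
  rw [associator_inv_naturality_left_assoc, ← comp_whiskerRight_assoc,
    BraidedCategory.braiding_naturality_left, comp_whiskerRight_assoc, associator_naturality_middle]

theorem leftComm_leftComm {C : Type u₂} [Category.{v₂} C] [MonoidalCategory C]
    [SymmetricCategory C] (X Y Z : C) : leftComm X Y Z ≫ leftComm Y X Z = 𝟙 _ := by
  simp [leftComm, ← comp_whiskerRight_assoc]

/-- The Koszul sign `(-1)^(pq)`. -/
def koszulSign (p q : ℤ) : ℤ := ((p * q).negOnePow : ℤˣ)

variable {k V}

namespace TreeOpData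

variable {P : FreeSym V → V → Type w} [∀ X v, AddCommGroup (P X v)] [∀ X v, Module k (P X v)]

/-- The axioms of a `T_V`-op in graded vector spaces. -/
structure IsTreeOp (O : TreeOpData k V P) : Prop where
  internal : ∀ X v, DirectSum.IsInternal (O.homog X v)
  act_mem : ∀ {X X' : FreeSym V} {v v' : V} (g : X' ⟶ X) (h : v ⟶ v') {n : ℤ} {x : P X v},
    x ∈ O.homog X v n → O.act g h x ∈ O.homog X' v' n
  one_mem : ∀ v, O.one v ∈ O.homog (.of v) v 0
  comp_mem : ∀ {B C : FreeSym V} {w v : V} {p q : ℤ} {x : P (.of w ⊗ B) v} {y : P C w},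
    x ∈ O.homog _ _ p → y ∈ O.homog _ _ q → O.comp x y ∈ O.homog _ _ (p + q)
  act_id : ∀ {X : FreeSym V} {v : V} (x : P X v), O.act (𝟙 X) (𝟙 v) x = x
  act_act : ∀ {X X' X'' : FreeSym V} {v v' v'' : V} (g : X' ⟶ X) (h : v ⟶ v') (g' : X'' ⟶ X')
    (h' : v' ⟶ v'') (x : P X v), O.act g' h' (O.act g h x) = O.act (g' ≫ g) (h ≫ h') x
  /-- Composition is natural in all inputs and outputs, including the colour of the new edge. -/
  comp_act : ∀ {B B' C C' : FreeSym V} {w w' v v' : V} (f : w ⟶ w') (g : B' ⟶ B) (h : v ⟶ v')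
    (c : C' ⟶ C) (x : P (.of w' ⊗ B) v) (y : P C w),
    O.comp (O.act (FreeSym.ofMap f ⊗ₘ g) h x) (O.act c (𝟙 w) y) =
      O.act (c ⊗ₘ g) h (O.comp x (O.act (𝟙 C) f y))
  one_act : ∀ {v v' : V} (f : v ⟶ v'),
    O.act (FreeSym.ofMap f) (𝟙 v') (O.one v') = O.act (𝟙 (.of v)) f (O.one v)
  comp_one : ∀ {B : FreeSym V} {w v : V} (x : P (.of w ⊗ B) v), O.comp x (O.one w) = x
  one_comp : ∀ {C : FreeSym V} {v : V} (y : P C v),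
    O.comp (O.act (ρ_ (FreeSym.of v)).hom (𝟙 v) (O.one v)) y = O.act (ρ_ C).hom (𝟙 v) y
  /-- Associativity for trees in which the three vertices lie above each other. -/
  assoc : ∀ {B C D : FreeSym V} {u w v : V} (x : P (.of w ⊗ B) v) (y : P (.of u ⊗ C) w)
    (z : P D u),
    O.comp (O.act (α_ (.of u) C B).inv (𝟙 v) (O.comp x y)) z =
      O.act (α_ D C B).inv (𝟙 v) (O.comp x (O.comp y z))
  /-- Associativity for trees in which two vertices lie next to each other. -/
  parallel : ∀ {B C D : FreeSym V} {u w v : V} {p q : ℤ} (x : P (.of w ⊗ (.of u ⊗ B)) v)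
    (y : P C w) (z : P D u), y ∈ O.homog _ _ p → z ∈ O.homog _ _ q →
    O.comp (O.act (leftComm (.of u) C B) (𝟙 v) (O.comp x y)) z =
      koszulSign p q • O.act (leftComm D C B) (𝟙 v)
        (O.comp (O.act (leftComm (.of w) D B) (𝟙 v)
          (O.comp (O.act (leftComm (.of u) (.of w) B) (𝟙 v) x) z)) y)

/-- Morphisms of `T_V`-ops. -/
structure IsMorphism {Q : FreeSym V → V → Type*} [∀ X v, AddCommGroup (Q X v)]
    [∀ X v, Module k (Q X v)] (O : TreeOpData k V P) (O' : TreeOpData k V Q)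
    (φ : ∀ X v, P X v →ₗ[k] Q X v) : Prop where
  map_homog : ∀ {X v n} {x : P X v}, x ∈ O.homog X v n → φ X v x ∈ O'.homog X v n
  map_act : ∀ {X X' : FreeSym V} {v v' : V} (g : X' ⟶ X) (h : v ⟶ v') (x : P X v),
    φ X' v' (O.act g h x) = O'.act g h (φ X v x)
  map_one : ∀ v, φ (.of v) v (O.one v) = O'.one v
  map_comp : ∀ {B C : FreeSym V} {w v : V} (x : P (.of w ⊗ B) v) (y : P C w),
    φ (C ⊗ B) v (O.comp x y) = O'.comp (φ (.of w ⊗ B) v x) (φ C w y)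

/-- Membership in the operadic ideal generated by a family `S` of sets of elements. -/
inductive InIdeal (O : TreeOpData k V P) (S : ∀ X v, Set (P X v)) :
    ∀ {X : FreeSym V} {v : V}, P X v → Prop
  | mem {X v} {x : P X v} : x ∈ S X v → InIdeal O S x
  | zero (X v) : InIdeal O S (0 : P X v)
  | add {X v} {x y : P X v} : InIdeal O S x → InIdeal O S y → InIdeal O S (x + y)
  | smul {X v} (c : k) {x : P X v} : InIdeal O S x → InIdeal O S (c • x)
  | act {X X' : FreeSym V} {v v' : V} (g : X' ⟶ X) (h : v ⟶ v') {x : P X v} :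
      InIdeal O S x → InIdeal O S (O.act g h x)
  | comp_left {B C : FreeSym V} {w v : V} {x : P (.of w ⊗ B) v} (y : P C w) :
      InIdeal O S x → InIdeal O S (O.comp x y)
  | comp_right {B C : FreeSym V} {w v : V} (x : P (.of w ⊗ B) v) {y : P C w} :
      InIdeal O S y → InIdeal O S (O.comp x y)

theorem InIdeal.induction {O : TreeOpData k V P} {S : ∀ X v, Set (P X v)}
    (N : ∀ X v, Submodule k (P X v)) (hS : ∀ X v x, x ∈ S X v → x ∈ N X v)
    (hact : ∀ {X X' : FreeSym V} {v v' : V} (g : X' ⟶ X) (h : v ⟶ v') (x : P X v),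
      x ∈ N X v → O.act g h x ∈ N X' v')
    (hleft : ∀ {B C : FreeSym V} {w v : V} (x : P (.of w ⊗ B) v) (y : P C w),
      x ∈ N _ _ → O.comp x y ∈ N _ _)
    (hright : ∀ {B C : FreeSym V} {w v : V} (x : P (.of w ⊗ B) v) (y : P C w),
      y ∈ N _ _ → O.comp x y ∈ N _ _)
    {X : FreeSym V} {v : V} {x : P X v} (hx : O.InIdeal S x) : x ∈ N X v := by
  induction hx with
  | mem hx => exact hS _ _ _ hx
  | zero X v => exact zero_mem _
  | add _ _ ihx ihy => exact add_mem ihx ihy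
  | smul c _ ih => exact Submodule.smul_mem _ c ih
  | act g h _ ih => exact hact g h _ ih
  | comp_left y _ ih => exact hleft _ y ih
  | comp_right x _ ih => exact hright x _ ih

/-- The operadic ideal generated by `S`. -/
def ideal (O : TreeOpData k V P) (S : ∀ X v, Set (P X v)) (X : FreeSym V) (v : V) :
    Submodule k (P X v) where
  carrier := {x | InIdeal O S x}
  zero_mem' := .zero X v
  add_mem' := .add
  smul_mem' c _ := .smul c

/-- The underlying spaces of the quotient of `P` by the ideal generated by `S`. -/
abbrev Quo (O : TreeOpData k V P) (S : ∀ X v, Set (P X v)) (X : FreeSym V) (v : V) :=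
  P X v ⧸ O.ideal S X v

/-- The quotient of `P` by the ideal generated by `S`. -/
def quo (O : TreeOpData k V P) (S : ∀ X v, Set (P X v)) : TreeOpData k V (O.Quo S) where
  homog X v n := (O.homog X v n).map (O.ideal S X v).mkQ
  act g h := Submodule.mapQ _ _ (O.act g h) (fun _ hx => InIdeal.act g h hx)
  one v := (O.ideal S _ _).mkQ (O.one v)
  comp {B C w v} := Submodule.liftQ (O.ideal S (.of w ⊗ B) v)
    { toFun := fun x => Submodule.mapQ (O.ideal S C w) (O.ideal S (C ⊗ B) v) (O.comp x)
        (fun _ hy => InIdeal.comp_right x hy)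
      map_add' := fun x x' => Submodule.linearMap_qext _ (LinearMap.ext fun y => by
        simp [Submodule.mapQ_apply]; rfl)
      map_smul' := fun c x => Submodule.linearMap_qext _ (LinearMap.ext fun y => by
        simp [Submodule.mapQ_apply]; rfl) }
    (fun x hx => by
      refine LinearMap.mem_ker.2 (LinearMap.ext fun y => ?_)
      induction y using Submodule.Quotient.induction_on with | _ y
      exact (Submodule.Quotient.mk_eq_zero _).2 (InIdeal.comp_left y hx))

end TreeOpData

/-! ### Free `T_V`-ops -/

/-- A `Cor_V`-module: a functor from the groupoid of `V`-coloured corollas to vector spaces. -/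
structure CorModule (A : FreeSym V → V → Type w) [∀ X v, AddCommGroup (A X v)]
    [∀ X v, Module k (A X v)] where
  act : ∀ {X X' : FreeSym V} {v v' : V}, (X' ⟶ X) → (v ⟶ v') → A X v →ₗ[k] A X' v'
  act_id : ∀ {X : FreeSym V} {v : V} (x : A X v), act (𝟙 X) (𝟙 v) x = x
  act_act : ∀ {X X' X'' : FreeSym V} {v v' v'' : V} (g : X' ⟶ X) (h : v ⟶ v') (g' : X'' ⟶ X')
    (h' : v' ⟶ v'') (x : A X v), act g' h' (act g h x) = act (g' ≫ g) (h ≫ h') x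

/-- Formal composites (decorated trees together with a way of assembling them) of elements of
`A`. -/
inductive Term (A : FreeSym V → V → Type w) : FreeSym V → V → Type (max u₁ v₁ w)
  | gen {X : FreeSym V} {v : V} (a : A X v) : Term A X v
  | one (v : V) : Term A (.of v) v
  | act {X X' : FreeSym V} {v v' : V} (g : X' ⟶ X) (h : v ⟶ v') (t : Term A X v) : Term A X' v'
  | comp {B C : FreeSym V} {w v : V} (t : Term A (.of w ⊗ B) v) (s : Term A C w) :
      Term A (C ⊗ B) v

/-- The number of vertices. -/
def Term.weight {A : FreeSym V → V → Type w} : ∀ {X v}, Term A X v → ℕ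
  | _, _, .gen _ => 1
  | _, _, .one _ => 0
  | _, _, .act _ _ t => t.weight
  | _, _, .comp t s => t.weight + s.weight

section Free

variable {A : FreeSym V → V → Type w} [∀ X v, AddCommGroup (A X v)] [∀ X v, Module k (A X v)]

variable (k) in
/-- The basis vector of a formal composite. -/
noncomputable abbrev mono {X : FreeSym V} {v : V} (t : Term A X v) : Term A X v →₀ k :=
  Finsupp.single t 1

variable (k A) in
/-- Linear combinations of formal composites, all generators being placed in degree `d`. -/
noncomputable def preFree (d : ℤ) : TreeOpData k V (fun X v => Term A X v →₀ k) where
  homog _ _ n := Finsupp.supported k k {t | d * t.weight = n}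
  act g h := Finsupp.lmapDomain k k (Term.act g h)
  one v := mono k (.one v)
  comp := Finsupp.linearCombination k (fun t => Finsupp.lmapDomain k k (Term.comp t))

variable (M : CorModule (k := k) A) (d : ℤ)

/-- The relations of the free `T_V`-op: multilinearity and equivariance of the decorations, and
the axioms of a `T_V`-op. -/
inductive FreeRel : ∀ (X : FreeSym V) (v : V), Set (Term A X v →₀ k)
  | gen_add {X v} (a b : A X v) :
      FreeRel X v (mono k (.gen (a + b)) - (mono k (.gen a) + mono k (.gen b)))
  | gen_smul {X v} (c : k) (a : A X v) :
      FreeRel X v (mono k (.gen (c • a)) - c • mono k (.gen a))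
  | gen_act {X X' : FreeSym V} {v v' : V} (g : X' ⟶ X) (h : v ⟶ v') (a : A X v) :
      FreeRel X' v' (mono k (.act g h (.gen a)) - mono k (.gen (M.act g h a)))
  | act_id {X v} (t : Term A X v) : FreeRel X v (mono k (.act (𝟙 X) (𝟙 v) t) - mono k t)
  | act_act {X X' X'' : FreeSym V} {v v' v'' : V} (g : X' ⟶ X) (h : v ⟶ v') (g' : X'' ⟶ X')
      (h' : v' ⟶ v'') (t : Term A X v) :
      FreeRel X'' v'' (mono k (.act g' h' (.act g h t)) - mono k (.act (g' ≫ g) (h ≫ h') t))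
  | comp_act {B B' C C' : FreeSym V} {w w' v v' : V} (f : w ⟶ w') (g : B' ⟶ B) (h : v ⟶ v')
      (c : C' ⟶ C) (t : Term A (.of w' ⊗ B) v) (s : Term A C w) :
      FreeRel (C' ⊗ B') v' (mono k (.comp (.act (FreeSym.ofMap f ⊗ₘ g) h t) (.act c (𝟙 w) s)) -
        mono k (.act (c ⊗ₘ g) h (.comp t (.act (𝟙 C) f s))))
  | one_act {v v' : V} (f : v ⟶ v') :
      FreeRel (.of v) v' (mono k (.act (FreeSym.ofMap f) (𝟙 v') (.one v')) -
        mono k (.act (𝟙 (.of v)) f (.one v)))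
  | comp_one {B : FreeSym V} {w v : V} (t : Term A (.of w ⊗ B) v) :
      FreeRel (.of w ⊗ B) v (mono k (.comp t (.one w)) - mono k t)
  | one_comp {C : FreeSym V} {v : V} (s : Term A C v) :
      FreeRel (C ⊗ 𝟙_ _) v (mono k (.comp (.act (ρ_ (FreeSym.of v)).hom (𝟙 v) (.one v)) s) -
        mono k (.act (ρ_ C).hom (𝟙 v) s))
  | assoc {B C D : FreeSym V} {u w v : V} (t : Term A (.of w ⊗ B) v) (s : Term A (.of u ⊗ C) w)
      (r : Term A D u) :
      FreeRel (D ⊗ (C ⊗ B)) v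
        (mono k (.comp (.act (α_ (.of u) C B).inv (𝟙 v) (.comp t s)) r) -
          mono k (.act (α_ D C B).inv (𝟙 v) (.comp t (.comp s r))))
  | parallel {B C D : FreeSym V} {u w v : V} (t : Term A (.of w ⊗ (.of u ⊗ B)) v)
      (s : Term A C w) (r : Term A D u) :
      FreeRel (D ⊗ (C ⊗ B)) v
        (mono k (.comp (.act (leftComm (.of u) C B) (𝟙 v) (.comp t s)) r) -
          koszulSign (d * s.weight) (d * r.weight) •
            mono k (.act (leftComm D C B) (𝟙 v) (.comp (.act (leftComm (.of w) D B) (𝟙 v)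
              (.comp (.act (leftComm (.of u) (.of w) B) (𝟙 v) t) r)) s)))

/-- The underlying spaces of the free `T_V`-op on the `Cor_V`-module `A` placed in degree `d`. -/
abbrev FreeOp := (preFree k A d).Quo (FreeRel M d)

/-- The free `T_V`-op `Fr (A)` on the `Cor_V`-module `A` placed in degree `d`. -/
noncomputable def freeOp : TreeOpData k V (FreeOp M d) := (preFree k A d).quo (FreeRel M d)

/-- The inclusion of the generators `A → Fr (A)`. -/
noncomputable def freeGen {X : FreeSym V} {v : V} (a : A X v) : FreeOp M d X v :=
  Submodule.Quotient.mk (mono k (.gen a))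

/-- The subspace of `Fr (A)` of elements of weight `n`, spanned by the trees with `n` vertices. -/
noncomputable def freeWeight (n : ℕ) (X : FreeSym V) (v : V) : Submodule k (FreeOp M d X v) :=
  Submodule.span k {x | ∃ t : Term A X v, t.weight = n ∧ x = Submodule.Quotient.mk (mono k t)}

variable {P : FreeSym V → V → Type*} [∀ X v, AddCommGroup (P X v)] [∀ X v, Module k (P X v)]

/-- Evaluation of formal composites in an op. -/
def Term.eval (O : TreeOpData k V P) (f : ∀ X v, A X v →ₗ[k] P X v) :
    ∀ {X v}, Term A X v → P X v
  | _, _, .gen a => f _ _ a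
  | _, _, .one v => O.one v
  | _, _, .act g h t => O.act g h (t.eval O f)
  | _, _, .comp t s => O.comp (t.eval O f) (s.eval O f)

theorem Term.eval_mem {O : TreeOpData k V P} (hO : O.IsTreeOp) {f : ∀ X v, A X v →ₗ[k] P X v}
    (hd : ∀ X v a, f X v a ∈ O.homog X v d) {X v} (t : Term A X v) :
    t.eval O f ∈ O.homog X v (d * t.weight) := by
  induction t with
  | gen a => simpa [Term.weight, Term.eval] using hd _ _ a
  | one v => simpa [Term.weight, Term.eval] using hO.one_mem v
  | act g h t ih => exact hO.act_mem g h ih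
  | comp t s iht ihs => simpa [Term.weight, Term.eval, mul_add] using hO.comp_mem iht ihs

/-- Evaluation of linear combinations of formal composites in an op. -/
noncomputable def evalLin (O : TreeOpData k V P) (f : ∀ X v, A X v →ₗ[k] P X v)
    (X : FreeSym V) (v : V) : (Term A X v →₀ k) →ₗ[k] P X v :=
  Finsupp.linearCombination k (fun t => t.eval O f)

theorem evalLin_mono (O : TreeOpData k V P) (f : ∀ X v, A X v →ₗ[k] P X v)
    {X : FreeSym V} {v : V} (t : Term A X v) : evalLin O f X v (mono k t) = t.eval O f := by
  simp [evalLin]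

theorem evalLin_comp (O : TreeOpData k V P) (f : ∀ X v, A X v →ₗ[k] P X v)
    {B C : FreeSym V} {w v : V} (x : Term A (.of w ⊗ B) v →₀ k) (y : Term A C w →₀ k) :
    evalLin O f (C ⊗ B) v ((preFree k A d).comp x y) =
      O.comp (evalLin O f _ _ x) (evalLin O f _ _ y) := by
  induction x using Finsupp.induction_linear with
  | zero => simp
  | add x x' hx hx' => simp only [map_add, LinearMap.add_apply, hx, hx']
  | single t c =>
    induction y using Finsupp.induction_linear with
    | zero => simp
    | add y y' hy hy' => simp only [map_add, hy, hy']
    | single s c' => 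
      rw [← mul_one c, ← mul_one c', ← smul_eq_mul, ← smul_eq_mul, ← Finsupp.smul_single,
        ← Finsupp.smul_single]
      have : (preFree k A d).comp (mono k t) (mono k s) = mono k (.comp t s) := by
        simp [preFree]
      simp only [map_smul, LinearMap.smul_apply, this, evalLin_mono, Term.eval]

theorem evalLin_eq_zero {O : TreeOpData k V P} (hO : O.IsTreeOp) {f : ∀ X v, A X v →ₗ[k] P X v}
    (hf : ∀ {X X' v v'} (g : X' ⟶ X) (h : v ⟶ v') (a : A X v),
      f X' v' (M.act g h a) = O.act g h (f X v a))
    (hd : ∀ X v a, f X v a ∈ O.homog X v d) {X v} {x : Term A X v →₀ k}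
    (hx : (preFree k A d).InIdeal (FreeRel M d) x) : evalLin O f X v x = 0 := by
  refine LinearMap.mem_ker.1 (TreeOpData.InIdeal.induction (fun X v => LinearMap.ker (evalLin O f X v))
    ?_ ?_ ?_ ?_ hx) <;> simp only [LinearMap.mem_ker]
  · intro X v x hx
    cases hx <;> simp only [map_sub, map_add, map_smul, map_zsmul, evalLin_mono, Term.eval, hf,
      sub_eq_zero]
    case act_id => exact hO.act_id _
    case act_act => exact hO.act_act _ _ _ _ _
    case comp_act => exact hO.comp_act _ _ _ _ _ _
    case one_act => exact hO.one_act _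
    case comp_one => exact hO.comp_one _
    case one_comp => exact hO.one_comp _
    case assoc => exact hO.assoc _ _ _
    case parallel =>
      exact hO.parallel _ _ _ (Term.eval_mem d hO hd _) (Term.eval_mem d hO hd _)
  · intro X X' v v' g h x ih
    have key : evalLin O f X' v' ∘ₗ (preFree k A d).act g h = O.act g h ∘ₗ evalLin O f X v := by
      ext t
      simp [evalLin, preFree, Term.eval]
    have := LinearMap.congr_fun key x
    simpa [ih] using this
  · intro B C w v x y ih
    rw [evalLin_comp, ih, map_zero, LinearMap.zero_apply]
  · intro B C w v x y ih
    rw [evalLin_comp, ih, map_zero]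

/-- The morphism of `T_V`-ops `Fr (A) → P` which extends a morphism of `Cor_V`-modules `f` from `A`
to the degree `d` part of `P`. -/
noncomputable def freeLift {O : TreeOpData k V P} (hO : O.IsTreeOp)
    (f : ∀ X v, A X v →ₗ[k] P X v)
    (hf : ∀ {X X' v v'} (g : X' ⟶ X) (h : v ⟶ v') (a : A X v),
      f X' v' (M.act g h a) = O.act g h (f X v a))
    (hd : ∀ X v a, f X v a ∈ O.homog X v d) (X : FreeSym V) (v : V) :
    FreeOp M d X v →ₗ[k] P X v :=
  Submodule.liftQ _ (evalLin O f X v) (fun _ hx => evalLin_eq_zero M d hO hf hd hx)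

end Free

end TreeOps

/-! ### The linearization of a Feynman category, and its Koszul twist -/

section Linearization

variable (k : Type w') [Field k] {V : Type u₁} [Groupoid.{v₁} V] {F : Type u₂} [Category.{v₂} F]
  [MonoidalCategory F] [SymmetricCategory F]

/-- The set `F (v₁, …, vₙ; v₀)` of basic morphisms `v₁ ⊗ ⋯ ⊗ vₙ ⟶ v₀`. -/
abbrev Basic (ι : V ⥤ F) (X : FreeSym V) (v : V) := (FreeSym.lift ι).obj X ⟶ ι.obj v

/-- The action of `Cor_V` on basic morphisms. -/
def Basic.act {ι : V ⥤ F} {X X' : FreeSym V} {v v' : V} (g : X' ⟶ X) (h : v ⟶ v')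
    (φ : Basic ι X v) : Basic ι X' v' :=
  (FreeSym.lift ι).map g ≫ φ ≫ ι.map h

/-- The composition of basic morphisms along a tree with one internal edge. -/
def Basic.comp {ι : V ⥤ F} {B C : FreeSym V} {w v : V} (φ : Basic ι (.of w ⊗ B) v)
    (ψ : Basic ι C w) : Basic ι (C ⊗ B) v :=
  (ψ ▷ (FreeSym.lift ι).obj B : (FreeSym.lift ι).obj C ⊗ (FreeSym.lift ι).obj B ⟶
    ι.obj w ⊗ (FreeSym.lift ι).obj B) ≫ φ

/-- The identity morphism of an object of `V`. -/
def Basic.one (ι : V ⥤ F) (v : V) : Basic ι (.of v) v := 𝟙 (ι.obj v)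

theorem Basic.comp_act {ι : V ⥤ F} {B B' C C' : FreeSym V} {w w' v v' : V} (f : w ⟶ w')
    (g : B' ⟶ B) (h : v ⟶ v') (c : C' ⟶ C) (φ : Basic ι (.of w' ⊗ B) v) (ψ : Basic ι C w) :
    Basic.comp (Basic.act (FreeSym.ofMap f ⊗ₘ g) h φ) (Basic.act c (𝟙 w) ψ) =
      Basic.act (c ⊗ₘ g) h (Basic.comp φ (Basic.act (𝟙 C) f ψ)) := by
  have aux {B B' C C' W W' v v' : F} (f : W ⟶ W') (g : B' ⟶ B) (h : v ⟶ v') (c : C' ⟶ C)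
      (φ : W' ⊗ B ⟶ v) (ψ : C ⟶ W) (e : W ⟶ W) (he : e = 𝟙 W) (i : C ⟶ C) (hi : i = 𝟙 C) :
      (c ≫ ψ ≫ e) ▷ B' ≫ (f ⊗ₘ g) ≫ φ ≫ h =
        (c ⊗ₘ g) ≫ ((i ≫ ψ ≫ f) ▷ B ≫ φ) ≫ h := by
    simp [he, hi, MonoidalCategory.tensorHom_def, whisker_exchange_assoc]
  have := aux (ι.map f) ((FreeSym.lift ι).map g) (ι.map h) ((FreeSym.lift ι).map c) φ ψ
    (ι.map (𝟙 w)) (ι.map_id w) ((FreeSym.lift ι).map (𝟙 C)) ((FreeSym.lift ι).map_id C)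
  unfold Basic.comp Basic.act
  rw [FreeSym.lift_map_tensorHom, FreeSym.lift_map_tensorHom]
  exact this

theorem Basic.one_act {ι : V ⥤ F} {v v' : V} (f : v ⟶ v') :
    Basic.act (FreeSym.ofMap f) (𝟙 v') (Basic.one ι v') =
      Basic.act (𝟙 (.of v)) f (Basic.one ι v) := by
  change ι.map f ≫ 𝟙 (ι.obj v') ≫ ι.map (𝟙 v') = 𝟙 (ι.obj v) ≫ 𝟙 (ι.obj v) ≫ ι.map f
  simp

theorem Basic.comp_one {ι : V ⥤ F} {B : FreeSym V} {w v : V} (φ : Basic ι (.of w ⊗ B) v) :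
    Basic.comp φ (Basic.one ι w) = φ := by
  have aux {W B v : F} (φ : W ⊗ B ⟶ v) : 𝟙 W ▷ B ≫ φ = φ := by simp
  exact aux φ

theorem Basic.one_comp {ι : V ⥤ F} {C : FreeSym V} {v : V} (ψ : Basic ι C v) :
    Basic.comp (Basic.act (ρ_ (FreeSym.of v)).hom (𝟙 v) (Basic.one ι v)) ψ =
      Basic.act (ρ_ C).hom (𝟙 v) ψ := by
  have aux {C W : F} (e : W ⟶ W) (ψ : C ⟶ W) (he : e = 𝟙 W) :
      ψ ▷ 𝟙_ F ≫ (ρ_ W).hom ≫ 𝟙 W ≫ e = (ρ_ C).hom ≫ ψ ≫ e := by simp [he]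
  exact aux (ι.map (𝟙 v)) ψ (ι.map_id v)

theorem Basic.assoc {ι : V ⥤ F} {B C D : FreeSym V} {u w v : V} (φ : Basic ι (.of w ⊗ B) v)
    (ψ : Basic ι (.of u ⊗ C) w) (χ : Basic ι D u) :
    Basic.comp (Basic.act (α_ (.of u) C B).inv (𝟙 v) (Basic.comp φ ψ)) χ =
      Basic.act (α_ D C B).inv (𝟙 v) (Basic.comp φ (Basic.comp ψ χ)) := by
  have aux {B C D U W v : F} (e : v ⟶ v) (φ : W ⊗ B ⟶ v) (ψ : U ⊗ C ⟶ W) (χ : D ⟶ U) :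
      χ ▷ (C ⊗ B) ≫ (α_ U C B).inv ≫ (ψ ▷ B ≫ φ) ≫ e =
        (α_ D C B).inv ≫ ((χ ▷ C ≫ ψ) ▷ B ≫ φ) ≫ e := by
    simp
  exact aux (ι.map (𝟙 v)) φ ψ χ

theorem Basic.parallel {ι : V ⥤ F} {B C D : FreeSym V} {u w v : V}
    (φ : Basic ι (.of w ⊗ (.of u ⊗ B)) v) (ψ : Basic ι C w) (χ : Basic ι D u) :
    Basic.comp (Basic.act (leftComm (.of u) C B) (𝟙 v) (Basic.comp φ ψ)) χ =
      Basic.act (leftComm D C B) (𝟙 v) (Basic.comp (Basic.act (leftComm (.of w) D B) (𝟙 v)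
        (Basic.comp (Basic.act (leftComm (.of u) (.of w) B) (𝟙 v) φ) χ)) ψ) := by
  have aux {B C D U W v : F} (e : v ⟶ v) (φ : W ⊗ (U ⊗ B) ⟶ v) (ψ : C ⟶ W) (χ : D ⟶ U)
      (he : e = 𝟙 v) :
      χ ▷ (C ⊗ B) ≫ leftComm U C B ≫ (ψ ▷ (U ⊗ B) ≫ φ) ≫ e =
        leftComm D C B ≫ (ψ ▷ (D ⊗ B) ≫ leftComm W D B ≫
          (χ ▷ (W ⊗ B) ≫ leftComm U W B ≫ φ ≫ e) ≫ e) ≫ e := by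
    subst he
    simp only [Category.comp_id]
    rw [reassoc_of% (leftComm_naturality χ C B), reassoc_of% (leftComm_naturality χ W B),
      reassoc_of% (leftComm_leftComm W D B), whisker_exchange_assoc]
  exact aux (ι.map (𝟙 v)) φ ψ χ (ι.map_id v)

/-- The linearization of `F` as a `T_V`-op in vector spaces (placed in degree `0`). -/
noncomputable def linearization (ι : V ⥤ F) : TreeOpData k V (fun X v => Basic ι X v →₀ k) where
  homog _ _ n := if n = 0 then ⊤ else ⊥
  act g h := Finsupp.lmapDomain k k (Basic.act g h)
  one v := Finsupp.single (Basic.one ι v) 1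
  comp := Finsupp.linearCombination k (fun φ => Finsupp.lmapDomain k k (Basic.comp φ))

theorem linearization_act_single (ι : V ⥤ F) {X X' : FreeSym V} {v v' : V} (g : X' ⟶ X)
    (h : v ⟶ v') (φ : Basic ι X v) (c : k) :
    (linearization k ι).act g h (Finsupp.single φ c) = Finsupp.single (Basic.act g h φ) c := by
  simp [linearization]

theorem linearization_comp_single (ι : V ⥤ F) {B C : FreeSym V} {w v : V}
    (φ : Basic ι (.of w ⊗ B) v) (ψ : Basic ι C w) (a b : k) :
    (linearization k ι).comp (Finsupp.single φ a) (Finsupp.single ψ b) =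
      Finsupp.single (Basic.comp φ ψ) (a * b) := by
  have : (linearization k ι).comp (Finsupp.single φ 1) (Finsupp.single ψ 1) =
      Finsupp.single (Basic.comp φ ψ) (1 : k) := by simp [linearization]
  rw [← mul_one a, ← mul_one b, ← smul_eq_mul, ← smul_eq_mul, ← Finsupp.smul_single,
    ← Finsupp.smul_single, map_smul, map_smul, LinearMap.smul_apply, this, Finsupp.smul_single,
    Finsupp.smul_single]
  simp [mul_comm]

theorem linearization_isTreeOp (ι : V ⥤ F) : (linearization k ι).IsTreeOp where
  internal X v := by
    rw [DirectSum.isInternal_submodule_iff_iSupIndep_and_iSup_eq_top]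
    refine ⟨?_, ?_⟩
    · intro i
      by_cases hi : i = 0
      · subst hi
        refine Disjoint.mono_right (iSup₂_le fun j hj => ?_) disjoint_bot_right
        simp [linearization, hj]
      · simp [linearization, hi]
    · exact top_unique (le_iSup_of_le 0 (by simp [linearization]))
  act_mem {X X' v v'} g h n x hx := by
    by_cases hn : n = 0
    · simp [linearization, hn]
    · have : x = 0 := by simpa [linearization, hn] using hx
      rw [this, map_zero]; exact zero_mem _
  one_mem v := by simp [linearization]
  comp_mem {B C w v p q x y} hx hy := by
    by_cases hp : p = 0
    · by_cases hq : q = 0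
      · simp [linearization, hp, hq]
      · have : y = 0 := by simpa [linearization, hq] using hy
        rw [this, map_zero]; exact zero_mem _
    · have : x = 0 := by simpa [linearization, hp] using hx
      rw [this, map_zero, LinearMap.zero_apply]; exact zero_mem _
  act_id {X v} x := by
    induction x using Finsupp.induction_linear with
    | zero => simp
    | add x y hx hy => rw [map_add, hx, hy]
    | single φ c =>
      rw [linearization_act_single]
      simp [Basic.act]
  act_act {X X' X'' v v' v''} g h g' h' x := by
    induction x using Finsupp.induction_linear with
    | zero => simp
    | add x y hx hy => rw [map_add, map_add, map_add, hx, hy]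
    | single φ c =>
      rw [linearization_act_single, linearization_act_single, linearization_act_single]
      simp [Basic.act]
  comp_act {B B' C C' w w' v v'} f g h c x y := by
    induction x using Finsupp.induction_linear with
    | zero => simp
    | add x x' hx hx' => simp only [map_add, LinearMap.add_apply, hx, hx']
    | single φ a =>
      induction y using Finsupp.induction_linear with
      | zero => simp
      | add y y' hy hy' => simp only [map_add, hy, hy']
      | single ψ b =>
        simp only [linearization_act_single, linearization_comp_single]
        rw [Basic.comp_act]
  one_act {v v'} f := by
    change (linearization k ι).act _ _ (Finsupp.single (Basic.one ι v') 1) =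
      (linearization k ι).act _ _ (Finsupp.single (Basic.one ι v) 1)
    rw [linearization_act_single, linearization_act_single, Basic.one_act]
  comp_one {B w v} x := by
    change (linearization k ι).comp x (Finsupp.single (Basic.one ι w) 1) = _
    induction x using Finsupp.induction_linear with
    | zero => simp
    | add x y hx hy => rw [map_add, LinearMap.add_apply, hx, hy]
    | single φ c => rw [linearization_comp_single, Basic.comp_one, mul_one]
  one_comp {C v} y := by
    change (linearization k ι).comp ((linearization k ι).act _ _
        (Finsupp.single (Basic.one ι v) 1)) y = _
    induction y using Finsupp.induction_linear with
    | zero => simp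
    | add y y' hy hy' => rw [map_add, map_add, hy, hy']
    | single ψ c =>
      rw [linearization_act_single, linearization_comp_single, linearization_act_single,
        Basic.one_comp, one_mul]
  assoc {B C D u w v} x y z := by
    induction x using Finsupp.induction_linear with
    | zero => simp
    | add x x' hx hx' => simp only [map_add, LinearMap.add_apply, hx, hx']
    | single φ a =>
      induction y using Finsupp.induction_linear with
      | zero => simp
      | add y y' hy hy' => simp only [map_add, LinearMap.add_apply, hy, hy']
      | single ψ b =>
        induction z using Finsupp.induction_linear with
        | zero => simp
        | add z z' hz hz' => simp only [map_add, hz, hz']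
        | single χ c =>
          simp only [linearization_act_single, linearization_comp_single]
          rw [Basic.assoc, mul_assoc]
  parallel {B C D u w v p q} x y z hy hz := by
    have key : (linearization k ι).comp ((linearization k ι).act (leftComm (.of u) C B) (𝟙 v)
        ((linearization k ι).comp x y)) z = (linearization k ι).act (leftComm D C B) (𝟙 v)
        ((linearization k ι).comp ((linearization k ι).act (leftComm (.of w) D B) (𝟙 v)
          ((linearization k ι).comp
            ((linearization k ι).act (leftComm (.of u) (.of w) B) (𝟙 v) x) z)) y) := by
      clear hy hz
      induction x using Finsupp.induction_linear with
      | zero => simp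
      | add x x' hx hx' => simp only [map_add, LinearMap.add_apply, hx, hx']
      | single φ a =>
        induction y using Finsupp.induction_linear with
        | zero => simp
        | add y y' hy hy' => simp only [map_add, LinearMap.add_apply, hy, hy']
        | single ψ b =>
          induction z using Finsupp.induction_linear with
          | zero => simp
          | add z z' hz hz' => simp only [map_add, LinearMap.add_apply, hz, hz']
          | single χ c =>
            simp only [linearization_act_single, linearization_comp_single]
            rw [Basic.parallel, mul_right_comm]
    by_cases hp : p = 0
    · rw [key, hp, koszulSign, zero_mul, Int.negOnePow_zero, Units.val_one, one_smul]
    · have : y = 0 := by simpa [linearization, hp] using hy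
      simp [this]

end Linearization

/-! ### Quadratic presentations -/

section Quadratic

variable {k : Type w'} [Field k] {V : Type u₁} [Groupoid.{v₁} V]
  {A : FreeSym V → V → Type w} [∀ X v, AddCommGroup (A X v)] [∀ X v, Module k (A X v)]
  {P : FreeSym V → V → Type*} [∀ X v, AddCommGroup (P X v)] [∀ X v, Module k (P X v)]

/-- A quadratic presentation of a `T_V`-op `P`: a surjective morphism of `T_V`-ops `Fr (A) → P`
whose kernel is the operadic ideal generated by the elements of weight `2` of the kernel. -/
structure IsQuadraticPresentation (M : CorModule (k := k) A) (d : ℤ) (O : TreeOpData k V P)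
    (π : ∀ X v, FreeOp M d X v →ₗ[k] P X v) : Prop where
  isMorphism : (freeOp M d).IsMorphism O π
  surjective : ∀ X v, Function.Surjective (π X v)
  ker_eq : ∀ X v, LinearMap.ker (π X v) = (freeOp M d).ideal
    (fun X v => {x | x ∈ freeWeight M d 2 X v ∧ π X v x = 0}) X v

/-- The objectwise linear dual of a `Cor_V`-module, with the contragredient action. -/
noncomputable def CorModule.dual (M : CorModule (k := k) A) :
    CorModule (k := k) (fun X v => Module.Dual k (A X v)) where
  act g h := (M.act (inv g) (inv h)).dualMap
  act_id x := by
    ext a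
    simp [M.act_id]
  act_act g h g' h' x := by
    ext a
    simp [M.act_act]

end Quadratic

/-! ### Cubical Feynman categories: degree one generators, relations, quadratic dual and twist -/

section Cubical

variable (k : Type w') [Field k] {V : Type u₁} [Groupoid.{v₁} V] {F : Type u₂} [Category.{v₂} F]
  [MonoidalCategory F] [SymmetricCategory F] {ι : V ⥤ F}

/-- The set of basic morphisms of degree `1`. -/
abbrev BasicOne (d : ProperDegree ι) (X : FreeSym V) (v : V) := {φ : Basic ι X v // d.deg φ = 1}

theorem ProperDegree.deg_map_le (d : ProperDegree ι) {D : Type*} [Category* D] (G : D ⥤ F)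
    {X Y : D} (g : X ⟶ Y) [IsIso g] : d.deg (G.map g) ≤ 1 := by
  rw [(d.deg_eq_zero (G.map g)).2 inferInstance]
  exact zero_le_one

theorem ProperDegree.deg_act (d : ProperDegree ι) {X X' : FreeSym V} {v v' : V} (g : X' ⟶ X)
    (h : v ⟶ v') (φ : Basic ι X v) : d.deg (Basic.act g h φ) = d.deg φ := by
  unfold Basic.act
  rw [d.deg_comp, d.deg_comp, (d.deg_eq_zero ((FreeSym.lift ι).map g)).2 inferInstance,
    (d.deg_eq_zero (ι.map h)).2 inferInstance, zero_add, add_zero]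

/-- The action of `Cor_V` on the basic morphisms of degree `1`. -/
def BasicOne.act {d : ProperDegree ι} {X X' : FreeSym V} {v v' : V} (g : X' ⟶ X) (h : v ⟶ v')
    (φ : BasicOne d X v) : BasicOne d X' v' :=
  ⟨Basic.act g h φ.1, (d.deg_act g h φ.1).trans φ.2⟩

/-- The generators `A`: the `Cor_V`-module spanned by the basic morphisms of degree `1`. -/
noncomputable def degreeOne (d : ProperDegree ι) :
    CorModule (k := k) (fun X v => BasicOne d X v →₀ k) where
  act g h := Finsupp.lmapDomain k k (BasicOne.act g h)
  act_id {X v} x := by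
    have : (BasicOne.act (𝟙 X) (𝟙 v) : BasicOne d X v → _) = id := by
      funext φ; apply Subtype.ext; simp [BasicOne.act, Basic.act]
    simp [this]
  act_act {X X' X'' v v' v''} g h g' h' x := by
    have : (BasicOne.act (g' ≫ g) (h ≫ h') : BasicOne d X v → BasicOne d X'' v'') =
        BasicOne.act g' h' ∘ BasicOne.act g h := by
      funext φ; apply Subtype.ext; simp [BasicOne.act, Basic.act]
    simp [this, Finsupp.mapDomain_comp]

/-- The inclusion of the generators `A` into the linearization of `F`. -/
noncomputable def degreeOneInclusion (d : ProperDegree ι) (X : FreeSym V) (v : V) :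
    (BasicOne d X v →₀ k) →ₗ[k] (Basic ι X v →₀ k) :=
  Finsupp.lmapDomain k k Subtype.val

/-- The canonical morphism `π : Fr (A) → 𝔽` of `T_V`-ops, which composes morphisms along trees. -/
noncomputable def presentation (d : ProperDegree ι) (X : FreeSym V) (v : V) :
    FreeOp (degreeOne k d) 0 X v →ₗ[k] (Basic ι X v →₀ k) :=
  freeLift (degreeOne k d) 0 (linearization_isTreeOp k ι) (degreeOneInclusion k d)
    (fun g h a => by
      induction a using Finsupp.induction_linear with
      | zero => simp
      | add a b ha hb => simp only [map_add, ha, hb]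
      | single φ c =>
        simp [degreeOne, degreeOneInclusion, linearization_act_single, BasicOne.act])
    (fun X v a => by simp [linearization]) X v

/-- The basis vectors of the generators. -/
noncomputable def basisGen (d : ProperDegree ι) {X : FreeSym V} {v : V} (φ : BasicOne d X v) :
    BasicOne d X v →₀ k :=
  Finsupp.single φ 1

/-- The dual basis vectors of the linear dual of the generators. -/
noncomputable def dualGen (d : ProperDegree ι) {X : FreeSym V} {v : V} (φ : BasicOne d X v) :
    Module.Dual k (BasicOne d X v →₀ k) :=
  Finsupp.lapply φ

/-- `Reads e x γ`: the chain `γ` of morphisms of degree `0` and `1` from `v₁ ⊗ ⋯ ⊗ vₙ` to `v₀`, read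
as a flow chart, is the tree `x` whose vertices are decorated by the generators `e φ` attached to
the basic morphisms `φ` of degree `1` in the chain. (A chain that is executed before another one
sits further away from the root.) -/
inductive Reads {k : Type w'} [Field k] {d : ProperDegree ι}
    {A : FreeSym V → V → Type w} [∀ X v, AddCommGroup (A X v)]
    [∀ X v, Module k (A X v)] {M : CorModule (k := k) A} {n : ℤ}
    (e : ∀ {X v}, BasicOne d X v → A X v) :
    ∀ {X : FreeSym V} {v : V}, FreeOp M n X v →
      d.Chain ((FreeSym.lift ι).obj X) (ι.obj v) → Prop
  | one (v : V) : Reads e ((freeOp M n).one v) (.nil d (ι.obj v))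
  | act {X X' : FreeSym V} {v v' : V} (g : X' ⟶ X) (h : v ⟶ v') {x : FreeOp M n X v}
      {γ : d.Chain ((FreeSym.lift ι).obj X) (ι.obj v)} : Reads e x γ →
      Reads e ((freeOp M n).act g h x)
        (((ProperDegree.Chain.single d ((FreeSym.lift ι).map g)).comp γ).comp
          (.single d (ι.map h)))
  | comp {B C : FreeSym V} {w v : V} {x : FreeOp M n (.of w ⊗ B) v}
      {γ : d.Chain ((FreeSym.lift ι).obj (.of w ⊗ B)) (ι.obj v)} (φ : BasicOne d C w) :
      Reads e x γ →
      Reads e ((freeOp M n).comp x (freeGen M n (e φ)))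
        (((ProperDegree.Chain.single d φ.1).whiskerRight ((FreeSym.lift ι).obj B)).comp γ)

variable (c : CubicalStructure ι)

/-- The relations `τ γ - γ` for all chains `γ` of `n` morphisms of degree `1`, for all `n`, and all
transpositions `τ`. -/
def transpositionRel (X : FreeSym V) (v : V) :
    Set (FreeOp (degreeOne k c.toProperDegree) 0 X v) :=
  {r | ∃ (n : ℕ) (i j : Fin n) (γ : c.ChainN n ((FreeSym.lift ι).obj X) (ι.obj v))
    (x y : FreeOp (degreeOne k c.toProperDegree) 0 X v), i ≠ j ∧
    Reads (basisGen k c.toProperDegree) x γ.1 ∧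
    Reads (basisGen k c.toProperDegree) y (c.permute (Equiv.swap i j) γ).1 ∧ r = y - x}

/-- The relations `τ γ - γ` for all chains `γ` of two morphisms of degree `1` and the
transposition `τ = (1 2)`. -/
def quadraticRel (X : FreeSym V) (v : V) :
    Set (FreeOp (degreeOne k c.toProperDegree) 0 X v) :=
  {r | ∃ (γ : c.ChainN 2 ((FreeSym.lift ι).obj X) (ι.obj v))
    (x y : FreeOp (degreeOne k c.toProperDegree) 0 X v),
    Reads (basisGen k c.toProperDegree) x γ.1 ∧
    Reads (basisGen k c.toProperDegree) y (c.permute (Equiv.swap 0 1) γ).1 ∧ r = y - x}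

/-- The free `T_V`-op `Fr (Σ⁻¹ A*)` on the desuspended linear dual of the generators. -/
abbrev DualFree := FreeOp (degreeOne k c.toProperDegree).dual (-1)

/-- The relations of the quadratic dual: the functionals on the part of weight `2` of `Fr (A)` that
vanish on each `τ γ - γ`. Here a functional `ξ` is identified with an element of weight `2` of
`Fr (Σ⁻¹ A*)` by means of the given bases: the part of weight `2` of `Fr (A) (v₁, …, vₙ; v₀)` has
the basis of trees `t γ` decorated by basic morphisms of degree `1`, indexed by the chains `γ` in
`C₂⁺(v₁ ⊗ ⋯ ⊗ vₙ, v₀)`, and the dual basis vector of `t γ` corresponds to the tree `t' γ` decorated by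
the dual basis vectors of the decorations of `t γ`. -/
def dualRel (X : FreeSym V) (v : V) : Set (DualFree k c X v) :=
  {r | ∃ (t : {γ : c.ChainN 2 ((FreeSym.lift ι).obj X) (ι.obj v) // γ.1.IsPlus} →
        FreeOp (degreeOne k c.toProperDegree) 0 X v)
      (t' : {γ : c.ChainN 2 ((FreeSym.lift ι).obj X) (ι.obj v) // γ.1.IsPlus} → DualFree k c X v)
      (ξ : Module.Dual k (FreeOp (degreeOne k c.toProperDegree) 0 X v)),
    (∀ γ, Reads (basisGen k c.toProperDegree) (t γ) γ.1.1) ∧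
    (∀ γ, Reads (dualGen k c.toProperDegree) (t' γ) γ.1.1) ∧
    (∀ x ∈ quadraticRel k c X v, ξ x = 0) ∧ r = ∑ᶠ γ, ξ (t γ) • t' γ}

/-- The quadratic dual `𝔽^!` of the linearization of `F`. -/
noncomputable def quadraticDual :
    TreeOpData k V ((freeOp (degreeOne k c.toProperDegree).dual (-1)).Quo (dualRel k c)) :=
  (freeOp (degreeOne k c.toProperDegree).dual (-1)).quo (dualRel k c)

/-- The chains of morphisms of degree `0` and `1` from `v₁ ⊗ ⋯ ⊗ vₙ` to `v₀`. -/
abbrev PlusChain (d : ProperDegree ι) (X : FreeSym V) (v : V) :=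
  {γ : d.Chain ((FreeSym.lift ι).obj X) (ι.obj v) // γ.IsPlus}

/-- The span of the elements `σ γ - sgn (σ) γ`. -/
noncomputable def twistRel (X : FreeSym V) (v : V) : Submodule k (PlusChain c.toProperDegree X v →₀ k) :=
  Submodule.span k {r | ∃ (n : ℕ) (σ : Equiv.Perm (Fin n))
    (γ : c.ChainN n ((FreeSym.lift ι).obj X) (ι.obj v)) (h : γ.1.IsPlus),
    r = Finsupp.single ⟨(c.permute σ γ).1, c.isPlus_permute σ γ h⟩ 1 -
      (Equiv.Perm.sign σ : ℤ) • Finsupp.single ⟨γ.1, h⟩ 1}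

/-- The underlying spaces of the `𝔎`-twist `𝔽_𝔎`: the sum over `n` of the coinvariants of the
`Sₙ`-representation `k [Cₙ⁺(v₁ ⊗ ⋯ ⊗ vₘ, v₀)] ⊗ sgn`. -/
abbrev Twist (X : FreeSym V) (v : V) :=
  (PlusChain c.toProperDegree X v →₀ k) ⧸ twistRel k c X v

/-- The class of a chain in the `𝔎`-twist. -/
noncomputable def Twist.mk {X : FreeSym V} {v : V}
    (γ : c.Chain ((FreeSym.lift ι).obj X) (ι.obj v)) (hγ : γ.IsPlus) : Twist k c X v :=
  Submodule.Quotient.mk (Finsupp.single ⟨γ, hγ⟩ 1)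

/-- `K` is the structure of a `T_V`-op in graded vector spaces on the `𝔎`-twist which is induced by
the composition of chains; a chain of `n` morphisms of degree `1` is placed in degree `-n`. Since
the classes of chains span, there is at most one such structure. -/
structure IsKoszulTwist (K : TreeOpData k V (Twist k c)) : Prop where
  isTreeOp : K.IsTreeOp
  homog_eq : ∀ (X : FreeSym V) (v : V) (n : ℤ), K.homog X v n = Submodule.span k
    {x | ∃ (γ : c.Chain ((FreeSym.lift ι).obj X) (ι.obj v)) (hγ : γ.IsPlus),
      -(γ.length : ℤ) = n ∧ x = Twist.mk k c γ hγ}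
  act_mk : ∀ {X X' : FreeSym V} {v v' : V} (g : X' ⟶ X) (h : v ⟶ v')
    (γ : c.Chain ((FreeSym.lift ι).obj X) (ι.obj v)) (hγ : γ.IsPlus),
    K.act g h (Twist.mk k c γ hγ) = Twist.mk k c
      (((ProperDegree.Chain.single _ ((FreeSym.lift ι).map g)).comp γ).comp
        (.single _ (ι.map h)))
      (.comp (.comp (.single (c.deg_map_le _ _)) hγ) (.single (c.deg_map_le _ _)))
  one_eq : ∀ v : V, K.one v = Twist.mk k c (X := .of v) (.nil c.toProperDegree (ι.obj v)) .nil
  comp_mk : ∀ {B C : FreeSym V} {w v : V}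
    (γ : c.Chain ((FreeSym.lift ι).obj (.of w ⊗ B)) (ι.obj v)) (hγ : γ.IsPlus)
    (δ : c.Chain ((FreeSym.lift ι).obj C) (ι.obj w)) (hδ : δ.IsPlus),
    K.comp (Twist.mk k c γ hγ) (Twist.mk k c δ hδ) =
      Twist.mk k c (X := C ⊗ B) ((δ.whiskerRight ((FreeSym.lift ι).obj B)).comp γ)
        (.comp (hδ.whiskerRight _) hγ)

end Cubical

/-! ### Coherence of the exchange `leftComm` -/

section LeftComm

variable {C : Type u₂} [Category.{v₂} C] [MonoidalCategory C] [SymmetricCategory C]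

/-! The proof rests on a dictionary between chains and trees. By the hereditary condition a morphism
of degree 1 is, up to isomorphisms on both sides, `φ ⊗ B` for a basic morphism `φ` of degree 1. A
chain of n morphisms of degree 1 into `ι v` therefore builds a tree with n vertices, the first
morphism being farthest from the root. Such a chain has exactly one reading in the free operad,
whatever the degree of the generators (`IsFeynman.exists_reads`, `IsFeynman.reads_unique`), and the
readings span (`Reads.span_eq_top`). Uniqueness combines two facts: the first morphism of non-zero
degree of a chain is unique up to an isomorphism (`single_comp_eq_single_comp`), and an isomorphism
between `φ ⊗ B` and `φ' ⊗ B'` is a tensor product (`IsFeynman.exists_eq_tensorHom`). Both this and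
the cancellation properties used later come from following a single letter of a tensor word through
a formal morphism (`FreeSym.rem`, `FreeSym.ext_comp`).

The second ingredient is the effect of permutations on readings
(`IsFeynman.reads_sub_mem_of_signRel`). Adjacent transpositions generate Sₙ, and each of them
changes only two consecutive vertices `φ`, `ψ`. If `ψ` consumes the output of `φ`, the two form a
chain of length two with basic target, tensored with spectators. The cubical axioms do not relate
permutations to ⊗, but the transposition commutes with tensoring all the same (`swap_whiskerRight`):
chains of length two with equal composition agree up to the transposition, the action is free, and
tensoring with an object is injective on such chains. If `φ` and `ψ` lie on different branches, the
transposition is the exchange of their order (`swap_single_exchange`), and the two readings agree up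
to the Koszul sign by the parallel axiom. Hence an ideal which contains the relations of length two
contains those of all lengths, with the trivial character of Sₙ for generators of degree 0 and with
the sign for generators of degree -1.

In degree 0, chains with the same composition have congruent readings modulo the quadratic
relations, so every ideal containing these relations contains the kernel of π
(`ker_presentation_le`). Any family of relations between the quadratic ones and the kernel then
generates the kernel, which gives the first two parts.

In degree -1, exchanging chains on different tensor factors costs the Koszul sign
(`signRel_exchange`), which makes the twist an operad. The free operad maps to it by sending the
reading of a chain to its class. A functional that vanishes on `τγ - γ` takes the same value on `γ`
and `τγ`, whose classes are opposite, so the dual relations are killed. Conversely, the functional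
which extracts the coefficient of one morphism yields the relation `γ* + (τγ)*` (`add_mem_dualRel`),
so that reading chains as trees is a well-defined inverse. -/

theorem leftComm_naturality_right (X Y : C) {Z Z' : C} (h : Z ⟶ Z') :
    X ◁ Y ◁ h ≫ leftComm X Y Z' = leftComm X Y Z ≫ Y ◁ X ◁ h := by
  simp only [leftComm, Category.assoc]
  rw [associator_inv_naturality_right_assoc, whisker_exchange_assoc]
  simp

theorem leftComm_naturality_middle (X : C) {Y Y' : C} (g : Y ⟶ Y') (Z : C) :
    X ◁ (g ▷ Z) ≫ leftComm X Y' Z = leftComm X Y Z ≫ g ▷ (X ⊗ Z) := by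
  simp only [leftComm, Category.assoc]
  rw [associator_inv_naturality_middle_assoc, ← comp_whiskerRight_assoc,
    BraidedCategory.braiding_naturality_right]
  simp

/-- This identity and the four below are the cases of `ext_comp_pre` for associators, left unitors
and braidings in which a letter has to jump over a tensor factor. -/
theorem leftComm_associator_middle (W X Y Z : C) :
    (α_ W (X ⊗ Y) Z).inv ≫ leftComm W X Y ▷ Z ≫ (α_ X (W ⊗ Y) Z).hom =
      W ◁ (α_ X Y Z).hom ≫ leftComm W X (Y ⊗ Z) ≫ X ◁ (α_ W Y Z).inv := by
  simp only [leftComm]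
  monoidal

theorem leftComm_tensor (W X Y Z : C) :
    leftComm W (X ⊗ Y) Z ≫ (α_ X Y (W ⊗ Z)).hom =
      W ◁ (α_ X Y Z).hom ≫ leftComm W X (Y ⊗ Z) ≫ X ◁ leftComm W Y Z := by
  simp only [leftComm, BraidedCategory.braiding_tensor_right_hom]
  monoidal

theorem leftComm_unit (W X : C) : leftComm W (𝟙_ C) X ≫ (λ_ _).hom = W ◁ (λ_ X).hom := by
  simp only [leftComm, braiding_tensorUnit_right]
  monoidal

/-- Moving `W ⊗ X` past `Y` amounts to moving `X` first and then `W`; this is a hexagon. -/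
theorem leftComm_braiding (W X Y : C) :
    (α_ W X Y).inv ≫ (β_ (W ⊗ X) Y).hom = W ◁ (β_ X Y).hom ≫ leftComm W Y X := by
  simp only [leftComm, BraidedCategory.braiding_tensor_left_hom]
  monoidal

theorem leftComm_comp_braiding (W X Y : C) :
    leftComm W X Y ≫ (β_ X (W ⊗ Y)).hom = W ◁ (β_ X Y).hom ≫ (α_ W Y X).inv := by
  simp only [leftComm, BraidedCategory.braiding_tensor_right_hom, Category.assoc,
    Iso.hom_inv_id_assoc]
  rw [← comp_whiskerRight_assoc, SymmetricCategory.symmetry]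
  simp

end LeftComm

/-! ### Letters of a tensor word, and their removal -/

namespace FreeSym

section Letters

variable {D : Type u₁} [Category.{v₁} D]

/-- The positions of the letters of a tensor word. -/
def Pos : FreeSym D → Type
  | of _ => Unit
  | unit => Empty
  | tensor X Y => Pos X ⊕ Pos Y

/-- The letter at a given position. -/
def lab : ∀ X : FreeSym D, Pos X → D
  | of x, _ => x
  | tensor X _, .inl i => lab X i
  | tensor _ Y, .inr j => lab Y j

/-- The word in which a letter is replaced by the unit. -/
def del : ∀ X : FreeSym D, Pos X → FreeSym D
  | of _, _ => unit
  | tensor X Y, .inl i => tensor (del X i) Y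
  | tensor X Y, .inr j => tensor X (del Y j)

/-- The morphism which moves a letter from the front to its position. -/
def ext : ∀ (X : FreeSym D) (i : Pos X), of (lab X i) ⊗ del X i ⟶ X
  | of x, _ => (ρ_ (of x)).hom
  | tensor X Y, .inl i => (α_ (of (lab X i)) (del X i) Y).inv ≫ ext X i ▷ Y
  | tensor X Y, .inr j => leftComm (of (lab Y j)) X (del Y j) ≫ X ◁ ext Y j

/-- What a morphism `X ⟶ Y` of tensor words does to a letter of `X`: it is sent to a letter of `Y`
by a morphism of `D`, and the remaining letters of `X` are sent to the remaining letters of `Y`. -/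
structure Rem (X Y : FreeSym D) (i : Pos X) where
  /-- The position of the image of the letter. -/
  pos : Pos Y
  /-- The effect on the letter. -/
  hom : lab X i ⟶ lab Y pos
  /-- The effect on the remaining letters. -/
  rest : del X i ⟶ del Y pos

/-- The effect of a formal morphism on a letter. -/
def remPre : ∀ {X Y : FreeSym D} (_ : PreHom X Y) (i : Pos X), Rem X Y i
  | _, _, .of f, _ => ⟨(), f, 𝟙 unit⟩
  | _, _, .id X, i => ⟨i, 𝟙 _, 𝟙 _⟩
  | _, _, .comp f g, i =>
    ⟨(remPre g (remPre f i).pos).pos, (remPre f i).hom ≫ (remPre g (remPre f i).pos).hom,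
      (remPre f i).rest ≫ (remPre g (remPre f i).pos).rest⟩
  | _, _, .whiskerLeft X f, .inl i => ⟨.inl i, 𝟙 _, del X i ◁ (⟦f⟧ : _ ⟶ _)⟩
  | _, _, .whiskerLeft X f, .inr j =>
    ⟨.inr (remPre f j).pos, (remPre f j).hom, X ◁ (remPre f j).rest⟩
  | _, _, .whiskerRight f Z, .inl i =>
    ⟨.inl (remPre f i).pos, (remPre f i).hom, (remPre f i).rest ▷ Z⟩
  | _, _, .whiskerRight f Z, .inr j => ⟨.inr j, 𝟙 _, (⟦f⟧ : _ ⟶ _) ▷ del Z j⟩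
  | _, _, .assocHom X Y Z, .inl (.inl i) => ⟨.inl i, 𝟙 _, (α_ (del X i) Y Z).hom⟩
  | _, _, .assocHom X Y Z, .inl (.inr i) => ⟨.inr (.inl i), 𝟙 _, (α_ X (del Y i) Z).hom⟩
  | _, _, .assocHom X Y Z, .inr i => ⟨.inr (.inr i), 𝟙 _, (α_ X Y (del Z i)).hom⟩
  | _, _, .assocInv X Y Z, .inl i => ⟨.inl (.inl i), 𝟙 _, (α_ (del X i) Y Z).inv⟩
  | _, _, .assocInv X Y Z, .inr (.inl i) => ⟨.inl (.inr i), 𝟙 _, (α_ X (del Y i) Z).inv⟩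
  | _, _, .assocInv X Y Z, .inr (.inr i) => ⟨.inr i, 𝟙 _, (α_ X Y (del Z i)).inv⟩
  | _, _, .leftHom _, .inl i => i.elim
  | _, _, .leftHom X, .inr i => ⟨i, 𝟙 _, (λ_ (del X i)).hom⟩
  | _, _, .leftInv X, i => ⟨.inr i, 𝟙 _, (λ_ (del X i)).inv⟩
  | _, _, .rightHom X, .inl i => ⟨i, 𝟙 _, (ρ_ (del X i)).hom⟩
  | _, _, .rightHom _, .inr i => i.elim
  | _, _, .rightInv X, i => ⟨.inl i, 𝟙 _, (ρ_ (del X i)).inv⟩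
  | _, _, .braid X Y, .inl i => ⟨.inr i, 𝟙 _, (β_ (del X i) Y).hom⟩
  | _, _, .braid X Y, .inr i => ⟨.inl i, 𝟙 _, (β_ X (del Y i)).hom⟩

theorem Rem.mk_congr {X Y : FreeSym D} {i : Pos X} {j : Pos Y} {f f' : lab X i ⟶ lab Y j}
    {h h' : del X i ⟶ del Y j} (hf : f = f') (hh : h = h') :
    Rem.mk (X := X) (Y := Y) (i := i) j f h = Rem.mk j f' h' := by rw [hf, hh]

/-- Marking a letter turns each relation into one of the same kind among the words with that letter
deleted, together with a trivial identity for the effect on the letter. The cases in which the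
letter would belong to a unit are empty. -/
theorem remPre_sound {X Y : FreeSym D} {f g : PreHom X Y} (h : HomRel f g) (i : Pos X) :
    remPre f i = remPre g i := by
  induction h with
  | refl => rfl
  | symm _ ih => exact (ih i).symm
  | trans _ _ ih₁ ih₂ => exact (ih₁ i).trans (ih₂ i)
  | comp _ _ ih₁ ih₂ => dsimp only [remPre]; rw [ih₁, ih₂]
  | whiskerLeft X h ih =>
    rcases i with i | i
    · dsimp only [remPre]
      exact Rem.mk_congr rfl (congrArg (fun t => del X i ◁ t) (Quotient.sound h))
    · dsimp only [remPre]; rw [ih]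
  | whiskerRight X h ih =>
    rcases i with i | i
    · dsimp only [remPre]; rw [ih]
    · dsimp only [remPre]
      exact Rem.mk_congr rfl (congrArg (fun t => t ▷ del X i) (Quotient.sound h))
  | of_id x => rfl
  | of_comp f g => exact Rem.mk_congr rfl (Category.comp_id _).symm
  | id_comp f => exact Rem.mk_congr (Category.id_comp _) (Category.id_comp _)
  | comp_id f => exact Rem.mk_congr (Category.comp_id _) (Category.comp_id _)
  | assoc f g h => exact Rem.mk_congr (Category.assoc _ _ _) (Category.assoc _ _ _)
  | whiskerLeft_id X Y =>
    rcases i with i | i <;> dsimp only [remPre] <;> refine Rem.mk_congr rfl ?_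
    · exact MonoidalCategory.whiskerLeft_id _ _
    · exact MonoidalCategory.whiskerLeft_id _ _
  | id_whiskerRight X Y =>
    rcases i with i | i <;> dsimp only [remPre] <;> refine Rem.mk_congr rfl ?_
    · exact MonoidalCategory.id_whiskerRight _ _
    · exact MonoidalCategory.id_whiskerRight _ _
  | whiskerLeft_comp W f g =>
    rcases i with i | i <;> dsimp only [remPre]
    · refine Rem.mk_congr (Category.comp_id _).symm ?_
      exact whiskerLeft_comp' (del W i) ⟦f⟧ ⟦g⟧
    · refine Rem.mk_congr rfl ?_
      exact whiskerLeft_comp' _ _ _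
  | comp_whiskerRight f g W =>
    rcases i with i | i <;> dsimp only [remPre]
    · refine Rem.mk_congr rfl ?_
      exact comp_whiskerRight' _ _ _
    · refine Rem.mk_congr (Category.comp_id _).symm ?_
      exact comp_whiskerRight' ⟦f⟧ ⟦g⟧ (del W i)
  | @exchange W X Y Z f g =>
    rcases i with i | i <;> dsimp only [remPre]
    · exact Rem.mk_congr ((Category.id_comp _).trans (Category.comp_id _).symm)
        (exchange' (remPre f i).rest ⟦g⟧)
    · exact Rem.mk_congr ((Category.comp_id _).trans (Category.id_comp _).symm)
        (exchange' ⟦f⟧ (remPre g i).rest)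
  | assoc_hom_inv X Y Z =>
    rcases i with (i | i) | i <;> refine Rem.mk_congr (Category.comp_id _) ?_
    · exact (α_ (del X i) Y Z).hom_inv_id
    · exact (α_ X (del Y i) Z).hom_inv_id
    · exact (α_ X Y (del Z i)).hom_inv_id
  | assoc_inv_hom X Y Z =>
    rcases i with i | i | i <;> refine Rem.mk_congr (Category.comp_id _) ?_
    · exact (α_ (del X i) Y Z).inv_hom_id
    · exact (α_ X (del Y i) Z).inv_hom_id
    · exact (α_ X Y (del Z i)).inv_hom_id
  | assoc_nat_left f Y Z =>
    rcases i with (i | i) | i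
    · exact Rem.mk_congr ((Category.comp_id _).trans (Category.id_comp _).symm)
        (assoc_nat_left' _ _ _)
    · exact Rem.mk_congr rfl (assoc_nat_left' ⟦f⟧ _ _)
    · exact Rem.mk_congr rfl (assoc_nat_left' ⟦f⟧ _ _)
  | assoc_nat_middle X f Z =>
    rcases i with (i | i) | i
    · exact Rem.mk_congr rfl (assoc_nat_middle' _ ⟦f⟧ _)
    · exact Rem.mk_congr ((Category.comp_id _).trans (Category.id_comp _).symm)
        (assoc_nat_middle' _ _ _)
    · exact Rem.mk_congr rfl (assoc_nat_middle' _ ⟦f⟧ _)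
  | assoc_nat_right X Y f =>
    rcases i with (i | i) | i
    · exact Rem.mk_congr rfl (assoc_nat_right' _ _ ⟦f⟧)
    · exact Rem.mk_congr rfl (assoc_nat_right' _ _ ⟦f⟧)
    · exact Rem.mk_congr ((Category.comp_id _).trans (Category.id_comp _).symm)
        (assoc_nat_right' _ _ _)
  | left_hom_inv X =>
    rcases i with i | i
    · exact i.elim
    · exact Rem.mk_congr (Category.comp_id _) (λ_ (del X i)).hom_inv_id
  | left_inv_hom X => exact Rem.mk_congr (Category.comp_id _) (λ_ (del X i)).inv_hom_id
  | left_nat f =>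
    rcases i with i | i
    · exact i.elim
    · exact Rem.mk_congr ((Category.comp_id _).trans (Category.id_comp _).symm)
        (leftUnitor_naturality _)
  | right_hom_inv X =>
    rcases i with i | i
    · exact Rem.mk_congr (Category.comp_id _) (ρ_ (del X i)).hom_inv_id
    · exact i.elim
  | right_inv_hom X => exact Rem.mk_congr (Category.comp_id _) (ρ_ (del X i)).inv_hom_id
  | right_nat f =>
    rcases i with i | i
    · exact Rem.mk_congr ((Category.comp_id _).trans (Category.id_comp _).symm)
        (rightUnitor_naturality _)
    · exact i.elim
  | pentagon W X Y Z =>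
    rcases i with ((i | i) | i) | i <;>
      exact Rem.mk_congr (Category.id_comp _) (MonoidalCategory.pentagon _ _ _ _)
  | triangle X Y =>
    rcases i with (i | i) | i
    · exact Rem.mk_congr (Category.comp_id _) (MonoidalCategory.triangle _ _)
    · exact i.elim
    · exact Rem.mk_congr (Category.comp_id _) (MonoidalCategory.triangle _ _)
  | braid_nat_right X f =>
    rcases i with i | i <;> dsimp only [remPre]
    · refine Rem.mk_congr rfl ?_
      exact BraidedCategory.braiding_naturality_right (del X i) ⟦f⟧
    · refine Rem.mk_congr ((Category.comp_id _).trans (Category.id_comp _).symm) ?_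
      exact BraidedCategory.braiding_naturality_right X _
  | braid_nat_left f Z =>
    rcases i with i | i <;> dsimp only [remPre]
    · refine Rem.mk_congr ((Category.comp_id _).trans (Category.id_comp _).symm) ?_
      exact BraidedCategory.braiding_naturality_left _ Z
    · refine Rem.mk_congr rfl ?_
      exact BraidedCategory.braiding_naturality_left ⟦f⟧ (del Z i)
  | hexagon_forward X Y Z =>
    rcases i with (i | i) | i <;>
      exact Rem.mk_congr rfl (BraidedCategory.hexagon_forward _ _ _)
  | hexagon_reverse X Y Z =>
    rcases i with i | i | i <;>
      exact Rem.mk_congr rfl (BraidedCategory.hexagon_reverse _ _ _)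
  | symmetry X Y =>
    rcases i with i | i <;> refine Rem.mk_congr (Category.comp_id _) ?_
    · exact SymmetricCategory.symmetry (del X i) Y
    · exact SymmetricCategory.symmetry X (del Y i)

/-- The effect of a morphism on a letter. -/
def rem {X Y : FreeSym D} (f : X ⟶ Y) (i : Pos X) : Rem X Y i :=
  Quotient.lift (fun f => remPre f i) (fun _ _ h => remPre_sound h i) f

/-- Naturality passes to composites and whiskerings, so only the structure maps matter; for these it
is a coherence identity of `leftComm`, chosen by the factor which contains the letter. Inverse maps
are mostly reduced to the forward ones by cancelling an isomorphism. -/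
theorem ext_comp_pre {X Y : FreeSym D} (f : PreHom X Y) (i : Pos X) :
    ext X i ≫ (⟦f⟧ : X ⟶ Y) =
      (ofMap (remPre f i).hom ⊗ₘ (remPre f i).rest) ≫ ext Y (remPre f i).pos := by
  induction f with
  | of f =>
    change (ρ_ _).hom ≫ ofMap f = (ofMap f ⊗ₘ 𝟙 (𝟙_ (FreeSym D))) ≫ (ρ_ _).hom
    simp
  | id X =>
    change ext X i ≫ 𝟙 X = (ofMap (𝟙 _) ⊗ₘ 𝟙 _) ≫ ext X i
    simp [ofMap_id]
  | @comp X Y Z f g ihf ihg =>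
    change ext X i ≫ (⟦f⟧ : X ⟶ Y) ≫ (⟦g⟧ : Y ⟶ Z) =
      (ofMap ((remPre f i).hom ≫ (remPre g (remPre f i).pos).hom) ⊗ₘ
        ((remPre f i).rest ≫ (remPre g (remPre f i).pos).rest)) ≫ ext Z (remPre g (remPre f i).pos).pos
    rw [← Category.assoc, ihf, Category.assoc, ihg, ofMap_comp, ← tensorHom_comp_tensorHom,
      Category.assoc]
  | @whiskerLeft X Y Z f ih =>
    rcases i with i | i
    · change ((α_ _ _ _).inv ≫ ext X i ▷ Y) ≫ X ◁ (⟦f⟧ : Y ⟶ Z) =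
        (ofMap (𝟙 _) ⊗ₘ (del X i ◁ (⟦f⟧ : Y ⟶ Z))) ≫ (α_ _ _ _).inv ≫ ext X i ▷ Z
      rw [ofMap_id, Category.assoc, ← whisker_exchange]
      simp
    · change (leftComm _ X _ ≫ X ◁ ext Y i) ≫ X ◁ (⟦f⟧ : Y ⟶ Z) =
        (ofMap (remPre f i).hom ⊗ₘ X ◁ (remPre f i).rest) ≫ leftComm _ X _ ≫ X ◁ ext Z _
      rw [Category.assoc, ← MonoidalCategory.whiskerLeft_comp, ih,
        MonoidalCategory.tensorHom_def, MonoidalCategory.tensorHom_def]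
      simp only [Category.assoc, MonoidalCategory.whiskerLeft_comp]
      rw [reassoc_of% (leftComm_naturality_right (of (lab Z (remPre f i).pos)) X (remPre f i).rest),
        reassoc_of% (leftComm_naturality (ofMap (remPre f i).hom) X (del Y i))]
  | @whiskerRight X Y f Z ih =>
    rcases i with i | i
    · change ((α_ _ _ _).inv ≫ ext X i ▷ Z) ≫ (⟦f⟧ : X ⟶ Y) ▷ Z =
        (ofMap (remPre f i).hom ⊗ₘ (remPre f i).rest ▷ Z) ≫ (α_ _ _ _).inv ≫ ext Y _ ▷ Z
      rw [Category.assoc, ← comp_whiskerRight, ih, MonoidalCategory.tensorHom_def,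
        MonoidalCategory.tensorHom_def]
      simp
    · change (leftComm _ X _ ≫ X ◁ ext Z i) ≫ (⟦f⟧ : X ⟶ Y) ▷ Z =
        (ofMap (𝟙 _) ⊗ₘ (⟦f⟧ : X ⟶ Y) ▷ del Z i) ≫ leftComm _ Y _ ≫ Y ◁ ext Z i
      rw [ofMap_id, id_tensorHom, reassoc_of% (leftComm_naturality_middle (of (lab Z i))
        (⟦f⟧ : X ⟶ Y) (del Z i)), Category.assoc, whisker_exchange]
  | assocHom X Y Z =>
    rcases i with (i | i) | i
    · change ((α_ _ _ _).inv ≫ ((α_ _ _ _).inv ≫ ext X i ▷ Y) ▷ Z) ≫ (α_ _ _ _).hom =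
        (ofMap (𝟙 _) ⊗ₘ (α_ (del X i) Y Z).hom) ≫ (α_ _ _ _).inv ≫ ext X i ▷ (Y ⊗ Z)
      rw [ofMap_id, id_tensorHom]
      monoidal
    · change ((α_ _ _ _).inv ≫ (leftComm _ X _ ≫ X ◁ ext Y i) ▷ Z) ≫ (α_ _ _ _).hom =
        (ofMap (𝟙 _) ⊗ₘ (α_ X (del Y i) Z).hom) ≫ leftComm _ X _ ≫
          X ◁ ((α_ _ _ _).inv ≫ ext Y i ▷ Z)
      rw [ofMap_id, id_tensorHom, MonoidalCategory.whiskerLeft_comp,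
        ← reassoc_of% (leftComm_associator_middle (of (lab Y i)) X (del Y i) Z)]
      simp
    · change (leftComm _ (X ⊗ Y) _ ≫ (X ⊗ Y) ◁ ext Z i) ≫ (α_ X Y Z).hom =
        (ofMap (𝟙 _) ⊗ₘ (α_ X Y (del Z i)).hom) ≫ leftComm _ X _ ≫
          X ◁ (leftComm _ Y _ ≫ Y ◁ ext Z i)
      rw [ofMap_id, id_tensorHom, MonoidalCategory.whiskerLeft_comp,
        ← reassoc_of% (leftComm_tensor (of (lab Z i)) X Y (del Z i))]
      simp
  | assocInv X Y Z =>
    rcases i with i | i | i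
    · change ((α_ _ _ _).inv ≫ ext X i ▷ (Y ⊗ Z)) ≫ (α_ _ _ _).inv =
        (ofMap (𝟙 _) ⊗ₘ (α_ (del X i) Y Z).inv) ≫ (α_ _ _ _).inv ≫
          ((α_ _ _ _).inv ≫ ext X i ▷ Y) ▷ Z
      rw [ofMap_id, id_tensorHom]
      monoidal
    · change (leftComm _ X _ ≫ X ◁ ((α_ _ _ _).inv ≫ ext Y i ▷ Z)) ≫ (α_ X Y Z).inv =
        (ofMap (𝟙 _) ⊗ₘ (α_ X (del Y i) Z).inv) ≫ (α_ _ _ _).inv ≫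
          (leftComm _ X _ ≫ X ◁ ext Y i) ▷ Z
      rw [ofMap_id, id_tensorHom, ← cancel_epi (_ ◁ (α_ X (del Y i) Z).hom),
        MonoidalCategory.whiskerLeft_comp]
      simp only [Category.assoc]
      rw [← reassoc_of% (leftComm_associator_middle (of (lab Y i)) X (del Y i) Z)]
      simp
    · change (leftComm _ X _ ≫ X ◁ (leftComm _ Y _ ≫ Y ◁ ext Z i)) ≫ (α_ X Y Z).inv =
        (ofMap (𝟙 _) ⊗ₘ (α_ X Y (del Z i)).inv) ≫ leftComm _ (X ⊗ Y) _ ≫ (X ⊗ Y) ◁ ext Z i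
      rw [ofMap_id, id_tensorHom, ← cancel_epi (_ ◁ (α_ X Y (del Z i)).hom),
        MonoidalCategory.whiskerLeft_comp]
      simp only [Category.assoc]
      rw [← reassoc_of% (leftComm_tensor (of (lab Z i)) X Y (del Z i))]
      simp
  | leftHom X =>
    rcases i with i | i
    · exact i.elim
    · change (leftComm _ (𝟙_ _) _ ≫ 𝟙_ _ ◁ ext X i) ≫ (λ_ X).hom =
        (ofMap (𝟙 _) ⊗ₘ (λ_ (del X i)).hom) ≫ ext X i
      rw [ofMap_id, id_tensorHom, ← leftComm_unit]
      simp
  | leftInv X =>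
    change ext X i ≫ (λ_ X).inv = (ofMap (𝟙 _) ⊗ₘ (λ_ (del X i)).inv) ≫
      leftComm _ (𝟙_ _) _ ≫ 𝟙_ _ ◁ ext X i
    rw [ofMap_id, id_tensorHom, ← cancel_epi (_ ◁ (λ_ (del X i)).hom),
      ← cancel_mono (λ_ X).hom, ← leftComm_unit]
    simp only [Category.assoc, Iso.inv_hom_id, Category.comp_id, leftUnitor_naturality]
    rw [reassoc_of% (leftComm_unit (of (lab X i)) (del X i)),
      ← MonoidalCategory.whiskerLeft_comp_assoc, Iso.inv_hom_id,
      MonoidalCategory.whiskerLeft_id, Category.id_comp,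
      reassoc_of% (leftComm_unit (of (lab X i)) (del X i))]
  | rightHom X =>
    rcases i with i | i
    · change ((α_ _ _ _).inv ≫ ext X i ▷ 𝟙_ _) ≫ (ρ_ X).hom =
        (ofMap (𝟙 _) ⊗ₘ (ρ_ (del X i)).hom) ≫ ext X i
      rw [ofMap_id, id_tensorHom]
      monoidal
    · exact i.elim
  | rightInv X =>
    change ext X i ≫ (ρ_ X).inv = (ofMap (𝟙 _) ⊗ₘ (ρ_ (del X i)).inv) ≫
      (α_ _ _ _).inv ≫ ext X i ▷ 𝟙_ _
    rw [ofMap_id, id_tensorHom]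
    monoidal
  | braid X Y =>
    rcases i with i | i
    · change ((α_ _ _ _).inv ≫ ext X i ▷ Y) ≫ (β_ X Y).hom =
        (ofMap (𝟙 _) ⊗ₘ (β_ (del X i) Y).hom) ≫ leftComm _ Y _ ≫ Y ◁ ext X i
      rw [ofMap_id, id_tensorHom, ← reassoc_of% (leftComm_braiding (of (lab X i)) (del X i) Y)]
      simp
    · change (leftComm _ X _ ≫ X ◁ ext Y i) ≫ (β_ X Y).hom =
        (ofMap (𝟙 _) ⊗ₘ (β_ X (del Y i)).hom) ≫ (α_ _ _ _).inv ≫ ext Y i ▷ X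
      rw [ofMap_id, id_tensorHom,
        ← reassoc_of% (leftComm_comp_braiding (of (lab Y i)) X (del Y i))]
      simp

/-- Moving a letter to its position is natural. -/
theorem ext_comp {X Y : FreeSym D} (f : X ⟶ Y) (i : Pos X) :
    ext X i ≫ f = (ofMap (rem f i).hom ⊗ₘ (rem f i).rest) ≫ ext Y (rem f i).pos := by
  induction f using Quotient.inductionOn with | _ f
  exact ext_comp_pre f i

end Letters

end FreeSym

/-! ### Cancellation in free symmetric monoidal categories -/

namespace FreeSym

section Cancellation

variable {D : Type u₁} [Category.{v₁} D]

/-- The position of a letter of the left factor. -/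
def Pos.left {X : FreeSym D} (i : Pos X) (Y : FreeSym D) : Pos (X ⊗ Y) := Sum.inl i

/-- The position of the first letter. -/
def Pos.first (a : D) (W : FreeSym D) : Pos (of a ⊗ W) := Sum.inl ()

theorem rem_comp_pos {X Y Z : FreeSym D} (f : X ⟶ Y) (g : Y ⟶ Z) (i : Pos X) :
    (rem (f ≫ g) i).pos = (rem g (rem f i).pos).pos := by
  induction f using Quotient.inductionOn
  induction g using Quotient.inductionOn
  rfl

theorem rem_whiskerRight_pos {X Y : FreeSym D} (f : X ⟶ Y) (Z : FreeSym D) (i : Pos X) :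
    (rem (f ▷ Z) (i.left Z)).pos = (rem f i).pos.left Z := by
  induction f using Quotient.inductionOn
  rfl

theorem rem_whiskerLeft_pos (X : FreeSym D) {Y Z : FreeSym D} (f : Y ⟶ Z) (i : Pos X) :
    (rem (X ◁ f) (i.left Y)).pos = i.left Z := by
  induction f using Quotient.inductionOn
  rfl

/-- Deleting the first letter leaves a unit in front, hence the remainder is `p` whiskered by the
unit. Both factors can thus be recovered from the tensor product. -/
theorem rem_ofMap_tensorHom {x y : D} (f : x ⟶ y) {X Y : FreeSym D} (p : X ⟶ Y) :
    rem (ofMap f ⊗ₘ p) (Pos.first x X) =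
      ⟨Pos.first y Y, f, (𝟙_ (FreeSym D) ◁ p : 𝟙_ (FreeSym D) ⊗ X ⟶ 𝟙_ (FreeSym D) ⊗ Y)⟩ := by
  induction p using Quotient.inductionOn with | _ p
  exact Rem.mk_congr (Category.comp_id f)
    ((congrArg (· ≫ _) (id_whiskerRight (𝟙_ (FreeSym D)) X)).trans (Category.id_comp _))

theorem ofMap_tensorHom_injective {x y : D} {f f' : x ⟶ y} {X Y : FreeSym D} {p p' : X ⟶ Y}
    (h : ofMap f ⊗ₘ p = ofMap f' ⊗ₘ p') : f = f' ∧ p = p' := by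
  have := ((rem_ofMap_tensorHom f p).symm.trans (congrArg (fun t => rem t (Pos.first x X)) h)).trans
    (rem_ofMap_tensorHom f' p')
  obtain ⟨h₁, h₂⟩ := (Rem.mk.injEq _ _ _ _ _ _).mp this |>.2
  exact ⟨eq_of_heq h₁, (MonoidalCategory.whiskerLeft_iff _ _).1 (eq_of_heq h₂)⟩

/-- Letters are cancelled one at a time by `ofMap_tensorHom_injective`, units by the unitor. -/
theorem whiskerLeft_injective (C : FreeSym D) {X Y : FreeSym D} {p p' : X ⟶ Y}
    (h : C ◁ p = C ◁ p') : p = p' := by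
  induction C generalizing X Y with
  | of c =>
    rw [← id_tensorHom, ← id_tensorHom, ← ofMap_id] at h
    exact (ofMap_tensorHom_injective h).2
  | unit => exact (MonoidalCategory.whiskerLeft_iff _ _).1 h
  | tensor C₁ C₂ ih₁ ih₂ =>
    apply ih₂
    apply ih₁
    change (C₁ ⊗ C₂) ◁ p = (C₁ ⊗ C₂) ◁ p' at h
    simpa using h

theorem whiskerRight_injective (C : FreeSym D) {X Y : FreeSym D} {p p' : X ⟶ Y}
    (h : p ▷ C = p' ▷ C) : p = p' := by
  apply whiskerLeft_injective C
  rw [← cancel_mono (β_ C Y).hom, BraidedCategory.braiding_naturality_right, h,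
    BraidedCategory.braiding_naturality_right]

/-- A morphism out of a word is determined by what it does to the first letter and to the
remaining ones. -/
theorem exists_eq_tensorHom_comp_ext {a : D} {W T : FreeSym D} (h : of a ⊗ W ⟶ T) :
    ∃ (f : a ⟶ lab T (rem h (Pos.first a W)).pos) (p : W ⟶ del T (rem h (Pos.first a W)).pos),
      h = (ofMap f ⊗ₘ p) ≫ ext T (rem h (Pos.first a W)).pos := by
  -- At the first letter `ext` is, by coherence, the unitor on the second factor, and can be
  -- cancelled.
  have aux {A L M T : FreeSym D} (e₀ : A ⊗ (𝟙_ _ ⊗ W) ⟶ A ⊗ W)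
      (h₀ : e₀ = (α_ A (𝟙_ _) W).inv ≫ (ρ_ A).hom ▷ W) (h : A ⊗ W ⟶ T) (f : A ⟶ L)
      (p : 𝟙_ _ ⊗ W ⟶ M) (e : L ⊗ M ⟶ T) (H : e₀ ≫ h = (f ⊗ₘ p) ≫ e) :
      h = (f ⊗ₘ ((λ_ W).inv ≫ p)) ≫ e := by
    have h₁ : e₀ = A ◁ (λ_ W).hom := by rw [h₀]; monoidal
    rw [← cancel_epi (A ◁ (λ_ W).hom), ← h₁, H, h₁, ← Category.assoc]
    congr 1
    rw [← id_tensorHom, tensorHom_comp_tensorHom]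
    simp
  exact ⟨_, _, aux (A := of a) _ rfl h _ _ _ (ext_comp h (Pos.first a W))⟩

theorem eq_tensorHom_of_pos {a b : D} {W W' : FreeSym D} {h : of a ⊗ W ⟶ of b ⊗ W'}
    (hp : (rem h (Pos.first a W)).pos = Pos.first b W') :
    ∃ (f : a ⟶ b) (p : W ⟶ W'), h = ofMap f ⊗ₘ p := by
  obtain ⟨f, p, key⟩ := exists_eq_tensorHom_comp_ext h
  revert f p key
  rw [hp]
  have aux {A L : FreeSym D} (e₀ : L ⊗ (𝟙_ _ ⊗ W') ⟶ L ⊗ W')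
      (h₀ : e₀ = (α_ L (𝟙_ _) W').inv ≫ (ρ_ L).hom ▷ W') (h : A ⊗ W ⟶ L ⊗ W') (f : A ⟶ L)
      (p : W ⟶ 𝟙_ _ ⊗ W') (H : h = (f ⊗ₘ p) ≫ e₀) :
      h = (f ⊗ₘ (p ≫ (λ_ W').hom)) := by
    have h₁ : e₀ = L ◁ (λ_ W').hom := by rw [h₀]; monoidal
    rw [H, h₁, ← id_tensorHom, tensorHom_comp_tensorHom]
    simp
  intro f p key
  exact ⟨f, _, aux (L := of b) _ rfl h (ofMap f) p key⟩

/-- The first letter of a word is sent either to the left or to the right factor. -/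
theorem first_letter_cases {w : D} {B X Y : FreeSym D} (q : of w ⊗ B ⟶ X ⊗ Y) :
    (∃ (X' : FreeSym D) (e : of w ⊗ X' ⟶ X) (h : B ⟶ X' ⊗ Y),
      q = of w ◁ h ≫ (α_ (of w) X' Y).inv ≫ e ▷ Y) ∨
    (∃ (Y' : FreeSym D) (e : of w ⊗ Y' ⟶ Y) (h : B ⟶ X ⊗ Y'),
      q = of w ◁ h ≫ leftComm (of w) X Y' ≫ X ◁ e) := by
  obtain ⟨f, p, key⟩ := exists_eq_tensorHom_comp_ext q
  revert f p key
  generalize (rem q (Pos.first w B)).pos = j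
  rcases j with j | j <;> intro f p key
  · have aux {A L X' : FreeSym D} (f : A ⟶ L) (p : B ⟶ X' ⊗ Y) (e : L ⊗ X' ⟶ X) :
        (f ⊗ₘ p) ≫ (α_ _ _ _).inv ≫ e ▷ Y =
          A ◁ p ≫ (α_ _ _ _).inv ≫ (f ▷ X' ≫ e) ▷ Y := by
      rw [MonoidalCategory.tensorHom_def']
      monoidal
    exact .inl ⟨del X j, _, p, key.trans (aux (ofMap f) p (ext X j))⟩
  · have aux {A L Y' : FreeSym D} (f : A ⟶ L) (p : B ⟶ X ⊗ Y') (e : L ⊗ Y' ⟶ Y) :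
        (f ⊗ₘ p) ≫ leftComm L X Y' ≫ X ◁ e = A ◁ p ≫ leftComm A X Y' ≫ X ◁ (f ▷ Y' ≫ e) := by
      rw [MonoidalCategory.tensorHom_def', Category.assoc,
        reassoc_of% (leftComm_naturality f X Y'), MonoidalCategory.whiskerLeft_comp]
    exact .inr ⟨del Y j, _, p, key.trans (aux (ofMap f) p (ext Y j))⟩

/-- If tensoring with `B` on the right agrees with tensoring with `C` on the left, both come from
a common morphism. -/
theorem exists_eq_whisker (C : FreeSym D) {R R' B : FreeSym D} {r : C ⊗ R ⟶ C ⊗ R'}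
    {p : R ⊗ B ⟶ R' ⊗ B} (h : (α_ C R B).inv ≫ r ▷ B ≫ (α_ C R' B).hom = C ◁ p) :
    ∃ s : R ⟶ R', p = s ▷ B ∧ r = C ◁ s := by
  suffices ∃ s : R ⟶ R', p = s ▷ B by
    obtain ⟨s, rfl⟩ := this
    refine ⟨s, rfl, whiskerRight_injective B ?_⟩
    rw [← cancel_epi (α_ C R B).inv, ← cancel_mono (α_ C R' B).hom, Category.assoc, h]
    simp
  induction C generalizing R R' with
  | of c =>
    -- If `r` keeps the letter `c` in front, it splits as a tensor product and `p` is read off from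
    -- its second factor.
    rcases hp : (rem r (Pos.first c R)).pos with ⟨⟩ | j
    · obtain ⟨f, s, rfl⟩ := eq_tensorHom_of_pos hp
      refine ⟨s, ?_⟩
      have h' : ofMap f ⊗ₘ s ▷ B = ofMap (𝟙 c) ⊗ₘ p := by
        rw [ofMap_id, id_tensorHom, ← h]
        simp [MonoidalCategory.tensorHom_def]
      exact (ofMap_tensorHom_injective h').2.symm
    -- If `r` sent `c` to a letter of `R'`, then so would the left side of `h`, whereas `C ◁ p`
    -- keeps the first letter in place.
    · have := congrArg (fun t => (rem t (Pos.first c (R ⊗ B))).pos) h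
      replace this := (rem_comp_pos _ _ _).symm.trans
        (this.trans (rem_whiskerLeft_pos (of c) p ()))
      replace this := (congrArg (fun t => (rem (α_ (of c) R' B).hom t).pos)
        (rem_whiskerRight_pos r B (Pos.first c R))).symm.trans
          ((rem_comp_pos _ _ _).symm.trans this)
      rw [hp] at this
      cases this
  | unit =>
    change (α_ (𝟙_ _) R B).inv ≫ r ▷ B ≫ (α_ (𝟙_ _) R' B).hom = 𝟙_ _ ◁ p at h
    refine ⟨(λ_ R).inv ≫ r ≫ (λ_ R').hom, ?_⟩
    have e : p = (λ_ _).inv ≫ 𝟙_ _ ◁ p ≫ (λ_ _).hom := by simp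
    rw [e, ← h]
    simp
  | tensor C₁ C₂ ih₁ ih₂ =>
    change (α_ (C₁ ⊗ C₂) R B).inv ≫ r ▷ B ≫ (α_ (C₁ ⊗ C₂) R' B).hom = (C₁ ⊗ C₂) ◁ p at h
    -- The factor `C₁` is stripped first, with `C₂` counted as part of `R`; then `C₂` is stripped
    -- from the morphism so obtained.
    obtain ⟨s, hs⟩ := ih₁ (R := C₂ ⊗ R) (R' := C₂ ⊗ R')
      (r := (α_ C₁ C₂ R).inv ≫ r ≫ (α_ C₁ C₂ R').hom)
      (p := (α_ C₂ R B).hom ≫ C₂ ◁ p ≫ (α_ C₂ R' B).inv) (by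
        have e : C₁ ◁ C₂ ◁ p = (α_ C₁ C₂ _).inv ≫ (C₁ ⊗ C₂) ◁ p ≫ (α_ C₁ C₂ _).hom := by simp
        rw [MonoidalCategory.whiskerLeft_comp, MonoidalCategory.whiskerLeft_comp, e, ← h]
        simp only [comp_whiskerRight, Category.assoc]
        monoidal)
    exact ih₂ (r := s) (p := p) (by rw [← hs]; simp)

/-- The first letter of the right factor of `of w ⊗ R ⊗ of u ⊗ R'` does not move to the front. -/
theorem braiding_ne_tensorHom {w u : D} {R R' : FreeSym D} (f : w ⟶ u)
    (p : R' ⊗ (of u ⊗ R) ⟶ R ⊗ (of w ⊗ R')) :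
    ofMap f ⊗ₘ p ≠ (α_ _ _ _).inv ≫ (β_ (of w ⊗ R') (of u ⊗ R)).hom ≫ (α_ _ _ _).hom := by
  intro h
  -- The two sides send the first letter `w` to different positions: to the front, and into the
  -- factor behind `u`.
  have := (congrArg Rem.pos (rem_ofMap_tensorHom f p)).symm.trans
    (congrArg (fun t => (rem t (Pos.first w (R' ⊗ (of u ⊗ R)))).pos) h)
  cases this

end Cancellation

end FreeSym

/-! ### Chains modulo composition with isomorphisms -/

section Chains

variable {V : Type u₁} [Groupoid.{v₁} V] {F : Type u₂} [Category.{v₂} F] [MonoidalCategory F]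
  [SymmetricCategory F] {ι : V ⥤ F} {d : ProperDegree ι}

namespace ProperDegree

theorem deg_of_isIso (d : ProperDegree ι) {X Y : F} (f : X ⟶ Y) [IsIso f] : d.deg f = 0 :=
  (d.deg_eq_zero f).2 inferInstance

theorem deg_whiskerLeft (d : ProperDegree ι) (B : F) {X Y : F} (f : X ⟶ Y) :
    d.deg (B ◁ f) = d.deg f := by
  rw [← id_tensorHom, d.deg_tensor, d.deg_id, zero_add]

namespace Chain

/-! ### Elementary properties of chains -/

theorem comp_assoc {W X Y Z : F} (γ : d.Chain W X) (δ : d.Chain X Y) (ε : d.Chain Y Z) :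
    (γ.comp δ).comp ε = γ.comp (δ.comp ε) := by
  induction γ using Quot.ind
  induction δ using Quot.ind
  induction ε using Quot.ind
  exact congrArg (Quot.mk _) (Quiver.Path.comp_assoc _ _ _)

@[simp]
theorem nil_comp {X Y : F} (γ : d.Chain X Y) : (nil d X).comp γ = γ := by
  induction γ using Quot.ind
  exact congrArg (Quot.mk _) (Quiver.Path.nil_comp _)

@[simp]
theorem comp_nil {X Y : F} (γ : d.Chain X Y) : γ.comp (nil d Y) = γ := by
  induction γ using Quot.ind
  rfl

theorem single_comp_single {X Y Z : F} (f : X ⟶ Y) (g : Y ⟶ Z) (h : d.deg f = 0 ∨ d.deg g = 0) :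
    (single d f).comp (single d g) = single d (f ≫ g) :=
  Quot.sound (PathRel.merge .nil f g .nil h)

theorem single_comp_single_of_left {X Y Z : F} (f : X ⟶ Y) [IsIso f] (g : Y ⟶ Z) :
    (single d f).comp (single d g) = single d (f ≫ g) :=
  single_comp_single f g (.inl (d.deg_of_isIso f))

theorem single_comp_single_of_right {X Y Z : F} (f : X ⟶ Y) (g : Y ⟶ Z) [IsIso g] :
    (single d f).comp (single d g) = single d (f ≫ g) :=
  single_comp_single f g (.inr (d.deg_of_isIso g))

theorem single_comp_single_comp_of_left {X Y Z W : F} (f : X ⟶ Y) [IsIso f] (g : Y ⟶ Z)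
    (γ : d.Chain Z W) :
    (single d f).comp ((single d g).comp γ) = (single d (f ≫ g)).comp γ := by
  rw [← comp_assoc, single_comp_single_of_left]

theorem single_comp_single_comp_of_right {X Y Z W : F} (f : X ⟶ Y) (g : Y ⟶ Z) [IsIso g]
    (γ : d.Chain Z W) :
    (single d f).comp ((single d g).comp γ) = (single d (f ≫ g)).comp γ := by
  rw [← comp_assoc, single_comp_single_of_right]

theorem single_id (X : F) : single d (𝟙 X) = nil d X :=
  Quot.sound (PathRel.delete .nil .nil)

@[simp]
theorem value_comp {X Y Z : F} (γ : d.Chain X Y) (δ : d.Chain Y Z) :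
    (γ.comp δ).value = γ.value ≫ δ.value := by
  induction γ using Quot.ind
  induction δ using Quot.ind
  exact composePath_comp _ _

@[simp]
theorem value_single {X Y : F} (f : X ⟶ Y) : (single d f).value = f := Category.id_comp f

@[simp]
theorem value_nil (X : F) : (nil d X).value = 𝟙 X := rfl

@[simp]
theorem length_nil (X : F) : (nil d X).length = 0 := rfl

theorem length_single {X Y : F} (f : X ⟶ Y) :
    (single d f).length = if d.deg f = 0 then 0 else 1 := Nat.zero_add _

@[simp]
theorem length_single_of_isIso {X Y : F} (f : X ⟶ Y) [IsIso f] : (single d f).length = 0 := by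
  rw [length_single, if_pos (d.deg_of_isIso f)]

theorem length_single_of_ne {X Y : F} (f : X ⟶ Y) (h : d.deg f ≠ 0) :
    (single d f).length = 1 := by
  rw [length_single, if_neg h]

theorem isPlus_comp {X Y Z : F} (γ : d.Chain X Y) (δ : d.Chain Y Z) :
    (γ.comp δ).IsPlus ↔ γ.IsPlus ∧ δ.IsPlus := by
  induction γ using Quot.ind
  induction δ using Quot.ind
  exact d.pathPlus_comp _ _

theorem isPlus_single {X Y : F} (f : X ⟶ Y) : (single d f).IsPlus ↔ d.deg f ≤ 1 :=
  ⟨fun h => h.2, fun h => ⟨trivial, h⟩⟩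

theorem isPlus_single_of_isIso {X Y : F} (f : X ⟶ Y) [IsIso f] : (single d f).IsPlus := by
  rw [isPlus_single, d.deg_of_isIso f]
  exact zero_le_one

theorem snoc_induction {X : F} {P : ∀ {Y : F}, d.Chain X Y → Prop} (h₀ : P (nil d X))
    (h : ∀ {Y Z : F} (γ : d.Chain X Y) (f : Y ⟶ Z), P γ → P (γ.comp (single d f)))
    {Y : F} (γ : d.Chain X Y) : P γ := by
  induction γ using Quot.ind with | _ p
  induction p with
  | nil => exact h₀
  | cons p f ih => exact h (Quot.mk _ p) f ih

theorem cons_induction {Y : F} {P : ∀ {X : F}, d.Chain X Y → Prop} (h₀ : P (nil d Y))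
    (h : ∀ {X Z : F} (f : X ⟶ Z) (γ : d.Chain Z Y), P γ → P ((single d f).comp γ))
    {X : F} (γ : d.Chain X Y) : P γ := by
  -- Paths grow at their end. To induct from the front, morphisms are moved one at a time from the
  -- end of `γ` to the front of `δ`.
  suffices ∀ {Z : F} (γ : d.Chain X Z) (δ : d.Chain Z Y), P δ → P (γ.comp δ) by
    simpa using this γ _ h₀
  intro Z γ
  induction γ using snoc_induction with
  | h₀ => intro δ hδ; simpa using hδ
  | h γ f ih =>
    intro δ hδ
    rw [comp_assoc]
    exact ih _ (h f δ hδ)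

theorem deg_value {X Y : F} (γ : d.Chain X Y) (h : γ.IsPlus) : d.deg γ.value = γ.length := by
  induction γ using snoc_induction with
  | h₀ => exact d.deg_id X
  | h γ f ih =>
    rw [isPlus_comp, isPlus_single] at h
    rw [value_comp, d.deg_comp, ih h.1, length_comp, length_single, value_single]
    split_ifs <;> omega

theorem eq_single_of_length_eq_zero {X Y : F} (γ : d.Chain X Y) (h : γ.length = 0) :
    IsIso γ.value ∧ γ = single d γ.value := by
  induction γ using snoc_induction with
  | h₀ => exact ⟨inferInstanceAs (IsIso (𝟙 X)), (single_id X).symm⟩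
  | h γ f ih =>
    rw [length_comp, length_single] at h
    have hf : d.deg f = 0 := by
      by_contra hf
      rw [if_neg hf] at h
      omega
    obtain ⟨h₁, h₂⟩ := ih (by omega)
    have := (d.deg_eq_zero f).1 hf
    rw [value_comp, value_single]
    refine ⟨inferInstance, ?_⟩
    conv_lhs => rw [h₂]
    rw [single_comp_single_of_left]

theorem exists_eq_single_comp {X Y : F} (γ : d.Chain X Y) {n : ℕ} (h : γ.length = n + 1) :
    ∃ (Z : F) (f : X ⟶ Z) (δ : d.Chain Z Y), d.deg f ≠ 0 ∧ δ.length = n ∧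
      γ = (single d f).comp δ := by
  induction γ using cons_induction with
  | h₀ => cases h
  | h f γ ih =>
    rw [length_comp, length_single] at h
    -- An isomorphism in front is absorbed into the next morphism of non-zero degree.
    by_cases hf : d.deg f = 0
    · rw [if_pos hf, zero_add] at h
      obtain ⟨Z, g, δ, hg, hδ, rfl⟩ := ih h
      refine ⟨Z, f ≫ g, δ, ?_, hδ, ?_⟩
      · rw [d.deg_comp]; omega
      · rw [← comp_assoc, single_comp_single _ _ (.inl hf)]
    · rw [if_neg hf] at h
      exact ⟨_, f, γ, hf, by omega, rfl⟩

theorem exists_eq_comp {X Y : F} (a : ℕ) {b : ℕ} (γ : d.Chain X Y) (h : γ.length = a + b) :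
    ∃ (Z : F) (α : d.Chain X Z) (β : d.Chain Z Y), α.length = a ∧ β.length = b ∧
      γ = α.comp β := by
  induction a generalizing X with
  | zero => exact ⟨X, nil d X, γ, rfl, by omega, (nil_comp γ).symm⟩
  | succ a ih =>
    obtain ⟨Z, f, δ, hf, hδ, rfl⟩ := exists_eq_single_comp γ (n := a + b) (by omega)
    obtain ⟨W, α, β, hα, hβ, rfl⟩ := ih δ hδ
    refine ⟨W, (single d f).comp α, β, ?_, hβ, (comp_assoc _ _ _).symm⟩
    rw [length_comp, length_single_of_ne f hf]
    omega

/-! ### Uniqueness of the first morphism of non-zero degree -/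

/-- `FirstSplitPath p f γ`: the path `p` consists of a morphism `f` of non-zero degree, followed by
the chain `γ`. -/
def FirstSplitPath {X : F} : ∀ {Y : F} (_ : Quiver.Path X Y) {Z : F} (_ : X ⟶ Z)
    (_ : d.Chain Z Y), Prop
  | _, .nil, _, _, _ => False
  | Y, .cons p g, Z, f, γ =>
    (d.pathLength p = 0 ∧ d.deg g ≠ 0 ∧ ∃ h : Z ⟶ Y, IsIso h ∧ f ≫ h = composePath p ≫ g ∧
      γ = single d h) ∨
    ∃ γ', FirstSplitPath p f γ' ∧ γ = γ'.comp (single d g)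

theorem FirstSplitPath.pathLength_ne {X Y Z : F} {p : Quiver.Path X Y} {f : X ⟶ Z}
    {γ : d.Chain Z Y} (h : FirstSplitPath p f γ) : d.pathLength p ≠ 0 := by
  induction p with
  | nil => exact h.elim
  | cons p g ih =>
    rcases h with ⟨_, hg, _⟩ | ⟨γ', h, _⟩
    · simp [pathLength, hg]
    · have := ih h
      simp only [pathLength]
      omega

theorem firstSplitPath_comp {X Y Z Z' : F} {p p' : Quiver.Path X Y} (f : X ⟶ Z')
    (h : ∀ γ, FirstSplitPath (d := d) p f γ ↔ FirstSplitPath p' f γ)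
    (hl : d.pathLength p = d.pathLength p') (hc : composePath p = composePath p')
    (q : Quiver.Path Y Z) (γ : d.Chain Z' Z) :
    FirstSplitPath (p.comp q) f γ ↔ FirstSplitPath (p'.comp q) f γ := by
  induction q with
  | nil => exact h γ
  | cons q g ih =>
    simp only [Quiver.Path.comp_cons, FirstSplitPath, ih, pathLength_comp, hl, composePath_comp, hc]

/-- The splitting is a predicate rather than a function because the target of the first morphism is
only determined up to an isomorphism, the `h` of the definition. An elementary move matters only at
the end of the path (`firstSplitPath_comp` appends the rest). If a factor `b` of degree 0 is merged
into the preceding morphism, then `h` is composed with `b` or with its inverse. -/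
theorem firstSplitPath_rel {X Y Z : F} {p p' : Quiver.Path X Y} (h : d.PathRel p p') (f : X ⟶ Z)
    (γ : d.Chain Z Y) : FirstSplitPath p f γ ↔ FirstSplitPath p' f γ := by
  rcases h with ⟨p, q⟩ | ⟨p, a, b, q, h⟩
  · refine firstSplitPath_comp f (fun γ => ?_) (by simp [pathLength, d.deg_id]) (by simp) q γ
    simp [FirstSplitPath, d.deg_id, single_id]
  · refine firstSplitPath_comp f (fun γ => ?_) ?_ (by simp) q γ
    · by_cases ha : d.deg a = 0
      · simp [FirstSplitPath, ha, pathLength, d.deg_comp, comp_assoc, single_comp_single a b h]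
      · have hb : d.deg b = 0 := h.resolve_left ha
        have := (d.deg_eq_zero b).1 hb
        simp only [FirstSplitPath, ha, pathLength, d.deg_comp, hb]
        simp only [if_neg, not_false_eq_true, Nat.add_eq_zero_iff, one_ne_zero, and_false,
          false_and, ne_eq, add_zero, ha, true_and, false_or, not_true_eq_false]
        constructor
        · rintro ⟨γ', ⟨hp, h, hh, hf, rfl⟩ | ⟨γ'', hγ'', rfl⟩, rfl⟩
          · exact .inl ⟨hp, h ≫ b, inferInstance, by rw [reassoc_of% hf],
              single_comp_single_of_right _ _⟩
          · exact .inr ⟨γ'', hγ'', by rw [comp_assoc, single_comp_single a b h]⟩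
        · rintro (⟨hp, h, hh, hf, rfl⟩ | ⟨γ', hγ', rfl⟩)
          · refine ⟨single d (h ≫ inv b), .inl ⟨hp, _, inferInstance, ?_, rfl⟩, ?_⟩
            · rw [reassoc_of% hf]; simp
            · rw [single_comp_single_of_right]; simp
          · exact ⟨_, .inr ⟨γ', hγ', rfl⟩, by rw [comp_assoc, single_comp_single a b h]⟩
    · simp only [pathLength, d.deg_comp]
      rcases h with h | h <;> simp [h]

/-- `FirstSplit δ f γ`: the chain `δ` consists of a morphism `f` of non-zero degree, followed by
the chain `γ`. -/
def FirstSplit {X Y Z : F} (δ : d.Chain X Y) (f : X ⟶ Z) (γ : d.Chain Z Y) : Prop :=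
  Quot.lift (fun p => FirstSplitPath p f γ) (fun _ _ h => propext (firstSplitPath_rel h f γ)) δ

theorem firstSplit_single_comp {X Y Z : F} {f : X ⟶ Z} (hf : d.deg f ≠ 0) (γ : d.Chain Z Y) :
    FirstSplit ((single d f).comp γ) f γ := by
  induction γ using Quot.ind with | _ q
  change FirstSplitPath ((Quiver.Path.nil.cons f).comp q) f _
  induction q with
  | nil => exact .inl ⟨rfl, hf, 𝟙 Z, inferInstance, by simp, (single_id Z).symm⟩
  | cons q g ih => exact .inr ⟨_, ih, rfl⟩

/-- The place where the first morphism of non-zero degree occurs is forced by `pathLength`. There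
`f` and `f'` both agree with the partial composition up to isomorphisms `e` and `e'`, whose quotient
compares them. -/
theorem FirstSplitPath.unique {X Y Z Z' : F} {p : Quiver.Path X Y} {f : X ⟶ Z} {f' : X ⟶ Z'}
    {γ : d.Chain Z Y} {γ' : d.Chain Z' Y} (h : FirstSplitPath p f γ)
    (h' : FirstSplitPath p f' γ') :
    ∃ g : Z ⟶ Z', IsIso g ∧ f ≫ g = f' ∧ γ = (single d g).comp γ' := by
  induction p with
  | nil => exact h.elim
  | cons p a ih =>
    rcases h with ⟨hp, ha, e, he, hf, rfl⟩ | ⟨δ, hδ, rfl⟩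
    · rcases h' with ⟨_, _, e', he', hf', rfl⟩ | ⟨δ', hδ', rfl⟩
      · refine ⟨e ≫ inv e', inferInstance, ?_, ?_⟩
        · rw [reassoc_of% hf, ← reassoc_of% hf', IsIso.hom_inv_id, Category.comp_id]
        · rw [single_comp_single_of_left]; simp
      · exact (hδ'.pathLength_ne hp).elim
    · rcases h' with ⟨hp, _⟩ | ⟨δ', hδ', rfl⟩
      · exact (hδ.pathLength_ne hp).elim
      · obtain ⟨g, hg, h₁, rfl⟩ := ih hδ hδ'
        exact ⟨g, hg, h₁, comp_assoc _ _ _⟩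

/-- The first morphism of non-zero degree of a chain is unique up to isomorphism. -/
theorem single_comp_eq_single_comp {X Y Z Z' : F} {f : X ⟶ Z} {f' : X ⟶ Z'} {γ : d.Chain Z Y}
    {γ' : d.Chain Z' Y} (hf : d.deg f ≠ 0) (hf' : d.deg f' ≠ 0)
    (h : (single d f).comp γ = (single d f').comp γ') :
    ∃ g : Z ⟶ Z', IsIso g ∧ f ≫ g = f' ∧ γ = (single d g).comp γ' := by
  have h₁ := firstSplit_single_comp hf γ
  have h₂ := firstSplit_single_comp hf' γ'
  rw [h] at h₁
  revert h₁ h₂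
  induction (single d f').comp γ' using Quot.ind with | _ p
  exact FirstSplitPath.unique

/-! ### Tensoring chains with identities -/

@[simp]
theorem nil_whiskerRight (X B : F) : (nil d X).whiskerRight B = nil d (X ⊗ B) := rfl

@[simp]
theorem single_whiskerRight {X Y : F} (f : X ⟶ Y) (B : F) :
    (single d f).whiskerRight B = single d (f ▷ B) := rfl

theorem comp_whiskerRight {X Y Z : F} (γ : d.Chain X Y) (δ : d.Chain Y Z) (B : F) :
    (γ.comp δ).whiskerRight B = (γ.whiskerRight B).comp (δ.whiskerRight B) := by
  induction γ using Quot.ind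
  induction δ using Quot.ind
  exact congrArg (Quot.mk _) (whiskerPath_comp _ _ _)

@[simp]
theorem length_whiskerRight {X Y : F} (γ : d.Chain X Y) (B : F) :
    (γ.whiskerRight B).length = γ.length := by
  induction γ using snoc_induction with
  | h₀ => rfl
  | h γ f ih => rw [comp_whiskerRight, length_comp, length_comp, ih, single_whiskerRight,
      length_single, length_single, d.deg_whiskerRight]

@[simp]
theorem value_whiskerRight {X Y : F} (γ : d.Chain X Y) (B : F) :
    (γ.whiskerRight B).value = γ.value ▷ B := by
  induction γ using snoc_induction with
  | h₀ => simp
  | h γ f ih => rw [comp_whiskerRight, value_comp, ih, single_whiskerRight, value_single,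
      value_comp, MonoidalCategory.comp_whiskerRight, value_single]

/-- A family of isomorphisms which is natural for morphisms is natural for chains. -/
theorem comp_single_of_natural {o o' : F → F} (φ : ∀ {X Y : F}, d.Chain X Y → d.Chain (o X) (o Y))
    (ψ : ∀ {X Y : F}, d.Chain X Y → d.Chain (o' X) (o' Y)) (hφ : ∀ X, φ (nil d X) = nil d (o X))
    (hψ : ∀ X, ψ (nil d X) = nil d (o' X))
    (hφ' : ∀ {X Y Z : F} (γ : d.Chain X Y) (δ : d.Chain Y Z), φ (γ.comp δ) = (φ γ).comp (φ δ))
    (hψ' : ∀ {X Y Z : F} (γ : d.Chain X Y) (δ : d.Chain Y Z), ψ (γ.comp δ) = (ψ γ).comp (ψ δ))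
    (e : ∀ X, o X ⟶ o' X)
    (he : ∀ {X Y : F} (f : X ⟶ Y), (φ (single d f)).comp (single d (e Y)) =
      (single d (e X)).comp (ψ (single d f))) {X Y : F} (γ : d.Chain X Y) :
    (φ γ).comp (single d (e Y)) = (single d (e X)).comp (ψ γ) := by
  induction γ using snoc_induction with
  | h₀ => rw [hφ, hψ, nil_comp, comp_nil]
  | h γ f ih => rw [hφ', hψ', ← comp_assoc, ← ih, comp_assoc, comp_assoc, he]

theorem whiskerRight_comp_single_whiskerLeft {X Y : F} (γ : d.Chain X Y) {B B' : F} (g : B ⟶ B')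
    [IsIso g] : (γ.whiskerRight B).comp (single d (Y ◁ g)) =
      (single d (X ◁ g)).comp (γ.whiskerRight B') :=
  comp_single_of_natural (fun γ => γ.whiskerRight B) (fun γ => γ.whiskerRight B')
    (fun _ => rfl) (fun _ => rfl) (fun _ _ => comp_whiskerRight _ _ _)
    (fun _ _ => comp_whiskerRight _ _ _) (fun X => X ◁ g)
    (fun f => by
      simp only [single_whiskerRight]
      rw [single_comp_single_of_right, single_comp_single_of_left, whisker_exchange]) γ

theorem whiskerRight_tensor {X Y : F} (γ : d.Chain X Y) (B C : F) :
    (γ.whiskerRight (B ⊗ C)).comp (single d (α_ Y B C).inv) =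
      (single d (α_ X B C).inv).comp ((γ.whiskerRight B).whiskerRight C) :=
  comp_single_of_natural (fun γ => γ.whiskerRight (B ⊗ C))
    (fun γ => (γ.whiskerRight B).whiskerRight C)
    (fun _ => rfl) (fun _ => rfl) (fun _ _ => comp_whiskerRight _ _ _)
    (fun _ _ => by rw [comp_whiskerRight, comp_whiskerRight]) (fun X => (α_ X B C).inv)
    (fun f => by
      simp only [single_whiskerRight]
      rw [single_comp_single_of_right, single_comp_single_of_left,
        associator_inv_naturality_left]) γ

theorem whiskerRight_unit {X Y : F} (γ : d.Chain X Y) :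
    (γ.whiskerRight (𝟙_ F)).comp (single d (ρ_ Y).hom) = (single d (ρ_ X).hom).comp γ :=
  comp_single_of_natural (fun γ => γ.whiskerRight (𝟙_ F)) (fun γ => γ)
    (fun _ => rfl) (fun _ => rfl) (fun _ _ => comp_whiskerRight _ _ _)
    (fun _ _ => rfl) (fun X => (ρ_ X).hom)
    (fun f => by
      simp only [single_whiskerRight]
      rw [single_comp_single_of_right, single_comp_single_of_left, rightUnitor_naturality]) γ

/-- The chain `B ⊗ γ`, all of whose constituents are tensored with the identity of `B`. -/
def whiskerLeft (B : F) {X Y : F} (γ : d.Chain X Y) : d.Chain (B ⊗ X) (B ⊗ Y) :=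
  (single d (β_ B X).hom).comp ((γ.whiskerRight B).comp (single d (β_ Y B).hom))

@[simp]
theorem single_whiskerLeft {X Y : F} (f : X ⟶ Y) (B : F) :
    (single d f).whiskerLeft B = single d (B ◁ f) := by
  unfold whiskerLeft
  rw [single_whiskerRight, single_comp_single_of_right, single_comp_single_of_left]
  simp

@[simp]
theorem nil_whiskerLeft (X B : F) : (nil d X).whiskerLeft B = nil d (B ⊗ X) := by
  rw [← single_id, single_whiskerLeft, MonoidalCategory.whiskerLeft_id, single_id]

theorem comp_whiskerLeft {X Y Z : F} (γ : d.Chain X Y) (δ : d.Chain Y Z) (B : F) :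
    (γ.comp δ).whiskerLeft B = (γ.whiskerLeft B).comp (δ.whiskerLeft B) := by
  unfold whiskerLeft
  simp only [comp_whiskerRight, comp_assoc]
  rw [single_comp_single_comp_of_left, SymmetricCategory.symmetry, single_id, nil_comp]

instance {C : Type*} [Category* C] [MonoidalCategory C] [SymmetricCategory C] (X Y Z : C) :
    IsIso (leftComm X Y Z) := by
  unfold leftComm
  infer_instance

theorem whiskerRight_comp_leftComm {X Y : F} (γ : d.Chain X Y) (B C : F) :
    (γ.whiskerRight (B ⊗ C)).comp (single d (leftComm Y B C)) =
      (single d (leftComm X B C)).comp ((γ.whiskerRight C).whiskerLeft B) :=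
  comp_single_of_natural (fun γ => γ.whiskerRight (B ⊗ C))
    (fun γ => (γ.whiskerRight C).whiskerLeft B)
    (fun _ => rfl) (fun _ => by simp) (fun _ _ => comp_whiskerRight _ _ _)
    (fun _ _ => by rw [comp_whiskerRight, comp_whiskerLeft]) (fun X => leftComm X B C)
    (fun f => by
      simp only [single_whiskerRight, single_whiskerLeft]
      rw [single_comp_single_of_right, single_comp_single_of_left, leftComm_naturality]) γ

end Chain

end ProperDegree

end Chains

/-! ### Consequences of the hereditary condition -/

section Heredity

variable {V : Type u₁} [Groupoid.{v₁} V] {F : Type u₂} [Category.{v₂} F] [MonoidalCategory F]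
  [SymmetricCategory F] {ι : V ⥤ F}

namespace ProperDegree

variable (d : ProperDegree ι)

theorem deg_arrowTensor (W W' : FreeSym (BasicArrows ι)) :
    d.deg ((arrowTensor ι).app (W ⊗ W')) =
      d.deg ((arrowTensor ι).app W) + d.deg ((arrowTensor ι).app W') :=
  d.deg_tensor _ _

theorem deg_letter_eq_zero {W : FreeSym (BasicArrows ι)} (h : d.deg ((arrowTensor ι).app W) = 0)
    (i : W.Pos) : d.deg (W.lab i).of.hom = 0 := by
  induction W with
  | of a => exact h
  | unit => exact i.elim
  | tensor W W' ih ih' =>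
    have h' := (d.deg_arrowTensor W W').symm.trans h
    rcases i with i | i
    · exact ih (by omega) i
    · exact ih' (by omega) i

theorem exists_deg_letter_ne_zero {W : FreeSym (BasicArrows ι)}
    (h : d.deg ((arrowTensor ι).app W) ≠ 0) : ∃ i : W.Pos, d.deg (W.lab i).of.hom ≠ 0 := by
  induction W with
  | of a => exact ⟨(), h⟩
  | unit => exact (h (d.deg_id (𝟙_ F))).elim
  | tensor W W' ih ih' =>
    by_cases h₀ : d.deg ((arrowTensor ι).app W) = 0
    · obtain ⟨i, hi⟩ := ih' (fun h₁ => h ((d.deg_arrowTensor W W').trans (by omega)))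
      exact ⟨.inr i, hi⟩
    · obtain ⟨i, hi⟩ := ih h₀
      exact ⟨.inl i, hi⟩

end ProperDegree

namespace IsFeynman

theorem exists_map_eq (hF : IsFeynman ι) {X Y : FreeSym V}
    (f : (FreeSym.lift ι).obj X ⟶ (FreeSym.lift ι).obj Y) [IsIso f] :
    ∃ g : X ⟶ Y, (FreeSym.lift ι).map g = f :=
  (hF.iso_full (asIso f)).exists

theorem exists_map_eq' (hF : IsFeynman ι) {X Y : FreeSym V}
    {f : (FreeSym.lift ι).obj X ⟶ (FreeSym.lift ι).obj Y} (_ : IsIso f) :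
    ∃ g : X ⟶ Y, (FreeSym.lift ι).map g = f :=
  hF.exists_map_eq f

theorem map_injective (hF : IsFeynman ι) {X Y : FreeSym V} {g g' : X ⟶ Y}
    (h : (FreeSym.lift ι).map g = (FreeSym.lift ι).map g') : g = g' :=
  (hF.iso_full (asIso ((FreeSym.lift ι).map g))).unique rfl h.symm

/-- Every object is the source and the target of a formal tensor product of isomorphisms whose
tensor product is the identity. -/
theorem exists_word (hF : IsFeynman ι) (d : ProperDegree ι) (B : F) :
    ∃ (W : FreeSym (BasicArrows ι)) (a : (arrowSource ι).obj W ≅ B)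
      (b : (arrowTarget ι).obj W ≅ B), (arrowTensor ι).app W ≫ b.hom = a.hom ∧
      ∀ i : W.Pos, d.deg (W.lab i).of.hom = 0 := by
  obtain ⟨W, a, b, h⟩ := hF.exists_decomposition (𝟙 B)
  rw [Category.comp_id] at h
  refine ⟨W, a, b, h, fun i => d.deg_letter_eq_zero ?_ i⟩
  have := congrArg d.deg h
  rw [d.deg_comp, d.deg_of_isIso a.hom, d.deg_of_isIso b.hom] at this
  omega

/-- An isomorphism between `φ ⊗ B` and `φ' ⊗ B'`, where `φ` and `φ'` are basic morphisms of
non-zero degree, is a tensor product. -/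
theorem exists_eq_tensorHom (hF : IsFeynman ι) (d : ProperDegree ι) {X X' B B' : F} {w w' : V}
    {φ : X ⟶ ι.obj w} {φ' : X' ⟶ ι.obj w'} (hφ : d.deg φ ≠ 0)
    (p : X ⊗ B ⟶ X' ⊗ B') [IsIso p] (g : ι.obj w ⊗ B ⟶ ι.obj w' ⊗ B') [IsIso g]
    (h : φ ▷ B ≫ g = p ≫ φ' ▷ B') :
    ∃ (p₁ : X ⟶ X') (p₂ : B ⟶ B') (f : w ⟶ w'), IsIso p₁ ∧ IsIso p₂ ∧ p = p₁ ⊗ₘ p₂ ∧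
      g = ι.map f ⊗ₘ p₂ ∧ φ ≫ ι.map f = p₁ ≫ φ' := by
  -- The spectators `B` and `B'` are replaced by words of isomorphisms, so that `φ ⊗ B` and `φ' ⊗
  -- B'` become tensor products of words of arrows, to which full faithfulness applies.
  obtain ⟨W, a, b, hab, hW⟩ := hF.exists_word d B
  obtain ⟨W', a', b', hab', hW'⟩ := hF.exists_word d B'
  let A : BasicArrows ι := ⟨⟨X, w, φ⟩⟩
  let A' : BasicArrows ι := ⟨⟨X', w', φ'⟩⟩
  let pp : X ⊗ (arrowSource ι).obj W ≅ X' ⊗ (arrowSource ι).obj W' :=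
    whiskerLeftIso X a ≪≫ asIso p ≪≫ whiskerLeftIso X' a'.symm
  let gg : ι.obj w ⊗ (arrowTarget ι).obj W ≅ ι.obj w' ⊗ (arrowTarget ι).obj W' :=
    whiskerLeftIso _ b ≪≫ asIso g ≪≫ whiskerLeftIso _ b'.symm
  have aux {S T S' T' : F} (m : S ⟶ T) (m' : S' ⟶ T') (a : S ≅ B) (b : T ≅ B) (a' : S' ≅ B')
      (b' : T' ≅ B') (hab : m ≫ b.hom = a.hom) (hab' : m' ≫ b'.hom = a'.hom) :
      (φ ⊗ₘ m) ≫ (_ ◁ b.hom ≫ g ≫ _ ◁ b'.inv) = (X ◁ a.hom ≫ p ≫ X' ◁ a'.inv) ≫ (φ' ⊗ₘ m') := by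
    have e₁ : m = a.hom ≫ b.inv := by rw [← hab]; simp
    have e₂ : m' = a'.hom ≫ b'.inv := by rw [← hab']; simp
    have e₃ : (φ ⊗ₘ m) ≫ _ ◁ b.hom = X ◁ a.hom ≫ φ ▷ B := by
      rw [whisker_exchange, MonoidalCategory.tensorHom_def, Category.assoc,
        ← MonoidalCategory.whiskerLeft_comp, hab]
    have e₄ : X' ◁ a'.inv ≫ (φ' ⊗ₘ m') = φ' ▷ B' ≫ _ ◁ b'.inv := by
      rw [MonoidalCategory.tensorHom_def', ← MonoidalCategory.whiskerLeft_comp_assoc, e₂,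
        Iso.inv_hom_id_assoc, whisker_exchange]
    rw [reassoc_of% e₃, reassoc_of% h, Category.assoc, Category.assoc, e₄]
  obtain ⟨t, ht₁, ht₂⟩ := (hF.decomposition_full (W := .of A ⊗ W) (W' := .of A' ⊗ W') pp gg
    (aux _ _ a b a' b' hab hab')).exists
  -- The letter `A` has non-zero degree and the letters of `W'` have degree 0. As isomorphisms of
  -- arrows preserve the degree, `A` can only go to `A'`.
  rcases hp : (FreeSym.rem t (FreeSym.Pos.first A W)).pos with ⟨⟩ | j
  · obtain ⟨f, q, rfl⟩ := FreeSym.eq_tensorHom_of_pos hp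
    have h₁ := (FreeSym.lift_map_tensorHom _ (FreeSym.ofMap f) q).symm.trans ht₁
    have h₂ := (FreeSym.lift_map_tensorHom _ (FreeSym.ofMap f) q).symm.trans ht₂
    have hq := (arrowTensor ι).naturality q
    have aux₂ {S T S' T' : F} {m : S ⟶ T} {m' : S' ⟶ T'} {a : S ≅ B} {b : T ≅ B} {a' : S' ≅ B'}
        {b' : T' ≅ B'} (hab : m ≫ b.hom = a.hom) (hab' : m' ≫ b'.hom = a'.hom)
        {q₁ : S ⟶ S'} {q₂ : T ⟶ T'} (hq : q₁ ≫ m' = m ≫ q₂) {f₁ : X ⟶ X'}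
        {f₂ : ι.obj w ⟶ ι.obj w'} (h₁ : f₁ ⊗ₘ q₁ = X ◁ a.hom ≫ p ≫ X' ◁ a'.inv)
        (h₂ : f₂ ⊗ₘ q₂ = _ ◁ b.hom ≫ g ≫ _ ◁ b'.inv) :
        p = f₁ ⊗ₘ (a.inv ≫ q₁ ≫ a'.hom) ∧ g = f₂ ⊗ₘ (a.inv ≫ q₁ ≫ a'.hom) := by
      -- The effects of `t` on the sources and on the targets of the remaining letters define the
      -- same morphism `B ⟶ B'`; it is the common second factor of `p` and `g`.
      have e : a.inv ≫ q₁ ≫ a'.hom = b.inv ≫ q₂ ≫ b'.hom := by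
        rw [← hab', reassoc_of% hq, ← cancel_epi a.hom, Iso.hom_inv_id_assoc, ← hab]
        simp
      constructor
      · rw [← cancel_epi (X ◁ a.hom), ← cancel_mono (X' ◁ a'.inv), Category.assoc, ← h₁,
          ← id_tensorHom, ← id_tensorHom, tensorHom_comp_tensorHom, tensorHom_comp_tensorHom]
        simp
      · rw [e, ← cancel_epi (_ ◁ b.hom), ← cancel_mono (_ ◁ b'.inv), Category.assoc, ← h₂,
          ← id_tensorHom, ← id_tensorHom, tensorHom_comp_tensorHom, tensorHom_comp_tensorHom]
        simp
    obtain ⟨h₃, h₄⟩ := aux₂ hab hab' hq h₁ h₂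
    have i₁ : IsIso ((arrowSource ι).map q) := inferInstance
    have i₂ : IsIso ((CommaMorphism.left f.iso.hom : X ⟶ X')) :=
      inferInstanceAs (IsIso ((Comma.fst _ _).map f.iso.hom))
    exact ⟨_, _, f.iso.hom.right, i₂, inferInstance, h₃, h₄, f.iso.hom.w.symm⟩
  · exfalso
    obtain ⟨f, -⟩ := FreeSym.exists_eq_tensorHom_comp_ext t
    rw [hp] at f
    have hf := congrArg d.deg f.iso.hom.w
    have i₂ : IsIso (CommaMorphism.left f.iso.hom) :=
      inferInstanceAs (IsIso ((Comma.fst _ _).map f.iso.hom))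
    have i₃ : IsIso (CommaMorphism.right f.iso.hom) :=
      inferInstanceAs (IsIso ((Comma.snd _ _).map f.iso.hom))
    replace hf := (d.deg_comp _ _).symm.trans (hf.trans (d.deg_comp _ _))
    have h₀ : d.deg (FreeSym.lab (.of A' ⊗ W') (.inr j)).of.hom = 0 := hW' j
    have h₁ : d.deg (ι.map f.iso.hom.right) = 0 := d.deg_of_isIso _
    rw [h₀, h₁, add_zero] at hf
    exact hφ (hf.symm.trans (d.deg_of_isIso (CommaMorphism.left f.iso.hom)))

/-- A morphism of degree `1` is isomorphic to `φ ⊗ B` for a basic morphism `φ`. -/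
theorem exists_eq_of_deg_eq_one (hF : IsFeynman ι) (d : ProperDegree ι) {X Y : F} (f : X ⟶ Y)
    (hf : d.deg f = 1) : ∃ (C B : FreeSym V) (w : V) (φ : BasicOne d C w)
      (p : X ⟶ (FreeSym.lift ι).obj C ⊗ (FreeSym.lift ι).obj B)
      (q : ι.obj w ⊗ (FreeSym.lift ι).obj B ⟶ Y), IsIso p ∧ IsIso q ∧
      f = p ≫ φ.1 ▷ (FreeSym.lift ι).obj B ≫ q := by
  obtain ⟨W, p, q, h⟩ := hF.exists_decomposition f
  have h₁ : d.deg ((arrowTensor ι).app W) = 1 := by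
    have := congrArg d.deg h
    rw [d.deg_comp, d.deg_comp, d.deg_of_isIso p.hom, d.deg_of_isIso q.hom] at this
    omega
  -- The degree is additive, so a letter of non-zero degree has degree 1. Once it is moved to the
  -- front, the remaining letters form an isomorphism.
  obtain ⟨i, hi⟩ := d.exists_deg_letter_ne_zero (by omega : d.deg ((arrowTensor ι).app W) ≠ 0)
  have hn := (arrowTensor ι).naturality (W.ext i)
  have h₂ := congrArg d.deg hn
  rw [d.deg_comp, d.deg_comp, d.deg_of_isIso ((arrowSource ι).map (W.ext i)),
    d.deg_of_isIso ((arrowTarget ι).map (W.ext i)), d.deg_arrowTensor, h₁] at h₂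
  replace h₂ : 0 + 1 = d.deg (W.lab i).of.hom + d.deg ((arrowTensor ι).app (W.del i)) + 0 := h₂
  have h₃ : IsIso ((arrowTensor ι).app (W.del i)) := (d.deg_eq_zero _).1 (by omega)
  obtain ⟨C, ⟨c⟩⟩ := hF.exists_iso (W.lab i).of.left
  obtain ⟨B, ⟨b⟩⟩ := hF.exists_iso ((arrowTarget ι).obj (W.del i))
  have aux {W₁ W₂ X₀ S T C B I : F} (p : W₁ ≅ X) (q : W₂ ≅ Y) (r : W₁ ⟶ W₂)
      (h : r ≫ q.hom = p.hom ≫ f) (s : X₀ ⊗ S ⟶ W₁) (hs : IsIso s) (t : I ⊗ T ⟶ W₂)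
      (ht : IsIso t) (φ : X₀ ⟶ I) (m : S ⟶ T) (hm : IsIso m) (he : s ≫ r = (φ ⊗ₘ m) ≫ t)
      (c : C ≅ X₀) (b : B ≅ T) : ∃ (p' : X ⟶ C ⊗ B) (q' : I ⊗ B ⟶ Y), IsIso p' ∧ IsIso q' ∧
        f = p' ≫ (c.hom ≫ φ) ▷ B ≫ q' := by
    refine ⟨p.inv ≫ inv s ≫ (c.inv ⊗ₘ (m ≫ b.inv)), I ◁ b.hom ≫ t ≫ q.hom, inferInstance,
      inferInstance, ?_⟩
    have e₁ : (c.inv ⊗ₘ (m ≫ b.inv)) ≫ (c.hom ≫ φ) ▷ B ≫ I ◁ b.hom = φ ⊗ₘ m := by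
      rw [← tensorHom_id, ← id_tensorHom, tensorHom_comp_tensorHom, tensorHom_comp_tensorHom]
      simp
    simp only [Category.assoc]
    rw [reassoc_of% e₁, ← reassoc_of% he, IsIso.inv_hom_id_assoc, h, Iso.inv_hom_id_assoc]
  obtain ⟨p', q', hp', hq', key⟩ := aux p q _ h ((arrowSource ι).map (W.ext i))
    (Functor.map_isIso _ _) ((arrowTarget ι).map (W.ext i)) (Functor.map_isIso _ _)
    (W.lab i).of.hom ((arrowTensor ι).app (W.del i)) h₃ hn c b
  refine ⟨C, B, (W.lab i).of.right, ⟨c.hom ≫ (W.lab i).of.hom, ?_⟩, p', q', hp', hq', key⟩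
  refine (d.deg_comp _ _).trans ?_
  rw [d.deg_of_isIso c.hom, zero_add]
  omega

/-- Isomorphisms of `F` come from the free symmetric monoidal category on `V`, where cancellation is
known. -/
theorem whiskerRight_injective (hF : IsFeynman ι) {X Y B : F} {r r' : X ⟶ Y} [IsIso r] [IsIso r']
    (h : r ▷ B = r' ▷ B) : r = r' := by
  obtain ⟨x, ⟨ex⟩⟩ := hF.exists_iso X
  obtain ⟨y, ⟨ey⟩⟩ := hF.exists_iso Y
  obtain ⟨b, ⟨eb⟩⟩ := hF.exists_iso B
  obtain ⟨s, hs⟩ := hF.exists_map_eq (ex.hom ≫ r ≫ ey.inv)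
  obtain ⟨s', hs'⟩ := hF.exists_map_eq (ex.hom ≫ r' ≫ ey.inv)
  have key : s ▷ b = s' ▷ b := by
    apply hF.map_injective
    rw [FreeSym.lift_map_whiskerRight, FreeSym.lift_map_whiskerRight, hs, hs']
    have aux {x y b : F} (ex : x ≅ X) (ey : y ≅ Y) (eb : b ≅ B) :
        (ex.hom ≫ r ≫ ey.inv) ▷ b = (ex.hom ≫ r' ≫ ey.inv) ▷ b := by
      rw [← cancel_mono (y ◁ eb.hom), ← whisker_exchange, ← whisker_exchange]
      simp [h]
    exact aux ex ey eb
  rw [← cancel_epi ex.hom, ← cancel_mono ey.inv, Category.assoc, Category.assoc, ← hs, ← hs',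
    FreeSym.whiskerRight_injective b key]

/-- If `r ⊗ B` is a tensor product of two morphisms along the two ways of bracketing, then so is
`r`. -/
theorem exists_eq_whiskerRight (hF : IsFeynman ι) {X X' R R' B : F} {r : X ⊗ R ⟶ X' ⊗ R'}
    [IsIso r] {p₁ : X ⟶ X'} [IsIso p₁] {p₂ : R ⊗ B ⟶ R' ⊗ B} [IsIso p₂]
    (h : (α_ X R B).inv ≫ r ▷ B ≫ (α_ X' R' B).hom = p₁ ⊗ₘ p₂) :
    ∃ s : R ⟶ R', IsIso s ∧ p₂ = s ▷ B ∧ r = p₁ ⊗ₘ s := by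
  obtain ⟨x, ⟨ex⟩⟩ := hF.exists_iso X
  obtain ⟨y, ⟨ey⟩⟩ := hF.exists_iso R
  obtain ⟨y', ⟨ey'⟩⟩ := hF.exists_iso R'
  obtain ⟨b, ⟨eb⟩⟩ := hF.exists_iso B
  -- Composing with the inverse of `p₁` normalizes the first factor to an identity, as
  -- `FreeSym.exists_eq_whisker` requires.
  have aux₀ {x y y' : F} (ex : x ≅ X) (ey : y ≅ R) (ey' : y' ≅ R') :
    IsIso ((ex.hom ⊗ₘ ey.hom) ≫ r ≫ ((inv p₁ ≫ ex.inv) ⊗ₘ ey'.inv)) := inferInstance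
  have aux₁ {y y' b : F} (ey : y ≅ R) (ey' : y' ≅ R') (eb : b ≅ B) :
    IsIso ((ey.hom ⊗ₘ eb.hom) ≫ p₂ ≫ (ey'.inv ⊗ₘ eb.inv)) := inferInstance
  obtain ⟨u, hu⟩ := hF.exists_map_eq' (aux₀ ex ey ey') (X := x ⊗ y) (Y := x ⊗ y')
  obtain ⟨q, hq⟩ := hF.exists_map_eq' (aux₁ ey ey' eb) (X := y ⊗ b) (Y := y' ⊗ b)
  have key : (α_ x y b).inv ≫ u ▷ b ≫ (α_ x y' b).hom = x ◁ q := by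
    apply hF.map_injective
    rw [FreeSym.lift_map_whiskerLeft, Functor.map_comp, Functor.map_comp,
      FreeSym.lift_map_whiskerRight, hu, hq]
    have aux {x y y' b : F} (ex : x ≅ X) (ey : y ≅ R) (ey' : y' ≅ R') (eb : b ≅ B) :
        (α_ x y b).inv ≫ ((ex.hom ⊗ₘ ey.hom) ≫ r ≫ ((inv p₁ ≫ ex.inv) ⊗ₘ ey'.inv)) ▷ b ≫
          (α_ x y' b).hom = x ◁ ((ey.hom ⊗ₘ eb.hom) ≫ p₂ ≫ (ey'.inv ⊗ₘ eb.inv)) := by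
      have e : r ▷ B = (α_ X R B).hom ≫ (p₁ ⊗ₘ p₂) ≫ (α_ X' R' B).inv := by rw [← h]; simp
      have e₁ : ((ex.hom ⊗ₘ ey.hom) ≫ r ≫ ((inv p₁ ≫ ex.inv) ⊗ₘ ey'.inv)) ▷ b =
          ((ex.hom ⊗ₘ ey.hom) ⊗ₘ eb.hom) ≫ r ▷ B ≫ (((inv p₁ ≫ ex.inv) ⊗ₘ ey'.inv) ⊗ₘ eb.inv) := by
        rw [← tensorHom_id, ← tensorHom_id, tensorHom_comp_tensorHom, tensorHom_comp_tensorHom]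
        simp
      rw [e₁, e]
      simp only [Category.assoc]
      rw [associator_naturality_assoc, Iso.inv_hom_id_assoc, associator_naturality,
        Iso.inv_hom_id_assoc, tensorHom_comp_tensorHom_assoc, tensorHom_comp_tensorHom, ← id_tensorHom]
      simp
    exact aux ex ey ey' eb
  obtain ⟨s, hs, hs'⟩ := FreeSym.exists_eq_whisker x key
  have hq' := hq.symm.trans ((congrArg _ hs).trans (FreeSym.lift_map_whiskerRight ι s b))
  have hu' := hu.symm.trans ((congrArg _ hs').trans (FreeSym.lift_map_whiskerLeft ι x s))
  have aux {x y y' b : F} {ex : x ≅ X} {ey : y ≅ R} {ey' : y' ≅ R'} {eb : b ≅ B} {s : y ⟶ y'}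
      (hq : (ey.hom ⊗ₘ eb.hom) ≫ p₂ ≫ (ey'.inv ⊗ₘ eb.inv) = s ▷ b)
      (hu : (ex.hom ⊗ₘ ey.hom) ≫ r ≫ ((inv p₁ ≫ ex.inv) ⊗ₘ ey'.inv) = x ◁ s) :
      p₂ = (ey.inv ≫ s ≫ ey'.hom) ▷ B ∧ r = p₁ ⊗ₘ (ey.inv ≫ s ≫ ey'.hom) := by
    constructor
    · rw [← cancel_epi (ey.hom ⊗ₘ eb.hom), ← cancel_mono (ey'.inv ⊗ₘ eb.inv), Category.assoc, hq,
        ← tensorHom_id, ← tensorHom_id, tensorHom_comp_tensorHom, tensorHom_comp_tensorHom]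
      simp
    · rw [← cancel_epi (ex.hom ⊗ₘ ey.hom), ← cancel_mono ((inv p₁ ≫ ex.inv) ⊗ₘ ey'.inv),
        Category.assoc, hu, ← id_tensorHom, tensorHom_comp_tensorHom, tensorHom_comp_tensorHom]
      simp
  obtain ⟨h₁, h₂⟩ := aux hq' hu'
  exact ⟨_, inferInstance, h₁, h₂⟩

/-- This transports `FreeSym.braiding_ne_tensorHom` to `F`. It is the reason why two orders of
executing independent morphisms are different chains. -/
theorem tensorHom_ne_braiding (hF : IsFeynman ι) {w u : V} {R R' : F} (f : w ⟶ u)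
    (p : R' ⊗ (ι.obj u ⊗ R) ⟶ R ⊗ (ι.obj w ⊗ R')) [IsIso p] :
    ι.map f ⊗ₘ p ≠ (α_ _ _ _).inv ≫ (β_ (ι.obj w ⊗ R') (ι.obj u ⊗ R)).hom ≫ (α_ _ _ _).hom := by
  intro h
  obtain ⟨x, ⟨ex⟩⟩ := hF.exists_iso R
  obtain ⟨x', ⟨ex'⟩⟩ := hF.exists_iso R'
  have aux₀ {x x' : F} (ex : x ≅ R) (ex' : x' ≅ R') :
    IsIso ((ex'.hom ⊗ₘ (ι.obj u ◁ ex.hom)) ≫ p ≫ (ex.inv ⊗ₘ (ι.obj w ◁ ex'.inv))) := inferInstance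
  obtain ⟨q, hq⟩ := hF.exists_map_eq' (aux₀ ex ex') (X := x' ⊗ (.of u ⊗ x)) (Y := x ⊗ (.of w ⊗ x'))
  refine FreeSym.braiding_ne_tensorHom f q (hF.map_injective ?_)
  rw [FreeSym.lift_map_tensorHom, hq]
  have aux {x x' U W : F} (ex : x ≅ R) (ex' : x' ≅ R') (f : W ⟶ U)
      (p : R' ⊗ (U ⊗ R) ⟶ R ⊗ (W ⊗ R'))
      (h : f ⊗ₘ p = (α_ _ _ _).inv ≫ (β_ (W ⊗ R') (U ⊗ R)).hom ≫ (α_ _ _ _).hom) :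
      f ⊗ₘ ((ex'.hom ⊗ₘ (U ◁ ex.hom)) ≫ p ≫ (ex.inv ⊗ₘ (W ◁ ex'.inv))) =
        (α_ _ _ _).inv ≫ (β_ (W ⊗ x') (U ⊗ x)).hom ≫ (α_ _ _ _).hom := by
    have e : f ⊗ₘ ((ex'.hom ⊗ₘ (U ◁ ex.hom)) ≫ p ≫ (ex.inv ⊗ₘ (W ◁ ex'.inv))) =
        (𝟙 W ⊗ₘ (ex'.hom ⊗ₘ (U ◁ ex.hom))) ≫ (f ⊗ₘ p) ≫ (𝟙 U ⊗ₘ (ex.inv ⊗ₘ (W ◁ ex'.inv))) := by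
      rw [tensorHom_comp_tensorHom, tensorHom_comp_tensorHom]
      simp
    rw [e, h]
    simp only [Category.assoc, associator_inv_naturality_assoc]
    rw [BraidedCategory.braiding_naturality_assoc, ← associator_naturality,
      tensorHom_comp_tensorHom_assoc]
    simp
  exact aux ex ex' _ p h

end IsFeynman

end Heredity

/-! ### Permutations of chains -/

section PermSum

theorem sign_permSum {n m : ℕ} (σ : Equiv.Perm (Fin n)) (τ : Equiv.Perm (Fin m)) :
    Equiv.Perm.sign (permSum σ τ) = Equiv.Perm.sign σ * Equiv.Perm.sign τ := by
  rw [permSum, Equiv.Perm.sign_permCongr, Equiv.Perm.sign_sumCongr]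

theorem permSum_one_swap {n m : ℕ} (a b : Fin m) :
    permSum (1 : Equiv.Perm (Fin n)) (Equiv.swap a b) =
      Equiv.swap (Fin.natAdd n a) (Fin.natAdd n b) := by
  change finSumFinEquiv.permCongr (Equiv.Perm.sumCongr 1 (Equiv.swap a b)) = _
  rw [Equiv.Perm.sumCongr_one_swap, Equiv.permCongr_def, Equiv.symm_trans_swap_trans]
  simp

theorem permSum_swap_one {n m : ℕ} (a b : Fin n) :
    permSum (Equiv.swap a b) (1 : Equiv.Perm (Fin m)) =
      Equiv.swap (Fin.castAdd m a) (Fin.castAdd m b) := by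
  change finSumFinEquiv.permCongr (Equiv.Perm.sumCongr (Equiv.swap a b) 1) = _
  rw [Equiv.Perm.sumCongr_swap_one, Equiv.permCongr_def, Equiv.symm_trans_swap_trans]
  simp

theorem perm_fin_two (σ : Equiv.Perm (Fin 2)) : σ = 1 ∨ σ = Equiv.swap 0 1 := by
  revert σ
  decide

end PermSum

namespace CubicalStructure

variable {V : Type u₁} [Groupoid.{v₁} V] {F : Type u₂} [Category.{v₂} F] [MonoidalCategory F]
  [SymmetricCategory F] {ι : V ⥤ F} (c : CubicalStructure ι)

open ProperDegree ProperDegree.Chain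

/-- `c.SignRel ε γ δ`: the chain `δ` is obtained from the chain `γ` by a permutation of sign
`ε`. -/
def SignRel (ε : ℤˣ) {X Y : F} (γ δ : c.Chain X Y) : Prop :=
  ∃ (n : ℕ) (γ' : c.ChainN n X Y) (σ : Equiv.Perm (Fin n)), Equiv.Perm.sign σ = ε ∧ γ'.1 = γ ∧
    (c.permute σ γ').1 = δ

variable {c}

theorem SignRel.refl {X Y : F} (γ : c.Chain X Y) : c.SignRel 1 γ γ :=
  ⟨γ.length, ⟨γ, rfl⟩, 1, by simp, rfl, by rw [c.one_permute]⟩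

theorem SignRel.trans {X Y : F} {γ δ η : c.Chain X Y} {ε ε' : ℤˣ} (h : c.SignRel ε γ δ)
    (h' : c.SignRel ε' δ η) : c.SignRel (ε * ε') γ η := by
  obtain ⟨n, γ', σ, rfl, rfl, rfl⟩ := h
  obtain ⟨m, δ', τ, rfl, h, rfl⟩ := h'
  obtain rfl : m = n := by rw [← δ'.2, h, (c.permute σ γ').2]
  obtain rfl : δ' = c.permute σ γ' := Subtype.ext h
  exact ⟨m, γ', τ * σ, by rw [map_mul, mul_comm], rfl, by rw [c.mul_permute]⟩

theorem SignRel.comp {X Y Z : F} {γ γ' : c.Chain X Y} {δ δ' : c.Chain Y Z} {ε ε' : ℤˣ}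
    (h : c.SignRel ε γ γ') (h' : c.SignRel ε' δ δ') :
    c.SignRel (ε * ε') (γ.comp δ) (γ'.comp δ') := by
  obtain ⟨n, γ, σ, rfl, rfl, rfl⟩ := h
  obtain ⟨m, δ, τ, rfl, rfl, rfl⟩ := h'
  exact ⟨n + m, γ.comp δ, permSum σ τ, sign_permSum σ τ, rfl, by rw [← c.permute_comp]; rfl⟩

theorem SignRel.comp_left {X Y Z : F} (γ : c.Chain X Y) {δ δ' : c.Chain Y Z} {ε : ℤˣ}
    (h : c.SignRel ε δ δ') : c.SignRel ε (γ.comp δ) (γ.comp δ') := by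
  simpa using (SignRel.refl γ).comp h

theorem SignRel.comp_right {X Y Z : F} {γ γ' : c.Chain X Y} {ε : ℤˣ} (h : c.SignRel ε γ γ')
    (δ : c.Chain Y Z) : c.SignRel ε (γ.comp δ) (γ'.comp δ) := by
  simpa using h.comp (SignRel.refl δ)

theorem SignRel.length_eq {X Y : F} {γ δ : c.Chain X Y} {ε : ℤˣ} (h : c.SignRel ε γ δ) :
    δ.length = γ.length := by
  obtain ⟨n, γ, σ, rfl, rfl, rfl⟩ := h
  rw [γ.2, (c.permute σ γ).2]

theorem signRel_permute {n : ℕ} {X Y : F} (σ : Equiv.Perm (Fin n)) (γ : c.ChainN n X Y) :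
    c.SignRel (Equiv.Perm.sign σ) γ.1 (c.permute σ γ).1 :=
  ⟨n, γ, σ, rfl, rfl, rfl⟩

/-- The degree of the common composition gives both lengths, and orbits of chains correspond to
morphisms. -/
theorem exists_signRel {X Y : F} {γ δ : c.Chain X Y} (hγ : γ.IsPlus) (hδ : δ.IsPlus)
    (h : γ.value = δ.value) : ∃ ε, c.SignRel ε γ δ := by
  have hl : δ.length = γ.length := by rw [← deg_value γ hγ, ← deg_value δ hδ, h]
  obtain ⟨σ, hσ⟩ := c.value_injective ⟨γ, rfl⟩ ⟨δ, hl⟩ hγ hδ h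
  exact ⟨_, _, _, σ, rfl, rfl, congrArg Subtype.val hσ⟩

variable (c) in
/-- The action of the transposition on chains of length two. -/
abbrev swap {X Y : F} (β : c.ChainN 2 X Y) : c.ChainN 2 X Y := c.permute (Equiv.swap 0 1) β

theorem swap_ne {X Y : F} (β : c.ChainN 2 X Y) : c.swap β ≠ β := fun h => by
  have := c.permute_free _ _ h
  revert this
  decide

theorem swap_swap {X Y : F} (β : c.ChainN 2 X Y) : c.swap (c.swap β) = β := by
  rw [swap, swap, ← c.mul_permute, Equiv.swap_mul_self, c.one_permute]

theorem signRel_swap {X Y : F} (β : c.ChainN 2 X Y) : c.SignRel (-1) β.1 (c.swap β).1 :=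
  ⟨2, β, _, Equiv.Perm.sign_swap (by decide), rfl, rfl⟩

/-- Chains with the same composition form one orbit, and S₂ has only two elements. Transpositions
are identified below by excluding the first alternative. -/
theorem eq_or_eq_swap {X Y : F} {β β' : c.ChainN 2 X Y} (hβ : β.1.IsPlus) (hβ' : β'.1.IsPlus)
    (h : β.1.value = β'.1.value) : β' = β ∨ β' = c.swap β := by
  obtain ⟨σ, rfl⟩ := c.value_injective β β' hβ hβ' h
  rcases perm_fin_two σ with rfl | rfl
  · exact .inl (c.one_permute β)
  · exact .inr rfl

/-- `c.Adj γ δ`: the chain `δ` is obtained from `γ` by applying the transposition to two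
consecutive morphisms. -/
def Adj (c : CubicalStructure ι) {X Y : F} (γ δ : c.Chain X Y) : Prop :=
  ∃ (X' Y' : F) (α : c.Chain X X') (β : c.ChainN 2 X' Y') (η : c.Chain Y' Y),
    γ = α.comp (β.1.comp η) ∧ δ = α.comp ((c.swap β).1.comp η)

/-- Cut the chain into pieces of lengths i, 2 and m. The transposition lies in Sᵢ × S₂ × Sₘ and acts
on the middle piece only, by compatibility with concatenation. -/
theorem adj_permute {n : ℕ} {X Y : F} (i : ℕ) (hi : i + 1 < n) (γ : c.ChainN n X Y) :
    c.Adj γ.1 (c.permute (Equiv.swap ⟨i, by omega⟩ ⟨i + 1, hi⟩) γ).1 := by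
  obtain ⟨m, rfl⟩ : ∃ m, n = i + (2 + m) := ⟨n - (i + 2), by omega⟩
  obtain ⟨γ, hγ⟩ := γ
  obtain ⟨X', α, δ, hα, hδ, rfl⟩ := exists_eq_comp i γ hγ
  obtain ⟨Y', β, η, hβ, hη, rfl⟩ := exists_eq_comp 2 δ hδ
  refine ⟨X', Y', α, ⟨β, hβ⟩, η, rfl, ?_⟩
  have h₁ := c.permute_comp (Equiv.swap 0 1) 1 (⟨β, hβ⟩ : c.ChainN 2 _ _)
    (⟨η, hη⟩ : c.ChainN m _ _)
  have h₂ := c.permute_comp 1 (permSum (Equiv.swap 0 1) 1) (⟨α, hα⟩ : c.ChainN i _ _)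
    (ProperDegree.ChainN.comp (⟨β, hβ⟩ : c.ChainN 2 _ _) (⟨η, hη⟩ : c.ChainN m _ _))
  rw [← h₁, c.one_permute, c.one_permute, permSum_swap_one, permSum_one_swap] at h₂
  exact (congrArg Subtype.val h₂).symm

/-- Adjacent transpositions, each of sign -1, generate the symmetric group already as a monoid, so
no case for inverses is needed. -/
theorem permute_induction {X Y : F} {n : ℕ} (P : c.ChainN n X Y → c.ChainN n X Y → ℤˣ → Prop)
    (refl : ∀ γ, γ.1.IsPlus → P γ γ 1)
    (trans : ∀ γ δ η ε ε', γ.1.IsPlus → δ.1.IsPlus → η.1.IsPlus → P γ δ ε → P δ η ε' →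
      P γ η (ε * ε'))
    (adj : ∀ γ δ, γ.1.IsPlus → δ.1.IsPlus → c.Adj γ.1 δ.1 → P γ δ (-1))
    (σ : Equiv.Perm (Fin n)) (γ : c.ChainN n X Y) (hγ : γ.1.IsPlus) :
    P γ (c.permute σ γ) (Equiv.Perm.sign σ) := by
  rcases n with _ | n
  · rw [Subsingleton.elim σ 1, c.one_permute, map_one]
    exact refl γ hγ
  have hσ : σ ∈ Submonoid.closure
      (Set.range fun i : Fin n => Equiv.swap i.castSucc i.succ) := by
    rw [Equiv.Perm.mclosure_swap_castSucc_succ]; trivial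
  induction hσ using Submonoid.closure_induction generalizing γ with
  | mem σ h =>
    obtain ⟨i, rfl⟩ := h
    dsimp only
    rw [Equiv.Perm.sign_swap (Fin.castSucc_lt_succ).ne]
    exact adj _ _ hγ (c.isPlus_permute _ _ hγ) (adj_permute i (by omega) γ)
  | one =>
    rw [c.one_permute, map_one]
    exact refl γ hγ
  | mul σ τ _ _ hσ hτ =>
    rw [c.mul_permute, map_mul, mul_comm]
    exact trans _ _ _ _ _ hγ (c.isPlus_permute _ _ hγ)
      (c.isPlus_permute _ _ (c.isPlus_permute _ _ hγ)) (hτ γ hγ)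
      (hσ _ (c.isPlus_permute _ _ hγ))

theorem SignRel.induction {X Y : F} (P : c.Chain X Y → c.Chain X Y → ℤˣ → Prop)
    (refl : ∀ γ, γ.IsPlus → P γ γ 1)
    (trans : ∀ γ δ η ε ε', γ.IsPlus → δ.IsPlus → η.IsPlus → P γ δ ε → P δ η ε' → P γ η (ε * ε'))
    (adj : ∀ γ δ, γ.IsPlus → δ.IsPlus → c.Adj γ δ → P γ δ (-1)) {γ δ : c.Chain X Y} {ε : ℤˣ}
    (hγ : γ.IsPlus) (h : c.SignRel ε γ δ) : P γ δ ε := by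
  obtain ⟨n, γ, σ, rfl, rfl, rfl⟩ := h
  exact permute_induction (fun γ δ ε => P γ.1 δ.1 ε) (fun γ => refl γ.1)
    (fun γ δ η => trans γ.1 δ.1 η.1) (fun γ δ => adj γ.1 δ.1) σ γ hγ

end CubicalStructure

/-! ### Tensoring chains of length two with identities -/

section Whisker

variable {V : Type u₁} [Groupoid.{v₁} V] {F : Type u₂} [Category.{v₂} F] [MonoidalCategory F]
  [SymmetricCategory F] {ι : V ⥤ F}

open ProperDegree ProperDegree.Chain

/-- Write `f` and `f'` as basic morphisms tensored with `R` and `R'`. By heredity the reassociated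
comparison isomorphism is a tensor product of a part on the basic morphisms and a part on `R ⊗ B`.
The corresponding isomorphism of sources comes from one tensored with `B`, so the second part does
so too. -/
theorem IsFeynman.exists_eq_whiskerRight_of_deg_eq_one (hF : IsFeynman ι) (d : ProperDegree ι)
    {X Y Y' B : F} {f : X ⟶ Y} {f' : X ⟶ Y'} (hf : d.deg f = 1) (hf' : d.deg f' = 1)
    (g : Y ⊗ B ⟶ Y' ⊗ B) [IsIso g] (h : f ▷ B ≫ g = f' ▷ B) :
    ∃ g₀ : Y ⟶ Y', IsIso g₀ ∧ g = g₀ ▷ B ∧ f ≫ g₀ = f' := by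
  obtain ⟨C, R, w, φ, p, q, hp, hq, rfl⟩ := hF.exists_eq_of_deg_eq_one d f hf
  obtain ⟨C', R', w', φ', p', q', hp', hq', rfl⟩ := hF.exists_eq_of_deg_eq_one d f' hf'
  generalize (FreeSym.lift ι).obj R = R at *
  generalize (FreeSym.lift ι).obj R' = R' at *
  obtain ⟨p₁, p₂, f, hp₁, hp₂, h₁, h₂, h₃⟩ := hF.exists_eq_tensorHom d (φ := φ.1) (φ' := φ'.1)
    (by rw [φ.2]; decide)
    ((α_ _ R B).inv ≫ (inv p ≫ p') ▷ B ≫ (α_ _ R' B).hom)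
    ((α_ _ R B).inv ≫ (q ▷ B ≫ g ≫ inv q' ▷ B) ≫ (α_ _ R' B).hom) (by
      rw [← cancel_epi (α_ _ R B).hom, ← cancel_epi (p ▷ B)]
      have e : p ▷ B ≫ φ.1 ▷ R ▷ B ≫ q ▷ B ≫ g = p' ▷ B ≫ φ'.1 ▷ R' ▷ B ≫ q' ▷ B := by
        simpa using h
      have e' := congrArg (fun t => t ≫ inv q' ▷ B ≫ (α_ _ R' B).hom) e
      simp only [Category.assoc] at e' ⊢
      have e'' : q' ▷ B ≫ inv q' ▷ B = 𝟙 _ := by rw [← MonoidalCategory.comp_whiskerRight]; simp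
      rw [reassoc_of% e''] at e'
      simpa using e')
  obtain ⟨s, hs, rfl, h₄⟩ := hF.exists_eq_whiskerRight h₁
  refine ⟨inv q ≫ (ι.map f ⊗ₘ s) ≫ q', inferInstance, ?_, ?_⟩
  · have e : q ▷ B ≫ g ≫ inv q' ▷ B = (ι.map f ⊗ₘ s) ▷ B := by
      rw [← cancel_epi (α_ _ R B).inv, ← cancel_mono (α_ _ R' B).hom, Category.assoc, h₂]
      rw [← tensorHom_id, ← tensorHom_id, Category.assoc, associator_naturality,
        Iso.inv_hom_id_assoc]
    rw [← cancel_epi (q ▷ B), ← cancel_mono (inv q' ▷ B), Category.assoc, e,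
      ← MonoidalCategory.comp_whiskerRight, ← MonoidalCategory.comp_whiskerRight]
    simp
  · have e : φ.1 ▷ R ≫ (ι.map f ⊗ₘ s) = (p₁ ⊗ₘ s) ≫ φ'.1 ▷ R' := by
      rw [← tensorHom_id, ← tensorHom_id, tensorHom_comp_tensorHom, tensorHom_comp_tensorHom, h₃]
      simp
    simp only [Category.assoc, IsIso.hom_inv_id_assoc]
    rw [reassoc_of% e, ← h₄]
    simp

theorem ProperDegree.Chain.eq_single_of_length_eq_one {d : ProperDegree ι} {X Y : F}
    (γ : d.Chain X Y) (hγ : γ.length = 1) (h : γ.IsPlus) :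
    ∃ f : X ⟶ Y, d.deg f = 1 ∧ γ = single d f := by
  obtain ⟨Z, f, δ, hf, hδ, rfl⟩ := exists_eq_single_comp γ hγ
  obtain ⟨hi, hδ⟩ := eq_single_of_length_eq_zero δ hδ
  rw [isPlus_comp, isPlus_single] at h
  refine ⟨f ≫ δ.value, ?_, ?_⟩
  · rw [d.deg_comp, d.deg_of_isIso δ.value]; omega
  · conv_lhs => rw [hδ]
    rw [single_comp_single_of_right]

theorem ProperDegree.Chain.exists_eq_single_comp_of_isPlus {d : ProperDegree ι} {X Y : F}
    (γ : d.Chain X Y) {n : ℕ} (hγ : γ.length = n + 1) (h : γ.IsPlus) :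
    ∃ (Z : F) (f : X ⟶ Z) (δ : d.Chain Z Y), d.deg f = 1 ∧ δ.length = n ∧ δ.IsPlus ∧
      γ = (single d f).comp δ := by
  obtain ⟨Z, f, δ, hf, hδ, rfl⟩ := exists_eq_single_comp γ hγ
  rw [isPlus_comp, isPlus_single] at h
  exact ⟨Z, f, δ, by omega, hδ, h.2, rfl⟩

/-- The first morphisms of the tensored chains differ by an isomorphism, which itself comes from an
isomorphism before tensoring with `B`. It is absorbed into the second morphism. -/
theorem IsFeynman.chain_whiskerRight_injective (hF : IsFeynman ι) {d : ProperDegree ι} {X Y B : F}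
    {β β' : d.ChainN 2 X Y} (hβ : β.1.IsPlus) (hβ' : β'.1.IsPlus)
    (h : β.1.whiskerRight B = β'.1.whiskerRight B) : β = β' := by
  obtain ⟨β, hl⟩ := β
  obtain ⟨β', hl'⟩ := β'
  apply Subtype.ext
  dsimp only at *
  obtain ⟨Z, f, δ, hf, hδ, hδ', rfl⟩ := exists_eq_single_comp_of_isPlus β hl hβ
  obtain ⟨f₂, hf₂, rfl⟩ := eq_single_of_length_eq_one δ hδ hδ'
  obtain ⟨Z', f', η, hf', hη, hη', rfl⟩ := exists_eq_single_comp_of_isPlus β' hl' hβ'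
  obtain ⟨f₂', hf₂', rfl⟩ := eq_single_of_length_eq_one η hη hη'
  simp only [ProperDegree.Chain.comp_whiskerRight, single_whiskerRight] at h
  obtain ⟨g, hg, h₁, h₂⟩ := single_comp_eq_single_comp
    (by rw [d.deg_whiskerRight, hf]; decide) (by rw [d.deg_whiskerRight, hf']; decide) h
  obtain ⟨g₀, hg₀, rfl, rfl⟩ := hF.exists_eq_whiskerRight_of_deg_eq_one d hf hf' g h₁
  have h₃ := congrArg Chain.value h₂
  simp only [value_comp, value_single] at h₃
  -- The second morphisms agree after tensoring. The comparison lemma with the identity of `Y ⊗ B`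
  -- gives an isomorphism `g₁` whose whiskering is an identity, so that `g₁` is one as well.
  obtain ⟨g₁, hg₁, h₄, h₅⟩ := hF.exists_eq_whiskerRight_of_deg_eq_one d (B := B) (f := f₂)
    (f' := g₀ ≫ f₂') hf₂ (by rw [d.deg_comp, hf₂', d.deg_of_isIso]) (𝟙 _) (by simpa using h₃)
  have h₆ : g₁ = 𝟙 _ := hF.whiskerRight_injective (B := B) (by rw [← h₄]; simp)
  rw [h₆, Category.comp_id] at h₅
  rw [h₅, ← single_comp_single_of_left g₀ f₂', single_comp_single_comp_of_right]

end Whisker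

/-! ### Compatibility of permutations with the tensor product -/

namespace CubicalStructure

variable {V : Type u₁} [Groupoid.{v₁} V] {F : Type u₂} [Category.{v₂} F] [MonoidalCategory F]
  [SymmetricCategory F] {ι : V ⥤ F} {c : CubicalStructure ι}

open ProperDegree ProperDegree.Chain

theorem Adj.signRel {X Y : F} {γ δ : c.Chain X Y} (h : c.Adj γ δ) : c.SignRel (-1) γ δ := by
  obtain ⟨X', Y', α, β, η, rfl, rfl⟩ := h
  exact .comp_left _ (.comp_right (signRel_swap β) _)

/-- The chains `β ⊗ B` and `swap β ⊗ B` have the same composition, so they agree or are exchanged by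
the transposition. If they agreed, injectivity of tensoring would make `β` a fixed point of a free
action. -/
theorem swap_whiskerRight (hF : IsFeynman ι) {X Y : F} (β : c.ChainN 2 X Y) (hβ : β.1.IsPlus)
    (B : F) : ((c.swap β).1.whiskerRight B) =
      (c.swap ⟨β.1.whiskerRight B, (length_whiskerRight _ B).trans β.2⟩).1 := by
  have hβ' := c.isPlus_permute (Equiv.swap 0 1) β hβ
  rcases eq_or_eq_swap (c := c) (β := ⟨β.1.whiskerRight B, (length_whiskerRight _ B).trans β.2⟩)
    (β' := ⟨(c.swap β).1.whiskerRight B, (length_whiskerRight _ B).trans (c.swap β).2⟩)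
    (hβ.whiskerRight B) (hβ'.whiskerRight B)
    (by rw [value_whiskerRight, value_whiskerRight, c.value_permute _ _ hβ]) with h | h
  · exact (swap_ne β (hF.chain_whiskerRight_injective hβ' hβ (congrArg Subtype.val h))).elim
  · exact congrArg Subtype.val h

theorem Adj.whiskerRight (hF : IsFeynman ι) {X Y : F} {γ δ : c.Chain X Y} (h : c.Adj γ δ)
    (hγ : γ.IsPlus) (B : F) : c.Adj (γ.whiskerRight B) (δ.whiskerRight B) := by
  obtain ⟨X', Y', α, β, η, rfl, rfl⟩ := h
  rw [isPlus_comp, isPlus_comp] at hγ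
  refine ⟨_, _, α.whiskerRight B, ⟨β.1.whiskerRight B, (length_whiskerRight _ B).trans β.2⟩,
    η.whiskerRight B, ?_, ?_⟩
  · rw [ProperDegree.Chain.comp_whiskerRight, ProperDegree.Chain.comp_whiskerRight]
  · rw [ProperDegree.Chain.comp_whiskerRight, ProperDegree.Chain.comp_whiskerRight,
      swap_whiskerRight hF β hγ.2.1]

theorem SignRel.whiskerRight (hF : IsFeynman ι) {X Y : F} {γ δ : c.Chain X Y} {ε : ℤˣ}
    (h : c.SignRel ε γ δ) (hγ : γ.IsPlus) (B : F) :
    c.SignRel ε (γ.whiskerRight B) (δ.whiskerRight B) :=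
  SignRel.induction (fun γ δ ε => c.SignRel ε (γ.whiskerRight B) (δ.whiskerRight B))
    (fun _ _ => .refl _) (fun _ _ _ _ _ _ _ _ h h' => h.trans h')
    (fun _ _ hγ _ h => (h.whiskerRight hF hγ B).signRel) hγ h

/-- If the two chains agreed, uniqueness of the first morphism would give an isomorphism between `Y
⊗ g` and `f ⊗ Y'` over the identity of `Y ⊗ Y'`. With the basic morphisms in `g` and `f` moved to
the front it would split as a tensor product, so the braiding of the targets would keep the first
letter in front. -/
theorem single_exchange_ne (hF : IsFeynman ι) {X X' Y Y' : F} (f : X ⟶ Y) (g : X' ⟶ Y')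
    (hf : c.deg f = 1) (hg : c.deg g = 1) :
    (single c.toProperDegree (f ▷ X')).comp (single _ (Y ◁ g)) ≠
      (single _ (X ◁ g)).comp (single _ (f ▷ Y')) := by
  intro h
  obtain ⟨g₀, hg₀, -, h₂⟩ := single_comp_eq_single_comp
    (by rw [c.deg_whiskerRight, hf]; decide) (by rw [deg_whiskerLeft, hg]; decide) h
  have h₃ := congrArg Chain.value h₂
  simp only [value_comp, value_single] at h₃
  obtain ⟨C, R, w, φ, p, q, hp, hq, rfl⟩ := hF.exists_eq_of_deg_eq_one c.toProperDegree f hf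
  obtain ⟨D, R', u, ψ, p', q', hp', hq', rfl⟩ := hF.exists_eq_of_deg_eq_one c.toProperDegree g hg
  generalize (FreeSym.lift ι).obj R = R at *
  generalize (FreeSym.lift ι).obj R' = R' at *
  obtain ⟨p₁, p₂, f, hp₁, hp₂, -, h₄, -⟩ := hF.exists_eq_tensorHom c.toProperDegree (φ := ψ.1)
    (φ' := φ.1) (by rw [ψ.2]; decide)
    ((α_ _ R' Y).inv ≫ (inv p' ▷ Y ≫ (β_ X' Y).hom ≫ g₀ ≫ p ▷ Y') ≫ (α_ _ R Y').hom)
    ((α_ _ R' Y).inv ≫ (q' ▷ Y ≫ (β_ Y' Y).hom ≫ inv q ▷ Y') ≫ (α_ _ R Y').hom) (by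
      rw [← cancel_epi (α_ _ R' Y).hom, ← cancel_epi (p' ▷ Y)]
      have e := congrArg (fun t => (β_ X' Y).hom ≫ t ≫ inv q ▷ Y' ≫ (α_ _ R Y').hom) h₃
      rw [← BraidedCategory.braiding_naturality_left_assoc] at e
      have e₁ : q ▷ Y' ≫ inv q ▷ Y' = 𝟙 _ := by rw [← MonoidalCategory.comp_whiskerRight]; simp
      have e₂ : p' ▷ Y ≫ inv p' ▷ Y = 𝟙 _ := by rw [← MonoidalCategory.comp_whiskerRight]; simp
      simp only [MonoidalCategory.comp_whiskerRight, Category.assoc] at e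
      rw [reassoc_of% e₁] at e
      simp only [Category.assoc, MonoidalCategory.whiskerRight_tensor, Iso.hom_inv_id_assoc]
      rw [reassoc_of% e₂, e])
  refine hF.tensorHom_ne_braiding f (R' ◁ q ≫ p₂ ≫ R ◁ inv q') ?_
  have e : ι.map f ⊗ₘ (R' ◁ q ≫ p₂ ≫ R ◁ inv q') =
      _ ◁ (R' ◁ q) ≫ (ι.map f ⊗ₘ p₂) ≫ _ ◁ (R ◁ inv q') := by
    rw [← id_tensorHom _ (R' ◁ q), ← id_tensorHom _ (R ◁ inv q'), tensorHom_comp_tensorHom,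
      tensorHom_comp_tensorHom, Category.id_comp, Category.comp_id]
  have e₁ : q ▷ Y' ≫ inv q ▷ Y' = 𝟙 _ := by rw [← MonoidalCategory.comp_whiskerRight]; simp
  rw [e, ← h₄]
  simp only [Category.assoc]
  rw [← associator_naturality_right, associator_inv_naturality_right_assoc,
    whisker_exchange_assoc, BraidedCategory.braiding_naturality_right_assoc, reassoc_of% e₁,
    BraidedCategory.braiding_naturality_left_assoc, ← MonoidalCategory.whiskerLeft_comp_assoc]
  simp

/-- The two orders have the same composition and are different chains, so the transposition must
exchange them. -/
theorem swap_single_exchange (hF : IsFeynman ι) {X X' Y Y' : F} (f : X ⟶ Y) (g : X' ⟶ Y')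
    (hf : c.deg f = 1) (hg : c.deg g = 1) (β : c.ChainN 2 (X ⊗ X') (Y ⊗ Y'))
    (hβ : β.1 = (single c.toProperDegree (f ▷ X')).comp (single _ (Y ◁ g))) :
    (c.swap β).1 = (single _ (X ◁ g)).comp (single _ (f ▷ Y')) := by
  have hf' (B : F) : c.deg (f ▷ B) = 1 := (c.deg_whiskerRight f B).trans hf
  have hg' (B : F) : c.deg (B ◁ g) = 1 := (deg_whiskerLeft _ B g).trans hg
  have h₂ : ((single c.toProperDegree (X ◁ g)).comp (single _ (f ▷ Y'))).length = 2 := by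
    rw [length_comp, length_single_of_ne, length_single_of_ne] <;> simp [hf', hg']
  rcases eq_or_eq_swap (c := c) (β := β) (β' := ⟨_, h₂⟩)
    (by rw [hβ]; simp [isPlus_comp, isPlus_single, hf', hg'])
    (by simp [isPlus_comp, isPlus_single, hf', hg'])
    (by rw [hβ]; simp [value_comp, value_single, whisker_exchange]) with h | h
  · exact (single_exchange_ne hF f g hf hg (hβ.symm.trans (congrArg Subtype.val h).symm)).elim
  · exact (congrArg Subtype.val h).symm

/-- The exponent is 1 exactly if both degrees are 1. If one of the morphisms is an isomorphism, both
chains reduce to the same chain with one term. -/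
theorem signRel_single_exchange (hF : IsFeynman ι) {X X' Y Y' : F} (f : X ⟶ Y) (g : X' ⟶ Y')
    (hf : c.deg f ≤ 1) (hg : c.deg g ≤ 1) :
    c.SignRel ((-1) ^ ((single c.toProperDegree f).length * (single c.toProperDegree g).length))
      ((single c.toProperDegree (f ▷ X')).comp (single _ (Y ◁ g)))
      ((single _ (X ◁ g)).comp (single _ (f ▷ Y'))) := by
  by_cases hf₀ : c.deg f = 0
  · rw [length_single, if_pos hf₀, zero_mul, pow_zero,
      single_comp_single _ _ (.inl (by rw [c.deg_whiskerRight, hf₀])),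
      single_comp_single _ _ (.inr (by rw [c.deg_whiskerRight, hf₀])), whisker_exchange]
    exact .refl _
  by_cases hg₀ : c.deg g = 0
  · rw [length_single g, if_pos hg₀, mul_zero, pow_zero,
      single_comp_single _ _ (.inr (by rw [deg_whiskerLeft, hg₀])),
      single_comp_single _ _ (.inl (by rw [deg_whiskerLeft, hg₀])), whisker_exchange]
    exact .refl _
  have hl : ((single c.toProperDegree (f ▷ X')).comp (single _ (Y ◁ g))).length = 2 := by
    rw [length_comp, length_single_of_ne _ (by rwa [c.deg_whiskerRight]),
      length_single_of_ne _ (by rwa [deg_whiskerLeft])]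
  rw [length_single_of_ne f hf₀, length_single_of_ne g hg₀, mul_one, pow_one,
    ← swap_single_exchange hF f g (by omega) (by omega) ⟨_, hl⟩ rfl]
  exact signRel_swap ⟨_, hl⟩

theorem signRel_exchange_single (hF : IsFeynman ι) {X X' Y Y' : F} (γ : c.Chain X Y)
    (hγ : γ.IsPlus) (g : X' ⟶ Y') (hg : c.deg g ≤ 1) :
    c.SignRel ((-1) ^ (γ.length * (single c.toProperDegree g).length))
      ((γ.whiskerRight X').comp (single _ (Y ◁ g)))
      ((single _ (X ◁ g)).comp (γ.whiskerRight Y')) := by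
  induction γ using cons_induction with
  | h₀ =>
    rw [nil_whiskerRight, nil_whiskerRight, nil_comp, comp_nil, length_nil, zero_mul, pow_zero]
    exact .refl _
  | h f γ ih =>
    rw [isPlus_comp, isPlus_single] at hγ
    rw [ProperDegree.Chain.comp_whiskerRight, ProperDegree.Chain.comp_whiskerRight,
      single_whiskerRight, single_whiskerRight, length_comp, add_mul, pow_add, mul_comm, comp_assoc]
    refine (SignRel.comp_left _ (ih hγ.2)).trans ?_
    rw [← comp_assoc, ← comp_assoc]
    exact .comp_right (signRel_single_exchange hF f g hγ.1 hg) _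

/-- The Koszul rule for chains: each crossing of two morphisms of degree 1 contributes a factor -1.
The morphisms of `δ` are moved across `γ` one by one. -/
theorem signRel_exchange (hF : IsFeynman ι) {X X' Y Y' : F} (γ : c.Chain X Y) (hγ : γ.IsPlus)
    (δ : c.Chain X' Y') (hδ : δ.IsPlus) :
    c.SignRel ((-1) ^ (γ.length * δ.length)) ((γ.whiskerRight X').comp (δ.whiskerLeft Y))
      ((δ.whiskerLeft X).comp (γ.whiskerRight Y')) := by
  induction δ using cons_induction with
  | h₀ =>
    rw [nil_whiskerLeft, nil_whiskerLeft, nil_comp, comp_nil, length_nil, mul_zero, pow_zero]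
    exact .refl _
  | h f δ ih =>
    rw [isPlus_comp, isPlus_single] at hδ
    rw [comp_whiskerLeft, comp_whiskerLeft, single_whiskerLeft, single_whiskerLeft, length_comp,
      mul_add, pow_add, comp_assoc, ← comp_assoc]
    refine (SignRel.comp_right (signRel_exchange_single hF γ hγ f hδ.1) _).trans ?_
    rw [comp_assoc]
    exact .comp_left _ (ih hδ.2)

end CubicalStructure

/-! ### The axioms of the free operad -/

section FreeOpAxioms

variable {k : Type w'} [Field k] {V : Type u₁} [Groupoid.{v₁} V]
  {A : FreeSym V → V → Type w} [∀ X v, AddCommGroup (A X v)] [∀ X v, Module k (A X v)]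
  (M : CorModule (k := k) A) (d : ℤ)

/-- The element of the free operad represented by a formal composite. -/
noncomputable def freeTerm {X : FreeSym V} {v : V} (t : Term A X v) : FreeOp M d X v :=
  Submodule.Quotient.mk (mono k t)

theorem freeTerm_act {X X' : FreeSym V} {v v' : V} (g : X' ⟶ X) (h : v ⟶ v') (t : Term A X v) :
    (freeOp M d).act g h (freeTerm M d t) = freeTerm M d (.act g h t) := by
  change Submodule.Quotient.mk ((preFree k A d).act g h (mono k t)) = _
  simp [preFree, freeTerm]

theorem freeTerm_comp {B C : FreeSym V} {w v : V} (t : Term A (.of w ⊗ B) v) (s : Term A C w) :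
    (freeOp M d).comp (freeTerm M d t) (freeTerm M d s) = freeTerm M d (.comp t s) := by
  change Submodule.Quotient.mk ((preFree k A d).comp (mono k t) (mono k s)) = _
  simp [preFree, freeTerm]

theorem freeTerm_one (v : V) : (freeOp M d).one v = freeTerm M d (.one v) := rfl

theorem mk_eq_of_freeRel {X : FreeSym V} {v : V} {x y : Term A X v →₀ k}
    (h : FreeRel M d X v (x - y)) : (Submodule.Quotient.mk x : FreeOp M d X v) =
      Submodule.Quotient.mk y :=
  (Submodule.Quotient.eq _).2 (.mem h)

variable {M d}

theorem FreeOp.induction {X : FreeSym V} {v : V} {P : FreeOp M d X v → Prop}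
    (term : ∀ t, P (freeTerm M d t)) (zero : P 0) (add : ∀ x y, P x → P y → P (x + y))
    (smul : ∀ (a : k) x, P x → P (a • x)) (x : FreeOp M d X v) : P x := by
  induction x using Submodule.Quotient.induction_on with | _ x
  induction x using Finsupp.induction_linear with
  | zero => exact zero
  | add x y hx hy => exact add _ _ hx hy
  | single t a =>
    have : (Submodule.Quotient.mk (Finsupp.single t a) : FreeOp M d X v) = a • freeTerm M d t := by
      rw [freeTerm, ← Submodule.Quotient.mk_smul, Finsupp.smul_single, smul_eq_mul, mul_one]
    rw [this]
    exact smul a _ (term t)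

variable (M d)

/-- The inclusion of the generators as a linear map. -/
noncomputable def freeGenₗ (X : FreeSym V) (v : V) : A X v →ₗ[k] FreeOp M d X v where
  toFun := freeGen M d
  map_add' a b := mk_eq_of_freeRel M d (.gen_add a b)
  map_smul' a x := mk_eq_of_freeRel M d (.gen_smul a x)

theorem act_freeGen {X X' : FreeSym V} {v v' : V} (g : X' ⟶ X) (h : v ⟶ v') (a : A X v) :
    (freeOp M d).act g h (freeGen M d a) = freeGen M d (M.act g h a) :=
  (freeTerm_act M d g h (.gen a)).trans (mk_eq_of_freeRel M d (.gen_act g h a))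

theorem freeOp_act_id {X : FreeSym V} {v : V} (x : FreeOp M d X v) :
    (freeOp M d).act (𝟙 X) (𝟙 v) x = x := by
  induction x using FreeOp.induction with
  | term t => rw [freeTerm_act]; exact mk_eq_of_freeRel M d (.act_id t)
  | zero => exact map_zero _
  | add x y hx hy => rw [map_add, hx, hy]
  | smul a x hx => rw [map_smul, hx]

theorem freeOp_act_act {X X' X'' : FreeSym V} {v v' v'' : V} (g : X' ⟶ X) (h : v ⟶ v')
    (g' : X'' ⟶ X') (h' : v' ⟶ v'') (x : FreeOp M d X v) :
    (freeOp M d).act g' h' ((freeOp M d).act g h x) = (freeOp M d).act (g' ≫ g) (h ≫ h') x := by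
  induction x using FreeOp.induction with
  | term t => simp only [freeTerm_act]; exact mk_eq_of_freeRel M d (.act_act g h g' h' t)
  | zero => simp only [map_zero]
  | add x y hx hy => simp only [map_add, hx, hy]
  | smul a x hx => simp only [map_smul, hx]

theorem freeOp_comp_act {B B' C C' : FreeSym V} {w w' v v' : V} (f : w ⟶ w') (g : B' ⟶ B)
    (h : v ⟶ v') (c : C' ⟶ C) (x : FreeOp M d (.of w' ⊗ B) v) (y : FreeOp M d C w) :
    (freeOp M d).comp ((freeOp M d).act (FreeSym.ofMap f ⊗ₘ g) h x)
        ((freeOp M d).act c (𝟙 w) y) =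
      (freeOp M d).act (c ⊗ₘ g) h ((freeOp M d).comp x ((freeOp M d).act (𝟙 C) f y)) := by
  induction x using FreeOp.induction with
  | zero => simp only [map_zero, LinearMap.zero_apply]
  | add x y hx hy => simp only [map_add, LinearMap.add_apply, hx, hy]
  | smul a x hx => simp only [map_smul, LinearMap.smul_apply, hx]
  | term t =>
    induction y using FreeOp.induction with
    | zero => simp only [map_zero]
    | add x y hx hy => simp only [map_add, hx, hy]
    | smul a x hx => simp only [map_smul, hx]
    | term s =>
      simp only [freeTerm_act, freeTerm_comp]
      exact mk_eq_of_freeRel M d (.comp_act f g h c t s)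

theorem freeOp_one_act {v v' : V} (f : v ⟶ v') :
    (freeOp M d).act (FreeSym.ofMap f) (𝟙 v') ((freeOp M d).one v') =
      (freeOp M d).act (𝟙 (.of v)) f ((freeOp M d).one v) := by
  simp only [freeTerm_one, freeTerm_act]
  exact mk_eq_of_freeRel M d (.one_act f)

theorem freeOp_comp_one {B : FreeSym V} {w v : V} (x : FreeOp M d (.of w ⊗ B) v) :
    (freeOp M d).comp x ((freeOp M d).one w) = x := by
  induction x using FreeOp.induction with
  | zero => simp only [map_zero, LinearMap.zero_apply]
  | add x y hx hy => rw [map_add, LinearMap.add_apply, hx, hy]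
  | smul a x hx => rw [map_smul, LinearMap.smul_apply, hx]
  | term t =>
    simp only [freeTerm_one, freeTerm_comp]
    exact mk_eq_of_freeRel M d (.comp_one t)

theorem freeOp_one_comp {C : FreeSym V} {v : V} (y : FreeOp M d C v) :
    (freeOp M d).comp ((freeOp M d).act (ρ_ (FreeSym.of v)).hom (𝟙 v) ((freeOp M d).one v)) y =
      (freeOp M d).act (ρ_ C).hom (𝟙 v) y := by
  induction y using FreeOp.induction with
  | zero => simp only [map_zero]
  | add x y hx hy => simp only [map_add, hx, hy]
  | smul a x hx => simp only [map_smul, hx]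
  | term t =>
    simp only [freeTerm_one, freeTerm_act, freeTerm_comp]
    exact mk_eq_of_freeRel M d (.one_comp t)

theorem freeOp_assoc {B C D : FreeSym V} {u w v : V} (x : FreeOp M d (.of w ⊗ B) v)
    (y : FreeOp M d (.of u ⊗ C) w) (z : FreeOp M d D u) :
    (freeOp M d).comp ((freeOp M d).act (α_ (.of u) C B).inv (𝟙 v) ((freeOp M d).comp x y)) z =
      (freeOp M d).act (α_ D C B).inv (𝟙 v) ((freeOp M d).comp x ((freeOp M d).comp y z)) := by
  induction x using FreeOp.induction with
  | zero => simp only [map_zero, LinearMap.zero_apply]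
  | add x y hx hy => simp only [map_add, LinearMap.add_apply, hx, hy]
  | smul a x hx => simp only [map_smul, LinearMap.smul_apply, hx]
  | term t =>
    induction y using FreeOp.induction with
    | zero => simp only [map_zero, LinearMap.zero_apply]
    | add x y hx hy => simp only [map_add, LinearMap.add_apply, hx, hy]
    | smul a x hx => simp only [map_smul, LinearMap.smul_apply, hx]
    | term s =>
      induction z using FreeOp.induction with
      | zero => simp only [map_zero]
      | add x y hx hy => simp only [map_add, hx, hy]
      | smul a x hx => simp only [map_smul, hx]
      | term r =>
        simp only [freeTerm_act, freeTerm_comp]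
        exact mk_eq_of_freeRel M d (.assoc t s r)

/-- For two generators both weights in the defining relation are 1, so the sign depends on `d` only.
-/
theorem freeOp_parallel {B C D : FreeSym V} {u w v : V} (x : FreeOp M d (.of w ⊗ (.of u ⊗ B)) v)
    (a : A C w) (b : A D u) :
    (freeOp M d).comp ((freeOp M d).act (leftComm (.of u) C B) (𝟙 v)
        ((freeOp M d).comp x (freeGen M d a))) (freeGen M d b) =
      koszulSign d d • (freeOp M d).act (leftComm D C B) (𝟙 v)
        ((freeOp M d).comp ((freeOp M d).act (leftComm (.of w) D B) (𝟙 v)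
          ((freeOp M d).comp ((freeOp M d).act (leftComm (.of u) (.of w) B) (𝟙 v) x)
            (freeGen M d b))) (freeGen M d a)) := by
  induction x using FreeOp.induction with
  | zero => simp only [map_zero, LinearMap.zero_apply, smul_zero]
  | add x y hx hy => simp only [map_add, LinearMap.add_apply, hx, hy, smul_add]
  | smul a x hx => simp only [map_smul, LinearMap.smul_apply, hx, smul_comm a]
  | term t =>
    have h := mk_eq_of_freeRel M d (.parallel t (.gen a) (.gen b))
    rw [Submodule.Quotient.mk_smul] at h
    simp only [Term.weight, Nat.cast_one, mul_one] at h
    change (freeOp M d).comp ((freeOp M d).act _ _ ((freeOp M d).comp _ (freeTerm M d (.gen a))))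
      (freeTerm M d (.gen b)) = _ • (freeOp M d).act _ _ ((freeOp M d).comp ((freeOp M d).act _ _
      ((freeOp M d).comp ((freeOp M d).act _ _ _) (freeTerm M d (.gen b)))) (freeTerm M d (.gen a)))
    simp only [freeTerm_act, freeTerm_comp]
    exact h

theorem freeOp_act_eq {X X' : FreeSym V} {v v' : V} (g : X' ⟶ X) (h : v ⟶ v')
    (x : FreeOp M d X v) : (freeOp M d).act g h x =
      (freeOp M d).act g (𝟙 v') ((freeOp M d).act (𝟙 X) h x) := by
  rw [freeOp_act_act, Category.comp_id, Category.comp_id]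

/-- Equivariance of the composition in the inputs of the upper vertex. -/
theorem freeOp_comp_act_upper {B C C' : FreeSym V} {w v : V} (c : C' ⟶ C)
    (x : FreeOp M d (.of w ⊗ B) v) (y : FreeOp M d C w) :
    (freeOp M d).comp x ((freeOp M d).act c (𝟙 w) y) =
      (freeOp M d).act (c ▷ B) (𝟙 v) ((freeOp M d).comp x y) := by
  have := freeOp_comp_act M d (𝟙 w) (𝟙 B) (𝟙 v) c x y
  simpa only [FreeSym.ofMap_id, id_whiskerRight, freeOp_act_id, tensorHom_id] using this

/-- Equivariance of the composition in the output and the other inputs of the lower vertex. -/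
theorem freeOp_comp_act_lower {B B' C : FreeSym V} {w v v' : V} (g : B' ⟶ B) (h : v ⟶ v')
    (x : FreeOp M d (.of w ⊗ B) v) (y : FreeOp M d C w) :
    (freeOp M d).comp ((freeOp M d).act (.of w ◁ g) h x) y =
      (freeOp M d).act (C ◁ g) h ((freeOp M d).comp x y) := by
  have := freeOp_comp_act M d (𝟙 w) g h (𝟙 C) x y
  simpa only [FreeSym.ofMap_id, id_tensorHom, freeOp_act_id] using this

/-- Equivariance of the composition in the colour of the edge. -/
theorem freeOp_comp_act_edge {B C : FreeSym V} {w w' v : V} (f : w ⟶ w')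
    (x : FreeOp M d (.of w' ⊗ B) v) (y : FreeOp M d C w) :
    (freeOp M d).comp x ((freeOp M d).act (𝟙 C) f y) =
      (freeOp M d).comp ((freeOp M d).act (FreeSym.ofMap f ▷ B) (𝟙 v) x) y := by
  have := freeOp_comp_act M d f (𝟙 B) (𝟙 v) (𝟙 C) x y
  simpa only [tensorHom_id, id_whiskerRight, freeOp_act_id] using this.symm

end FreeOpAxioms

/-! ### Reading chains as trees -/

section Readings

variable {k : Type w'} [Field k] {V : Type u₁} [Groupoid.{v₁} V] {F : Type u₂} [Category.{v₂} F]
  [MonoidalCategory F] [SymmetricCategory F] {ι : V ⥤ F} {d : ProperDegree ι}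
  {A : FreeSym V → V → Type w} [∀ X v, AddCommGroup (A X v)] [∀ X v, Module k (A X v)]
  {M : CorModule (k := k) A} {n : ℤ} {e : ∀ {X v}, BasicOne d X v → A X v}

open ProperDegree ProperDegree.Chain

theorem ProperDegree.Chain.length_single_whiskerRight_comp {C w B Y : F} {φ : C ⟶ w}
    (hφ : d.deg φ = 1) (γ : d.Chain (w ⊗ B) Y) :
    (((single d φ).whiskerRight B).comp γ).length = γ.length + 1 := by
  rw [length_comp, length_whiskerRight, length_single_of_ne _ (by rw [hφ]; decide), add_comm]

theorem ProperDegree.Chain.length_single_comp_of_isIso {X Y Z : F} {p : X ⟶ Y} (_ : IsIso p)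
    (γ : d.Chain Y Z) : ((single d p).comp γ).length = γ.length := by
  rw [length_comp, length_single_of_isIso, zero_add]

theorem ProperDegree.Chain.single_comp_of_eq_id {X Y : F} {p : X ⟶ X} (h : p = 𝟙 X)
    (γ : d.Chain X Y) : (single d p).comp γ = γ := by
  rw [h, single_id, nil_comp]

namespace Reads

theorem congr {X : FreeSym V} {v : V} {x : FreeOp M n X v}
    {γ γ' : d.Chain ((FreeSym.lift ι).obj X) (ι.obj v)} (h : Reads e x γ) (hγ : γ = γ') :
    Reads e x γ' := hγ ▸ h

theorem act_left {X X' : FreeSym V} {v : V} (g : X' ⟶ X) {x : FreeOp M n X v}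
    {γ : d.Chain ((FreeSym.lift ι).obj X) (ι.obj v)} (h : Reads e x γ) :
    Reads e ((freeOp M n).act g (𝟙 v) x) ((single d ((FreeSym.lift ι).map g)).comp γ) :=
  (h.act g (𝟙 v)).congr (by rw [ι.map_id, single_id, comp_nil])

theorem act_right {X : FreeSym V} {v v' : V} (f : v ⟶ v') {x : FreeOp M n X v}
    {γ : d.Chain ((FreeSym.lift ι).obj X) (ι.obj v)} (h : Reads e x γ) :
    Reads e ((freeOp M n).act (𝟙 X) f x) (γ.comp (single d (ι.map f))) :=
  (h.act (𝟙 X) f).congr (by rw [(FreeSym.lift ι).map_id, single_id, nil_comp])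

theorem isPlus {X : FreeSym V} {v : V} {x : FreeOp M n X v}
    {γ : d.Chain ((FreeSym.lift ι).obj X) (ι.obj v)} (h : Reads e x γ) : γ.IsPlus := by
  induction h with
  | one v => exact .nil
  | act g h _ ih => exact .comp (.comp (.single (d.deg_map_le _ _)) ih) (.single (d.deg_map_le _ _))
  | comp φ _ ih => exact .comp (.whiskerRight (.single φ.2.le) _) ih

theorem exists_term {X : FreeSym V} {v : V} {x : FreeOp M n X v}
    {γ : d.Chain ((FreeSym.lift ι).obj X) (ι.obj v)} (h : Reads e x γ) :
    ∃ t : Term A X v, t.weight = γ.length ∧ x = freeTerm M n t := by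
  induction h with
  | one v => exact ⟨.one v, rfl, rfl⟩
  | act g h _ ih =>
    obtain ⟨t, ht, rfl⟩ := ih
    refine ⟨.act g h t, ?_, freeTerm_act M n g h t⟩
    rw [length_comp, length_comp, length_single_of_isIso, length_single_of_isIso]
    simpa [Term.weight] using ht
  | comp φ _ ih =>
    obtain ⟨t, ht, rfl⟩ := ih
    refine ⟨.comp t (.gen (e φ)), ?_, freeTerm_comp M n t (.gen (e φ))⟩
    exact (congrArg (· + 1) ht).trans (length_single_whiskerRight_comp φ.2 _).symm

theorem mem_freeWeight {X : FreeSym V} {v : V} {x : FreeOp M n X v}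
    {γ : d.Chain ((FreeSym.lift ι).obj X) (ι.obj v)} (h : Reads e x γ) :
    x ∈ freeWeight M n γ.length X v := by
  obtain ⟨t, ht, rfl⟩ := h.exists_term
  exact Submodule.subset_span ⟨t, ht, rfl⟩

/-- The reading of a chain without morphisms of degree `1`. -/
theorem exists_eq_act_one {X : FreeSym V} {v : V} {x : FreeOp M n X v}
    {γ : d.Chain ((FreeSym.lift ι).obj X) (ι.obj v)} (h : Reads e x γ) (hγ : γ.length = 0) :
    ∃ g : X ⟶ .of v, x = (freeOp M n).act g (𝟙 v) ((freeOp M n).one v) ∧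
      (FreeSym.lift ι).map g = γ.value := by
  induction h with
  | one v =>
    exact ⟨𝟙 _, (freeOp_act_id M n _).symm, (FreeSym.lift ι).map_id _⟩
  | @act _ _ v v' g h _ γ _ ih =>
    rw [length_comp, length_comp] at hγ
    obtain ⟨g', rfl, hg'⟩ := ih (by omega)
    refine ⟨g ≫ g' ≫ FreeSym.ofMap h, ?_, ?_⟩
    -- An isomorphism at the root of the tree without vertices is moved to its leaf by
    -- `freeOp_one_act`.
    · have e₁ : (freeOp M n).act (g ≫ g') (𝟙 v ≫ h) ((freeOp M n).one v) =
          (freeOp M n).act (g ≫ g') (𝟙 v')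
            ((freeOp M n).act (𝟙 (.of v)) h ((freeOp M n).one v)) := by
        rw [freeOp_act_act, Category.comp_id, Category.comp_id, Category.id_comp]
      rw [freeOp_act_act, e₁, ← freeOp_one_act, freeOp_act_act, Category.comp_id, Category.assoc]
    · rw [value_comp, value_comp, value_single, value_single, ← hg', Functor.map_comp,
        Functor.map_comp]
      exact (Category.assoc _ _ _).symm
  | comp φ _ ih =>
    exact absurd ((length_single_whiskerRight_comp φ.2 _).symm.trans hγ) (Nat.succ_ne_zero _)

/-- The reading of a chain with a morphism of degree `1`. -/
theorem exists_eq_comp {X : FreeSym V} {v : V} {x : FreeOp M n X v}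
    {γ : d.Chain ((FreeSym.lift ι).obj X) (ι.obj v)} (h : Reads e x γ) (hγ : γ.length ≠ 0) :
    ∃ (B C : FreeSym V) (w : V) (p : X ⟶ C ⊗ B) (φ : BasicOne d C w)
      (y : FreeOp M n (.of w ⊗ B) v)
      (δ : d.Chain ((FreeSym.lift ι).obj (.of w ⊗ B)) (ι.obj v)), Reads e y δ ∧
      x = (freeOp M n).act p (𝟙 v) ((freeOp M n).comp y (freeGen M n (e φ))) ∧
      γ = (single d ((FreeSym.lift ι).map p)).comp
        (((single d φ.1).whiskerRight ((FreeSym.lift ι).obj B)).comp δ) := by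
  induction h with
  | one v => exact (hγ rfl).elim
  | @act _ _ v v' g h _ γ _ ih =>
    rw [length_comp, length_comp, length_single_of_isIso, length_single_of_isIso] at hγ
    obtain ⟨B, C, w, p, φ, y, δ, hy, rfl, rfl⟩ := ih (by omega)
    refine ⟨B, C, w, g ≫ p, φ, _, _, hy.act_right h, ?_, ?_⟩
    · have := freeOp_comp_act_lower M n (𝟙 B) h y (freeGen M n (e φ))
      rw [MonoidalCategory.whiskerLeft_id, MonoidalCategory.whiskerLeft_id] at this
      rw [this, freeOp_act_act, freeOp_act_act]
      simp
    · have aux {X' X Y Z v v' : F} {g : X' ⟶ X} {p : X ⟶ Y} {g' : X' ⟶ Y} (hg : IsIso g)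
          (h : g' = g ≫ p) (γ : d.Chain Y Z) (δ : d.Chain Z v) (f : v ⟶ v') :
          ((single d g).comp ((single d p).comp (γ.comp δ))).comp (single d f) =
            (single d g').comp (γ.comp (δ.comp (single d f))) := by
        rw [comp_assoc, comp_assoc, comp_assoc, h, single_comp_single_comp_of_left]
      exact aux inferInstance (Functor.map_comp _ _ _) _ δ _
  | @comp B C w v x γ φ h ih =>
    exact ⟨B, C, w, 𝟙 _, φ, x, γ, h, (freeOp_act_id M n _).symm,
      (single_comp_of_eq_id ((FreeSym.lift ι).map_id (C ⊗ B))
        (((single d φ.1).whiskerRight ((FreeSym.lift ι).obj B)).comp γ)).symm⟩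

end Reads

/-- Every chain of morphisms of degree `0` and `1` can be read as a tree. -/
theorem IsFeynman.exists_reads (hF : IsFeynman ι) (M : CorModule (k := k) A) (n : ℤ)
    (e : ∀ {X v}, BasicOne d X v → A X v) {X : FreeSym V} {v : V}
    (γ : d.Chain ((FreeSym.lift ι).obj X) (ι.obj v)) (hγ : γ.IsPlus) :
    ∃ x : FreeOp M n X v, Reads e x γ := by
  obtain ⟨l, hl⟩ : ∃ l, γ.length = l := ⟨_, rfl⟩
  induction l generalizing X with
  | zero =>
    obtain ⟨h, h'⟩ := eq_single_of_length_eq_zero γ hl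
    obtain ⟨g, hg⟩ := hF.exists_map_eq' h (Y := .of v)
    refine ⟨_, ((Reads.one v).act_left g).congr ?_⟩
    rw [hg]
    exact (comp_nil _).trans h'.symm
  | succ l ih =>
    -- The first morphism is `φ ⊗ B` up to isomorphisms. The one before it acts on the leaves of the
    -- tree, and the one after it is absorbed into the rest of the chain.
    obtain ⟨Z, f, δ, hf, hδ, hδ', rfl⟩ := exists_eq_single_comp_of_isPlus γ hl hγ
    obtain ⟨C, B, w, φ, p, q, hp, hq, rfl⟩ := hF.exists_eq_of_deg_eq_one d f hf
    obtain ⟨p, rfl⟩ := hF.exists_map_eq' hp (Y := C ⊗ B)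
    obtain ⟨x, hx⟩ := ih (X := .of w ⊗ B) ((single d q).comp δ)
      ((isPlus_comp _ _).2 ⟨isPlus_single_of_isIso q, hδ'⟩)
      ((length_single_comp_of_isIso hq δ).trans hδ)
    refine ⟨_, ((hx.comp φ).act_left p).congr ?_⟩
    have aux {X Y Z W U : F} (p : X ⟶ Y) (hp : IsIso p) (f : Y ⟶ Z) (q : Z ⟶ W) (hq : IsIso q)
        (δ : d.Chain W U) : (single d p).comp ((single d f).comp ((single d q).comp δ)) =
          (single d (p ≫ f ≫ q)).comp δ := by
      rw [single_comp_single_comp_of_right f q δ, single_comp_single_comp_of_left p]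
    exact aux _ hp _ q hq δ

variable (he : ∀ {X X' : FreeSym V} {v v' : V} (g : X' ⟶ X) (h : v ⟶ v') (φ : BasicOne d X v),
  M.act g h (e φ) = e (BasicOne.act g h φ))

include he

/-- The tree which is read from a chain is unique. -/
theorem IsFeynman.reads_unique (hF : IsFeynman ι) {X : FreeSym V} {v : V} {x y : FreeOp M n X v}
    {γ : d.Chain ((FreeSym.lift ι).obj X) (ι.obj v)} (hx : Reads e x γ) (hy : Reads e y γ) :
    x = y := by
  obtain ⟨l, hl⟩ : ∃ l, γ.length = l := ⟨_, rfl⟩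
  induction l generalizing X with
  | zero =>
    obtain ⟨g, rfl, hg⟩ := hx.exists_eq_act_one hl
    obtain ⟨g', rfl, hg'⟩ := hy.exists_eq_act_one hl
    rw [hF.map_injective (hg.trans hg'.symm)]
  | succ l ih =>
    obtain ⟨B, C, w, p, φ, x, δ, hx', rfl, h₁⟩ := hx.exists_eq_comp (by omega)
    obtain ⟨B', C', w', p', φ', y, δ', hy', rfl, h₂⟩ := hy.exists_eq_comp (by omega)
    -- Both readings begin with a vertex. Uniqueness of the first morphism supplies an isomorphism
    -- `g` between what remains after executing it.
    have aux {X B C w B' C' w' : F} {p : X ⟶ C ⊗ B} {φ : C ⟶ w} {p' : X ⟶ C' ⊗ B'} {φ' : C' ⟶ w'}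
        {Y : F} {δ : d.Chain (w ⊗ B) Y} {δ' : d.Chain (w' ⊗ B') Y} {γ : d.Chain X Y}
        (hp : IsIso p) (hp' : IsIso p') (hφ : d.deg φ = 1) (hφ' : d.deg φ' = 1)
        (h₁ : γ = (single d p).comp (((single d φ).whiskerRight B).comp δ))
        (h₂ : γ = (single d p').comp (((single d φ').whiskerRight B').comp δ')) :
        δ.length + 1 = γ.length ∧ ∃ (g : w ⊗ B ⟶ w' ⊗ B'), IsIso (inv p ≫ p') ∧ IsIso g ∧
          φ ▷ B ≫ g = (inv p ≫ p') ≫ φ' ▷ B' ∧ δ = (single d g).comp δ' := by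
      refine ⟨?_, ?_⟩
      · rw [h₁, length_comp, length_comp, length_single_of_isIso, length_whiskerRight,
          length_single_of_ne _ (by rw [hφ]; decide)]
        omega
      · rw [h₁, single_whiskerRight, single_whiskerRight, single_comp_single_comp_of_left,
          single_comp_single_comp_of_left] at h₂
        obtain ⟨g, hg, h₃, h₄⟩ := single_comp_eq_single_comp
          (by rw [d.deg_comp, d.deg_whiskerRight, hφ]; omega)
          (by rw [d.deg_comp, d.deg_whiskerRight, hφ']; omega) h₂
        refine ⟨g, inferInstance, hg, ?_, h₄⟩
        rw [Category.assoc] at h₃ ⊢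
        rw [← h₃, IsIso.inv_hom_id_assoc]
    obtain ⟨hl', g, _, hg, h₃, rfl⟩ := aux (Functor.map_isIso _ p) (Functor.map_isIso _ p') φ.2 φ'.2
      h₁ h₂
    -- The comparison splits into a relabelling `r₁` of the inputs of the vertex, a relabelling `r₂`
    -- of the other inputs, and an isomorphism `f` on the colour of the edge. Equivariance of the
    -- composition in the free operad identifies such readings.
    obtain ⟨p₁, p₂, f, hp₁, hp₂, h₄, rfl, h₅⟩ := hF.exists_eq_tensorHom d
      (by rw [φ.2]; decide) _ g h₃
    obtain ⟨r₁, rfl⟩ := hF.exists_map_eq' hp₁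
    obtain ⟨r₂, rfl⟩ := hF.exists_map_eq' hp₂
    have h₆ : p' = p ≫ (r₁ ⊗ₘ r₂) := by
      apply hF.map_injective
      rw [Functor.map_comp, FreeSym.lift_map_tensorHom]
      have aux {X Y Z : F} (p : X ⟶ Y) (p' : X ⟶ Z) (hp : IsIso p) (r : Y ⟶ Z)
        (h : inv p ≫ p' = r) : p' = p ≫ r := by rw [← h, IsIso.hom_inv_id_assoc]
      exact aux _ _ _ _ h₄
    have h₇ := ih hx' ((hy'.act_left (FreeSym.ofMap f ⊗ₘ r₂)).congr (by
      rw [FreeSym.lift_map_tensorHom]; rfl)) (by exact Nat.succ.inj (hl'.trans hl))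
    have h₈ : (freeOp M n).act (𝟙 C) f (freeGen M n (e φ)) =
        (freeOp M n).act r₁ (𝟙 w') (freeGen M n (e φ')) := by
      rw [act_freeGen, act_freeGen, he, he]
      congr 2
      apply Subtype.ext
      simpa [BasicOne.act, Basic.act] using h₅
    have h₉ := freeOp_comp_act M n f r₂ (𝟙 v) (𝟙 C) y (freeGen M n (e φ))
    rw [freeOp_act_id, h₈, freeOp_comp_act_upper, freeOp_act_act] at h₉
    rw [h₇, h₉, freeOp_act_act, h₆]
    simp [MonoidalCategory.tensorHom_def']

omit he

/-- Readings are compatible with composition. -/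
theorem Reads.comp' {B C : FreeSym V} {w v : V} {x : FreeOp M n (.of w ⊗ B) v}
    {γ : d.Chain ((FreeSym.lift ι).obj (.of w ⊗ B)) (ι.obj v)} (hx : Reads e x γ)
    {y : FreeOp M n C w} {δ : d.Chain ((FreeSym.lift ι).obj C) (ι.obj w)} (hy : Reads e y δ) :
    Reads e ((freeOp M n).comp x y) ((δ.whiskerRight ((FreeSym.lift ι).obj B)).comp γ) := by
  induction hy generalizing B v with
  | one w =>
    rw [freeOp_comp_one]
    exact hx.congr (nil_comp γ).symm
  | @act X X' w w' g h y δ hy ih =>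
    rw [freeOp_act_eq, freeOp_comp_act_upper, freeOp_comp_act_edge]
    refine ((ih (hx.act_left (FreeSym.ofMap h ▷ B))).act_left (g ▷ B)).congr ?_
    rw [FreeSym.lift_map_whiskerRight, FreeSym.lift_map_whiskerRight]
    have aux {X' X w w' B v : F} (g : X' ⟶ X) (δ : d.Chain X w) (h : w ⟶ w')
        (γ : d.Chain (w' ⊗ B) v) : (single d (g ▷ B)).comp ((δ.whiskerRight B).comp
          ((single d (h ▷ B)).comp γ)) =
        ((((single d g).comp δ).comp (single d h)).whiskerRight B).comp γ := by
      rw [ProperDegree.Chain.comp_whiskerRight, ProperDegree.Chain.comp_whiskerRight,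
        comp_assoc, comp_assoc, single_whiskerRight, single_whiskerRight]
    exact aux _ δ _ γ
  | @comp C D u w y δ φ hy ih =>
    -- Reassociated, the vertex `φ` is grafted onto the composite of `x` and `y`, as the order of
    -- execution demands.
    have h := freeOp_assoc M n x y (freeGen M n (e φ))
    replace h := congrArg ((freeOp M n).act (α_ D C B).hom (𝟙 v)) h
    rw [freeOp_act_act, Iso.hom_inv_id, Category.comp_id, freeOp_act_id] at h
    rw [← h]
    refine ((((ih hx).act_left (α_ (.of u) C B).inv).comp φ).act_left (α_ D C B).hom).congr ?_
    have aux {D U C B W v : F} (φ : D ⟶ U) (δ : d.Chain (U ⊗ C) W) (γ : d.Chain (W ⊗ B) v) :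
        (single d (α_ D C B).hom).comp (((single d φ).whiskerRight (C ⊗ B)).comp
          ((single d (α_ U C B).inv).comp ((δ.whiskerRight B).comp γ))) =
        ((((single d φ).whiskerRight C).comp δ).whiskerRight B).comp γ := by
      rw [single_whiskerRight, single_whiskerRight, ProperDegree.Chain.comp_whiskerRight,
        single_whiskerRight, single_comp_single_comp_of_left, single_comp_single_comp_of_right,
        comp_assoc]
      simp
    exact aux φ.1 δ γ

/-- The tree with one vertex. -/
theorem Reads.gen {C : FreeSym V} {w : V} (φ : BasicOne d C w) :
    Reads (M := M) (n := n) e (freeGen M n (e φ)) (single d φ.1) := by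
  -- A reading grafts generators onto a smaller tree, so the tree with one vertex is obtained by
  -- grafting onto the unit.
  have h := congrArg ((freeOp M n).act (ρ_ C).inv (𝟙 w)) (freeOp_one_comp M n (freeGen M n (e φ)))
  rw [freeOp_act_act, Iso.inv_hom_id, Category.comp_id, freeOp_act_id] at h
  rw [← h]
  refine ((((Reads.one w).act_left (ρ_ (.of w)).hom).comp φ).act_left (ρ_ C).inv).congr ?_
  have aux {C w : F} (φ : C ⟶ w) : (single d (ρ_ C).inv).comp
      (((single d φ).whiskerRight (𝟙_ F)).comp ((single d (ρ_ w).hom).comp (nil d w))) =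
      single d φ := by
    rw [comp_nil, single_whiskerRight, single_comp_single_of_right, single_comp_single_of_left]
    simp
  exact aux φ.1

/-- The readings of chains span the free operad. -/
theorem Reads.span_eq_top (hspan : ∀ (X : FreeSym V) (v : V),
      Submodule.span k (Set.range (e : BasicOne d X v → A X v)) = ⊤) (X : FreeSym V) (v : V) :
    Submodule.span k {x : FreeOp M n X v | ∃ γ, Reads e x γ} = ⊤ := by
  rw [eq_top_iff]
  rintro x -
  induction x using FreeOp.induction with
  | zero => exact zero_mem _
  | add x y hx hy => exact add_mem hx hy
  | smul a x hx => exact Submodule.smul_mem _ a hx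
  | term t =>
    induction t with
    | @gen X v a =>
      have ha : a ∈ Submodule.span k (Set.range (e : BasicOne d X v → A X v)) := by
        rw [hspan]; trivial
      have := Submodule.mem_map_of_mem (f := freeGenₗ M n X v) ha
      rw [Submodule.map_span] at this
      refine Submodule.span_mono ?_ this
      rintro _ ⟨_, ⟨φ, rfl⟩, rfl⟩
      exact ⟨_, .gen φ⟩
    | one v => exact Submodule.subset_span ⟨_, .one v⟩
    | act g h t ih =>
      rw [← freeTerm_act]
      have := Submodule.mem_map_of_mem (f := (freeOp M n).act g h) ih
      rw [Submodule.map_span] at this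
      refine Submodule.span_mono ?_ this
      rintro _ ⟨x, ⟨γ, hx⟩, rfl⟩
      exact ⟨_, hx.act g h⟩
    | comp t s iht ihs =>
      rw [← freeTerm_comp]
      have := Submodule.apply_mem_map₂ (freeOp M n).comp iht ihs
      rw [Submodule.map₂_span_span] at this
      refine Submodule.span_mono ?_ this
      rintro _ ⟨x, ⟨γ, hx⟩, y, ⟨δ, hy⟩, rfl⟩
      exact ⟨_, hx.comp' hy⟩

end Readings

/-! ### Operadic ideals -/

namespace TreeOpData

variable {k : Type w'} [Field k] {V : Type u₁} [Groupoid.{v₁} V]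
  {P : FreeSym V → V → Type w} [∀ X v, AddCommGroup (P X v)] [∀ X v, Module k (P X v)]

/-- `J` is an operadic ideal. -/
structure IsIdeal (O : TreeOpData k V P) (J : ∀ X v, Submodule k (P X v)) : Prop where
  act_mem : ∀ {X X' : FreeSym V} {v v' : V} (g : X' ⟶ X) (h : v ⟶ v') {x : P X v},
    x ∈ J X v → O.act g h x ∈ J X' v'
  comp_left_mem : ∀ {B C : FreeSym V} {w v : V} {x : P (.of w ⊗ B) v} (y : P C w),
    x ∈ J _ _ → O.comp x y ∈ J _ _
  comp_right_mem : ∀ {B C : FreeSym V} {w v : V} (x : P (.of w ⊗ B) v) {y : P C w},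
    y ∈ J _ _ → O.comp x y ∈ J _ _

theorem isIdeal_ideal (O : TreeOpData k V P) (S : ∀ X v, Set (P X v)) : O.IsIdeal (O.ideal S) where
  act_mem g h _ hx := .act g h hx
  comp_left_mem y hx := .comp_left y hx
  comp_right_mem x _ hy := .comp_right x hy

theorem subset_ideal (O : TreeOpData k V P) (S : ∀ X v, Set (P X v)) (X : FreeSym V) (v : V) :
    S X v ⊆ O.ideal S X v := fun _ hx => .mem hx

theorem IsIdeal.ideal_le {O : TreeOpData k V P} {J : ∀ X v, Submodule k (P X v)} (hJ : O.IsIdeal J)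
    {S : ∀ X v, Set (P X v)} (hS : ∀ X v, S X v ⊆ J X v) (X : FreeSym V) (v : V) :
    O.ideal S X v ≤ J X v := fun _ hx =>
  InIdeal.induction J (fun X v _ hx => hS X v hx) (fun g h _ hx => hJ.act_mem g h hx)
    (fun _ y hx => hJ.comp_left_mem y hx) (fun x _ hy => hJ.comp_right_mem x hy) hx

theorem IsMorphism.isIdeal_ker {Q : FreeSym V → V → Type*} [∀ X v, AddCommGroup (Q X v)]
    [∀ X v, Module k (Q X v)] {O : TreeOpData k V P} {O' : TreeOpData k V Q}
    {φ : ∀ X v, P X v →ₗ[k] Q X v} (hφ : O.IsMorphism O' φ) :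
    O.IsIdeal (fun X v => LinearMap.ker (φ X v)) where
  act_mem g h x hx := by
    rw [LinearMap.mem_ker] at hx ⊢
    rw [hφ.map_act, hx, map_zero]
  comp_left_mem y hx := by
    rw [LinearMap.mem_ker] at hx ⊢
    rw [hφ.map_comp, hx, map_zero, LinearMap.zero_apply]
  comp_right_mem x y hy := by
    rw [LinearMap.mem_ker] at hy ⊢
    rw [hφ.map_comp, hy, map_zero]

end TreeOpData

/-! ### Readings of chains which differ by a permutation -/

section Transpositions

variable {V : Type u₁} [Groupoid.{v₁} V] {F : Type u₂} [Category.{v₂} F]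
  [MonoidalCategory F] [SymmetricCategory F] {ι : V ⥤ F} {c : CubicalStructure ι}

open ProperDegree ProperDegree.Chain

/-- In S₂ the sign determines the permutation. This identifies `κ'` below from the sign relation
alone. -/
theorem CubicalStructure.SignRel.eq_swap {X Y : F} {β : c.ChainN 2 X Y} {δ : c.Chain X Y}
    (h : c.SignRel (-1) β.1 δ) : δ = (c.swap β).1 := by
  obtain ⟨m, γ, σ, hσ, hγ, rfl⟩ := h
  obtain rfl : m = 2 := by rw [← γ.2, hγ, β.2]
  obtain rfl : γ = β := Subtype.ext hγ
  rcases perm_fin_two σ with rfl | rfl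
  · rw [Equiv.Perm.sign_one] at hσ
    exact absurd hσ (by decide)
  · rfl

variable {k : Type w'} [Field k]
  {A : FreeSym V → V → Type w} [∀ X v, AddCommGroup (A X v)] [∀ X v, Module k (A X v)]
  {M : CorModule (k := k) A} {n : ℤ} {e : ∀ {X v}, BasicOne c.toProperDegree X v → A X v}
  {J : ∀ X v, Submodule k (FreeOp M n X v)}

theorem koszulSign_mul_self (p : ℤ) : koszulSign p p * koszulSign p p = 1 := by
  unfold koszulSign
  rw [← Units.val_mul, Int.units_mul_self, Units.val_one]

/-- Compatibility of transpositions with the associativity of composition for two vertices on top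
of each other. -/
theorem IsFeynman.reads_sub_mem_of_stacked (hF : IsFeynman ι) (hJ : (freeOp M n).IsIdeal J)
    (he : ∀ {X X' : FreeSym V} {v v' : V} (g : X' ⟶ X) (h : v ⟶ v')
      (φ : BasicOne c.toProperDegree X v), M.act g h (e φ) = e (BasicOne.act g h φ))
    (hbase : ∀ {X : FreeSym V} {v : V} (β : c.ChainN 2 ((FreeSym.lift ι).obj X) (ι.obj v))
      (x y : FreeOp M n X v), Reads e x β.1 → Reads e y (c.swap β).1 →
        y - koszulSign n n • x ∈ J X v)
    {X B C D B' : FreeSym V} {v w u : V} (p : X ⟶ C ⊗ B) (φ : BasicOne c.toProperDegree C w)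
    (q : .of w ⊗ B ⟶ D ⊗ B') (ψ : BasicOne c.toProperDegree D u)
    (X' : FreeSym V) (h : B ⟶ X' ⊗ B') (g : .of w ⊗ X' ⟶ D)
    (hq : q = .of w ◁ h ≫ (α_ _ _ _).inv ≫ g ▷ B')
    {η : c.Chain ((FreeSym.lift ι).obj (.of u ⊗ B')) (ι.obj v)} (hη : η.IsPlus)
    {κ κ' : c.Chain ((FreeSym.lift ι).obj X) ((FreeSym.lift ι).obj (.of u ⊗ B'))}
    (hκ : κ = (single _ ((FreeSym.lift ι).map p)).comp
      ((single _ (φ.1 ▷ (FreeSym.lift ι).obj B)).comp ((single _ ((FreeSym.lift ι).map q)).comp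
        (single _ (ψ.1 ▷ (FreeSym.lift ι).obj B')))))
    (hκ' : c.SignRel (-1) κ κ') {x y : FreeOp M n X v} (hx : Reads e x (κ.comp η))
    (hy : Reads e y (κ'.comp η)) : y - koszulSign n n • x ∈ J X v := by
  have aux₁ {C X' w D u : F} {φ : C ⟶ w} {g : w ⊗ X' ⟶ D} {ψ : D ⟶ u} (hφ : c.deg φ = 1)
      (hψ : c.deg ψ = 1) (_ : IsIso g) : ((single c.toProperDegree (φ ▷ X')).comp
        (single c.toProperDegree (g ≫ ψ))).length = 2 ∧ ((single c.toProperDegree (φ ▷ X')).comp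
        (single c.toProperDegree (g ≫ ψ))).IsPlus := by
    constructor
    · rw [length_comp, length_single_of_ne _ (by rw [c.deg_whiskerRight, hφ]; decide),
        length_single_of_ne _ (by rw [c.deg_comp, hψ]; omega)]
    · rw [isPlus_comp, isPlus_single, isPlus_single, c.deg_whiskerRight, c.deg_comp, hφ, hψ,
        ProperDegree.deg_of_isIso]
      decide
  obtain ⟨hl, hp⟩ := aux₁ (X' := (FreeSym.lift ι).obj X') (g := (FreeSym.lift ι).map g) φ.2 ψ.2
    (Functor.map_isIso _ _)
  -- The letters `B'` are used by neither vertex; `X'` holds the inputs of `ψ` other than the output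
  -- of `φ`. Hence `κ` is `β ⊗ B'` up to the isomorphism `r`.
  let β : c.ChainN 2 ((FreeSym.lift ι).obj (C ⊗ X')) (ι.obj u) := ⟨_, hl⟩
  obtain ⟨x₀, hx₀⟩ := hF.exists_reads M n e β.1 hp
  obtain ⟨y₀, hy₀⟩ := hF.exists_reads M n e (c.swap β).1 (c.isPlus_permute _ _ hp)
  obtain ⟨z, hz⟩ := hF.exists_reads M n e η hη
  have aux₂ {X B C B' X' w u D : F} {p : X ⟶ C ⊗ B} {φ : C ⟶ w} {q : w ⊗ B ⟶ D ⊗ B'} {ψ : D ⟶ u}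
      {h : B ⟶ X' ⊗ B'} {g : w ⊗ X' ⟶ D} (hq : q = w ◁ h ≫ (α_ _ _ _).inv ≫ g ▷ B') (_ : IsIso q)
      (_ : IsIso p) (_ : IsIso h) (_ : IsIso g) :
      (single c.toProperDegree p).comp ((single _ (φ ▷ B)).comp ((single _ q).comp
        (single _ (ψ ▷ B')))) = (single _ (p ≫ C ◁ h ≫ (α_ _ _ _).inv)).comp
        (((single _ (φ ▷ X')).comp (single _ (g ≫ ψ))).whiskerRight B') := by
    rw [ProperDegree.Chain.comp_whiskerRight, single_whiskerRight, single_whiskerRight,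
      single_comp_single_comp_of_right (φ ▷ B) q, single_comp_single_comp_of_left p,
      MonoidalCategory.comp_whiskerRight, ← single_comp_single_of_left (g ▷ B'),
      single_comp_single_comp_of_right _ (g ▷ B'), single_comp_single_comp_of_left _, hq]
    congr 2
    simp only [Category.assoc]
    rw [← whisker_exchange_assoc, associator_inv_naturality_left_assoc]
  let r : X ⟶ (C ⊗ X') ⊗ B' := p ≫ C ◁ h ≫ (α_ _ _ _).inv
  have hr : (FreeSym.lift ι).map r = (FreeSym.lift ι).map p ≫
      (FreeSym.lift ι).obj C ◁ (FreeSym.lift ι).map h ≫ (α_ _ _ _).inv := by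
    rw [Functor.map_comp, Functor.map_comp, FreeSym.lift_map_whiskerLeft]
    rfl
  have hκr : κ = (single _ ((FreeSym.lift ι).map r)).comp
      (β.1.whiskerRight ((FreeSym.lift ι).obj B')) := by
    rw [hκ, hr]
    refine aux₂ ?_ (Functor.map_isIso _ _) (Functor.map_isIso _ _) (Functor.map_isIso _ _)
      (Functor.map_isIso _ _)
    rw [hq, Functor.map_comp, Functor.map_comp, FreeSym.lift_map_whiskerLeft,
      FreeSym.lift_map_whiskerRight]
    rfl
  -- Both chains arise from `κ` by an odd permutation, and for length two there is only one.
  have hκr' : κ' = (single _ ((FreeSym.lift ι).map r)).comp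
      ((c.swap β).1.whiskerRight ((FreeSym.lift ι).obj B')) := by
    have h₁ : c.SignRel (-1) κ ((single _ ((FreeSym.lift ι).map r)).comp
        ((c.swap β).1.whiskerRight ((FreeSym.lift ι).obj B'))) := by
      rw [hκr]
      exact .comp_left _ ((CubicalStructure.signRel_swap β).whiskerRight hF hp _)
    have hl₂ : κ.length = 2 := by
      rw [hκr]
      exact (length_single_comp_of_isIso inferInstance _).trans
        ((length_whiskerRight _ _).trans hl)
    exact (CubicalStructure.SignRel.eq_swap (β := ⟨κ, hl₂⟩) hκ').trans
      (CubicalStructure.SignRel.eq_swap (β := ⟨κ, hl₂⟩) h₁).symm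
  have hx' := hF.reads_unique he hx (((hz.comp' hx₀).act_left r).congr
    ((comp_assoc _ _ η).symm.trans (congrArg (fun t => Chain.comp t η) hκr.symm)))
  have hy' := hF.reads_unique he hy (((hz.comp' hy₀).act_left r).congr
    ((comp_assoc _ _ η).symm.trans (congrArg (fun t => Chain.comp t η) hκr'.symm)))
  -- Both readings graft a reading of a chain of length two onto the same tree `z`, so the
  -- difference is the image of the relation for `β`.
  rw [hx', hy', ← map_zsmul, ← map_zsmul, ← map_sub, ← map_sub]
  exact hJ.act_mem _ _ (hJ.comp_right_mem _ (hbase β x₀ y₀ hx₀ hy₀))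

/-- Compatibility of transpositions with the associativity of composition for two vertices next to
each other. -/
theorem IsFeynman.reads_sub_mem_of_parallel (hF : IsFeynman ι)
    (he : ∀ {X X' : FreeSym V} {v v' : V} (g : X' ⟶ X) (h : v ⟶ v')
      (φ : BasicOne c.toProperDegree X v), M.act g h (e φ) = e (BasicOne.act g h φ))
    {X B C D B' : FreeSym V} {v w u : V} (p : X ⟶ C ⊗ B) (φ : BasicOne c.toProperDegree C w)
    (q : .of w ⊗ B ⟶ D ⊗ B') (ψ : BasicOne c.toProperDegree D u)
    (Y' : FreeSym V) (h : B ⟶ D ⊗ Y') (g : .of w ⊗ Y' ⟶ B')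
    (hq : q = .of w ◁ h ≫ leftComm _ _ _ ≫ D ◁ g)
    {η : c.Chain ((FreeSym.lift ι).obj (.of u ⊗ B')) (ι.obj v)} (hη : η.IsPlus)
    {κ κ' : c.Chain ((FreeSym.lift ι).obj X) ((FreeSym.lift ι).obj (.of u ⊗ B'))}
    (hκ : κ = (single _ ((FreeSym.lift ι).map p)).comp
      ((single _ (φ.1 ▷ (FreeSym.lift ι).obj B)).comp ((single _ ((FreeSym.lift ι).map q)).comp
        (single _ (ψ.1 ▷ (FreeSym.lift ι).obj B')))))
    (hκ' : c.SignRel (-1) κ κ') {x y : FreeOp M n X v} (hx : Reads e x (κ.comp η))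
    (hy : Reads e y (κ'.comp η)) : y = koszulSign n n • x := by
  obtain ⟨z, hz⟩ := hF.exists_reads M n e η hη
  have aux {X C B w D B' u Y' T : F} {p : X ⟶ C ⊗ B} {φ : C ⟶ w} {q : w ⊗ B ⟶ D ⊗ B'} {ψ : D ⟶ u}
      {h : B ⟶ D ⊗ Y'} {g : w ⊗ Y' ⟶ B'} (hq : q = w ◁ h ≫ leftComm _ _ _ ≫ D ◁ g)
      (hφ : c.deg φ = 1) (hψ : c.deg ψ = 1) (_ : IsIso p) (_ : IsIso q) (_ : IsIso h) (_ : IsIso g)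
      {r : X ⟶ C ⊗ (D ⊗ Y')} (hr : r = p ≫ C ◁ h) {κ κ' : c.Chain X (u ⊗ B')}
      (hκ : κ = (single _ p).comp ((single _ (φ ▷ B)).comp ((single _ q).comp
        (single _ (ψ ▷ B'))))) (hκ' : c.SignRel (-1) κ κ') (η : c.Chain (u ⊗ B') T) :
      κ.comp η = (single _ r).comp (((single _ φ).whiskerRight (D ⊗ Y')).comp
          ((single _ (leftComm w D Y')).comp (((single _ ψ).whiskerRight (w ⊗ Y')).comp
            ((single _ (u ◁ g)).comp η)))) ∧
        κ'.comp η = (single _ r).comp ((single _ (leftComm C D Y')).comp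
          (((single _ ψ).whiskerRight (C ⊗ Y')).comp ((single _ (leftComm u C Y')).comp
            (((single _ φ).whiskerRight (u ⊗ Y')).comp ((single _ (leftComm w u Y')).comp
              ((single _ (u ◁ g)).comp η)))))) := by
    have hr' : IsIso r := by rw [hr]; infer_instance
    have h₁ : κ = (single _ r).comp ((single _ (φ ▷ (D ⊗ Y'))).comp
        ((single _ (leftComm w D Y')).comp ((single _ (ψ ▷ (w ⊗ Y'))).comp
          (single _ (u ◁ g))))) := by
      rw [hκ, single_comp_single_comp_of_right (φ ▷ B) q, single_comp_single_comp_of_left p,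
        single_comp_single_of_right (ψ ▷ (w ⊗ Y')), ← whisker_exchange,
        ← single_comp_single_of_left (D ◁ g), single_comp_single_comp_of_right _ (D ◁ g),
        single_comp_single_comp_of_right (φ ▷ _) (leftComm w D Y' ≫ D ◁ g),
        single_comp_single_comp_of_left r, hq, hr]
      simp only [Category.assoc]
      rw [← whisker_exchange_assoc]
    -- A reading attaches vertices at the first tensor factor, so executing `ψ` before `φ` requires
    -- bringing `D` to the front and moving the result back.
    have hβ : (C ◁ (ψ ▷ Y')) = leftComm C D Y' ≫ ψ ▷ (C ⊗ Y') ≫ leftComm u C Y' := by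
      rw [← reassoc_of% (leftComm_naturality_middle C ψ Y'), leftComm_leftComm, Category.comp_id]
    have hψ' : c.deg (ψ ▷ Y') = 1 := (c.deg_whiskerRight ψ Y').trans hψ
    have hl : ((single c.toProperDegree (φ ▷ (D ⊗ Y'))).comp
        (single c.toProperDegree (w ◁ (ψ ▷ Y')))).length = 2 := by
      rw [length_comp, length_single_of_ne _ (by rw [c.deg_whiskerRight, hφ]; decide),
        length_single_of_ne _ (by rw [ProperDegree.deg_whiskerLeft, hψ']; decide)]
    -- The transposition of two independent vertices is the exchange of their order, which describes
    -- `κ'` explicitly.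
    have h₂ := CubicalStructure.signRel_swap (c := c) ⟨_, hl⟩
    rw [CubicalStructure.swap_single_exchange hF φ (ψ ▷ Y') hφ hψ' ⟨_, hl⟩ rfl] at h₂
    have h₃ : c.SignRel (-1) κ ((single _ r).comp (((single _ (C ◁ (ψ ▷ Y'))).comp
        (single _ (φ ▷ (u ⊗ Y')))).comp (single _ (leftComm w u Y' ≫ u ◁ g)))) := by
      have h₄ := CubicalStructure.SignRel.comp_left (single _ r) (h₂.comp_right
        (single _ (leftComm w u Y' ≫ u ◁ g)))
      convert h₄ using 1
      rw [h₁, comp_assoc, single_comp_single_of_right (w ◁ _),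
        reassoc_of% (leftComm_naturality_middle w ψ Y'), single_comp_single_of_right (ψ ▷ _),
        single_comp_single_of_left (leftComm w D Y')]
    have hl₂ : κ.length = 2 := by
      rw [hκ, length_single_comp_of_isIso inferInstance, length_comp,
        length_single_comp_of_isIso inferInstance,
        length_single_of_ne _ (by rw [c.deg_whiskerRight, hφ]; decide),
        length_single_of_ne _ (by rw [c.deg_whiskerRight, hψ]; decide)]
    have h₅ := (CubicalStructure.SignRel.eq_swap (β := ⟨κ, hl₂⟩) hκ').trans
      (CubicalStructure.SignRel.eq_swap (β := ⟨κ, hl₂⟩) h₃).symm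
    constructor
    · rw [h₁]
      simp only [comp_assoc, single_whiskerRight]
    · rw [h₅, hβ, ← single_comp_single_of_left (leftComm C D Y'),
        ← single_comp_single_of_right (ψ ▷ _), ← single_comp_single_of_left (leftComm w u Y')]
      simp only [comp_assoc, single_whiskerRight]
  let r : X ⟶ C ⊗ (D ⊗ Y') := p ≫ C ◁ h
  obtain ⟨h₁, h₂⟩ := aux (q := (FreeSym.lift ι).map q) (h := (FreeSym.lift ι).map h)
    (g := (FreeSym.lift ι).map g) (p := (FreeSym.lift ι).map p) (r := (FreeSym.lift ι).map r)
    (by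
      rw [hq, Functor.map_comp, Functor.map_comp, FreeSym.lift_map_whiskerLeft,
        FreeSym.lift_map_whiskerLeft]
      rfl) φ.2 ψ.2 (Functor.map_isIso _ _) (Functor.map_isIso _ _) (Functor.map_isIso _ _)
    (Functor.map_isIso _ _) (by
      rw [Functor.map_comp, FreeSym.lift_map_whiskerLeft]; rfl) hκ hκ' η
  have hz' : Reads e ((freeOp M n).act (.of u ◁ g) (𝟙 v) z)
      ((single _ (ι.obj u ◁ (FreeSym.lift ι).map g)).comp η) :=
    (hz.act_left (.of u ◁ g)).congr (by rw [FreeSym.lift_map_whiskerLeft]; rfl)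
  have hx' := hF.reads_unique he hx (((((hz'.comp ψ).act_left
    (leftComm (.of w) D Y')).comp φ).act_left r).congr h₁.symm)
  have hy' := hF.reads_unique he hy (((((((hz'.act_left (leftComm (.of w) (.of u) Y')).comp φ).act_left
    (leftComm (.of u) C Y')).comp ψ).act_left (leftComm C D Y')).act_left r).congr h₂.symm)
  -- The two readings are the two sides of the parallel axiom. The sign may be moved across because
  -- its square is 1.
  rw [hx', hy', freeOp_parallel M n ((freeOp M n).act (.of u ◁ g) (𝟙 v) z) (e ψ) (e φ), map_zsmul, smul_smul, koszulSign_mul_self, one_smul]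

/-- If transpositions act by a sign on the readings of chains of length two, then they do so on
the readings of all chains. -/
theorem IsFeynman.reads_sub_mem_of_adj (hF : IsFeynman ι) (hJ : (freeOp M n).IsIdeal J)
    (he : ∀ {X X' : FreeSym V} {v v' : V} (g : X' ⟶ X) (h : v ⟶ v')
      (φ : BasicOne c.toProperDegree X v), M.act g h (e φ) = e (BasicOne.act g h φ))
    (hbase : ∀ {X : FreeSym V} {v : V} (β : c.ChainN 2 ((FreeSym.lift ι).obj X) (ι.obj v))
      (x y : FreeOp M n X v), Reads e x β.1 → Reads e y (c.swap β).1 →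
        y - koszulSign n n • x ∈ J X v)
    {X : FreeSym V} {v : V} {γ δ : c.Chain ((FreeSym.lift ι).obj X) (ι.obj v)} (h : c.Adj γ δ)
    {x y : FreeOp M n X v} (hx : Reads e x γ) (hy : Reads e y δ) :
    y - koszulSign n n • x ∈ J X v := by
  obtain ⟨Y, Y', α, β, η, rfl, rfl⟩ := h
  obtain ⟨l, hl⟩ : ∃ l, α.length = l := ⟨_, rfl⟩
  induction l generalizing X with
  | zero =>
    -- Here `α` is an isomorphism. It is absorbed into the first of the two morphisms of `β`, both
    -- of which are written with basic morphisms `φ` and `ψ`; the isomorphism `r` left at the end is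
    -- moved into `η`.
    obtain ⟨ha, hα⟩ := eq_single_of_length_eq_zero α hl
    have hp := hx.isPlus
    rw [isPlus_comp, isPlus_comp] at hp
    obtain ⟨Z, f, δ, hf, hδ, hδ', hβ⟩ := exists_eq_single_comp_of_isPlus β.1 β.2 hp.2.1
    obtain ⟨f', hf', rfl⟩ := eq_single_of_length_eq_one δ hδ hδ'
    obtain ⟨C, B, w, φ, p, q, hp', hq', hpq⟩ := hF.exists_eq_of_deg_eq_one c.toProperDegree
      (α.value ≫ f) (by rw [c.deg_comp, hf, ProperDegree.deg_of_isIso])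
    obtain ⟨D, B', u, ψ, q₂, r, hq₂, hr, hqr⟩ := hF.exists_eq_of_deg_eq_one c.toProperDegree
      (q ≫ f') (by rw [c.deg_comp, hf', ProperDegree.deg_of_isIso])
    obtain ⟨p, rfl⟩ := hF.exists_map_eq' hp' (Y := C ⊗ B)
    obtain ⟨q₂, rfl⟩ := hF.exists_map_eq' hq₂ (X := .of w ⊗ B) (Y := D ⊗ B')
    have aux {X Y Z Y' M₁ M₂ M₃ M₄ T : F} {α : c.Chain X Y} {a : X ⟶ Y} (ha : IsIso a)
        (hα : α = single _ a) {β : c.ChainN 2 Y Y'} {f : Y ⟶ Z} {f' : Z ⟶ Y'}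
        (hβ : β.1 = (single _ f).comp (single _ f')) {p : X ⟶ M₁} {φ : M₁ ⟶ M₂} {q : M₂ ⟶ Z}
        (_ : IsIso p) (_ : IsIso q) (h : a ≫ f = p ≫ φ ≫ q) {q₂ : M₂ ⟶ M₃} {ψ : M₃ ⟶ M₄}
        {r : M₄ ⟶ Y'} (_ : IsIso q₂) (_ : IsIso r) (h' : q ≫ f' = q₂ ≫ ψ ≫ r)
        (η : c.Chain Y' T) :
        ∃ κ κ' : c.Chain X M₄, κ = (single _ p).comp ((single _ φ).comp ((single _ q₂).comp
          (single _ ψ))) ∧ c.SignRel (-1) κ κ' ∧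
          α.comp (β.1.comp η) = κ.comp ((single _ r).comp η) ∧
          α.comp ((c.swap β).1.comp η) = κ'.comp ((single _ r).comp η) := by
      have h₁ : (single c.toProperDegree a).comp (β.1.comp (single _ (inv r))) =
          (single _ p).comp ((single _ φ).comp ((single _ q₂).comp (single _ ψ))) := by
        rw [hβ, comp_assoc, single_comp_single_comp_of_left, h, single_comp_single_of_right f',
          ← Category.assoc, ← single_comp_single_of_right (p ≫ φ) q, comp_assoc,
          single_comp_single_of_left, reassoc_of% h', IsIso.hom_inv_id, Category.comp_id,
          ← single_comp_single_of_left p, comp_assoc, single_comp_single_of_left q₂]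
      refine ⟨_, (single _ a).comp ((c.swap β).1.comp (single _ (inv r))), rfl, ?_, ?_, ?_⟩
      · rw [← h₁]
        exact .comp_left _ (.comp_right (CubicalStructure.signRel_swap β) _)
      · rw [← h₁, hα, comp_assoc, comp_assoc, single_comp_single_comp_of_left, IsIso.inv_hom_id,
          single_id, nil_comp]
      · rw [hα, comp_assoc, comp_assoc, single_comp_single_comp_of_left, IsIso.inv_hom_id,
          single_id, nil_comp]
    obtain ⟨κ, κ', hκ, hκ', h₁, h₂⟩ := aux ha hα hβ hp' hq' hpq hq₂ hr hqr η
    rw [h₁] at hx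
    rw [h₂] at hy
    have hη : ((single c.toProperDegree r).comp η).IsPlus :=
      (isPlus_comp _ _).2 ⟨isPlus_single_of_isIso r, hp.2.2⟩
    -- The output `w` of `φ` is either an input of `ψ`, with the vertices stacked, or a spectator of
    -- `ψ`, with the vertices parallel.
    rcases FreeSym.first_letter_cases q₂ with ⟨X', g, h, hq⟩ | ⟨Y', g, h, hq⟩
    · exact hF.reads_sub_mem_of_stacked hJ he hbase p φ q₂ ψ X' h g hq hη hκ hκ' hx hy
    · rw [hF.reads_sub_mem_of_parallel he p φ q₂ ψ Y' h g hq hη hκ hκ' hx hy, sub_self]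
      exact zero_mem _
  | succ l ih =>
    have hp := hx.isPlus
    rw [isPlus_comp, isPlus_comp] at hp
    -- The first vertex of `α` is grafted onto both trees alike. It is stripped off, and the ideal
    -- is stable under grafting it back.
    obtain ⟨Z, f, α, hf, hα, hα', rfl⟩ := exists_eq_single_comp_of_isPlus α hl hp.1
    obtain ⟨C, B, w, φ, p, q, hp', hq', rfl⟩ := hF.exists_eq_of_deg_eq_one c.toProperDegree f hf
    obtain ⟨p, rfl⟩ := hF.exists_map_eq' hp' (Y := C ⊗ B)
    have hβ := c.isPlus_permute (Equiv.swap 0 1) β hp.2.1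
    have hα₁ : ((single c.toProperDegree q).comp α).IsPlus :=
      (isPlus_comp _ _).2 ⟨isPlus_single_of_isIso q, hα'⟩
    obtain ⟨x₁, hx₁⟩ := hF.exists_reads M n e (X := .of w ⊗ B)
      (((single c.toProperDegree q).comp α).comp (β.1.comp η))
      (.comp hα₁ (.comp hp.2.1 hp.2.2))
    obtain ⟨y₁, hy₁⟩ := hF.exists_reads M n e (X := .of w ⊗ B)
      (((single c.toProperDegree q).comp α).comp ((c.swap β).1.comp η))
      (.comp hα₁ (.comp hβ hp.2.2))
    have aux {X M₁ M₂ Z Y T : F} {p : X ⟶ M₁} {φ : M₁ ⟶ M₂} {q : M₂ ⟶ Z} (_ : IsIso p)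
        (_ : IsIso q) {α : c.Chain Z Y} {δ : c.Chain Y T} :
        ((single _ (p ≫ φ ≫ q)).comp α).comp δ = (single _ p).comp ((single _ φ).comp
          (((single _ q).comp α).comp δ)) := by
      rw [← single_comp_single_of_left p, ← single_comp_single_of_right φ]
      simp only [comp_assoc]
    have hx' := hF.reads_unique he hx (((hx₁.comp φ).act_left p).congr (aux hp' hq').symm)
    have hy' := hF.reads_unique he hy (((hy₁.comp φ).act_left p).congr (aux hp' hq').symm)
    rw [hx', hy', ← map_zsmul, ← map_sub]
    have h₁ := ih (X := .of w ⊗ B) ((single c.toProperDegree q).comp α) hx₁ hy₁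
      ((length_single_comp_of_isIso hq' α).trans hα)
    have h₂ := hJ.act_mem p (𝟙 v) (hJ.comp_left_mem (freeGen M n (e φ)) h₁)
    rwa [map_sub, LinearMap.sub_apply, map_zsmul, LinearMap.smul_apply] at h₂

/-- If transpositions act by a sign on the readings of chains of length two, then all permutations
act by the corresponding character on the readings of all chains. -/
theorem IsFeynman.reads_sub_mem_of_signRel (hF : IsFeynman ι) (hJ : (freeOp M n).IsIdeal J)
    (he : ∀ {X X' : FreeSym V} {v v' : V} (g : X' ⟶ X) (h : v ⟶ v')
      (φ : BasicOne c.toProperDegree X v), M.act g h (e φ) = e (BasicOne.act g h φ))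
    (hbase : ∀ {X : FreeSym V} {v : V} (β : c.ChainN 2 ((FreeSym.lift ι).obj X) (ι.obj v))
      (x y : FreeOp M n X v), Reads e x β.1 → Reads e y (c.swap β).1 →
        y - koszulSign n n • x ∈ J X v)
    (χ : ℤˣ →* ℤˣ) (hχ : (χ (-1) : ℤ) = koszulSign n n)
    {X : FreeSym V} {v : V} {γ δ : c.Chain ((FreeSym.lift ι).obj X) (ι.obj v)} {ε : ℤˣ}
    (h : c.SignRel ε γ δ) {x y : FreeOp M n X v} (hx : Reads e x γ) (hy : Reads e y δ) :
    y - (χ ε : ℤ) • x ∈ J X v := by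
  -- Multiplicativity of `χ` reduces the claim to adjacent transpositions, whose sign is -1.
  refine CubicalStructure.SignRel.induction (fun γ δ ε => ∀ x y : FreeOp M n X v, Reads e x γ →
    Reads e y δ → y - (χ ε : ℤ) • x ∈ J X v) ?_ ?_ ?_ hx.isPlus h x y hx hy
  · intro γ _ x y hx hy
    rw [hF.reads_unique he hx hy, map_one, Units.val_one, one_smul, sub_self]
    exact zero_mem _
  · intro γ δ η ε ε' _ hδ _ h₁ h₂ x y hx hy
    obtain ⟨z, hz⟩ := hF.exists_reads M n e δ hδ
    have := add_mem (h₂ z y hz hy) (Submodule.smul_of_tower_mem _ (χ ε' : ℤ) (h₁ x z hx hz))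
    rwa [smul_sub, sub_add_sub_cancel, smul_smul, ← Units.val_mul, ← map_mul, mul_comm ε'] at this
  · intro γ δ _ _ h x y hx hy
    rw [hχ]
    exact hF.reads_sub_mem_of_adj hJ he hbase h hx hy

end Transpositions

/-! ### Morphisms out of the free operad -/

section FreeLift

variable {k : Type w'} [Field k] {V : Type u₁} [Groupoid.{v₁} V]
  {A : FreeSym V → V → Type w} [∀ X v, AddCommGroup (A X v)] [∀ X v, Module k (A X v)]
  (M : CorModule (k := k) A) (d : ℤ) {P : FreeSym V → V → Type*} [∀ X v, AddCommGroup (P X v)]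
  [∀ X v, Module k (P X v)] {O : TreeOpData k V P} (hO : O.IsTreeOp)
  (f : ∀ X v, A X v →ₗ[k] P X v)
  (hf : ∀ {X X' v v'} (g : X' ⟶ X) (h : v ⟶ v') (a : A X v),
    f X' v' (M.act g h a) = O.act g h (f X v a))
  (hd : ∀ X v a, f X v a ∈ O.homog X v d)

theorem freeLift_freeTerm {X : FreeSym V} {v : V} (t : Term A X v) :
    freeLift M d hO f hf hd X v (freeTerm M d t) = t.eval O f :=
  evalLin_mono O f t

theorem freeLift_freeGen {X : FreeSym V} {v : V} (a : A X v) :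
    freeLift M d hO f hf hd X v (freeGen M d a) = f X v a :=
  freeLift_freeTerm M d hO f hf hd (.gen a)

theorem isMorphism_freeLift : (freeOp M d).IsMorphism O (freeLift M d hO f hf hd) where
  map_homog := by
    rintro X v n _ ⟨x, hx, rfl⟩
    change evalLin O f X v x ∈ _
    refine Submodule.sum_mem _ fun t ht => Submodule.smul_mem _ _ ?_
    have := hx ht
    rw [← show d * t.weight = n from this]
    exact Term.eval_mem d hO hd t
  map_act g h x := by
    induction x using FreeOp.induction with
    | term t => rw [freeTerm_act, freeLift_freeTerm, freeLift_freeTerm]; rfl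
    | zero => simp only [map_zero]
    | add x y hx hy => simp only [map_add, hx, hy]
    | smul a x hx => simp only [map_smul, hx]
  map_one v := freeLift_freeTerm M d hO f hf hd (.one v)
  map_comp x y := by
    induction x using FreeOp.induction with
    | zero => simp only [map_zero, LinearMap.zero_apply]
    | add x y hx hy => simp only [map_add, LinearMap.add_apply, hx, hy]
    | smul a x hx => simp only [map_smul, LinearMap.smul_apply, hx]
    | term t =>
      induction y using FreeOp.induction with
      | zero => simp only [map_zero]
      | add x y hx hy => simp only [map_add, hx, hy]
      | smul a x hx => simp only [map_smul, hx]
      | term s =>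
        rw [freeTerm_comp, freeLift_freeTerm, freeLift_freeTerm, freeLift_freeTerm]
        rfl

end FreeLift

/-! ### The quadratic presentation of the linearization -/

section Presentation

variable {k : Type w'} [Field k] {V : Type u₁} [Groupoid.{v₁} V] {F : Type u₂} [Category.{v₂} F]
  [MonoidalCategory F] [SymmetricCategory F] {ι : V ⥤ F}

open ProperDegree ProperDegree.Chain

theorem degreeOneInclusion_act (d : ProperDegree ι) {X X' : FreeSym V} {v v' : V} (g : X' ⟶ X)
    (h : v ⟶ v') (a : BasicOne d X v →₀ k) :
    degreeOneInclusion k d X' v' ((degreeOne k d).act g h a) =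
      (linearization k ι).act g h (degreeOneInclusion k d X v a) := by
  induction a using Finsupp.induction_linear with
  | zero => simp
  | add a b ha hb => simp only [map_add, ha, hb]
  | single φ c => simp [degreeOne, degreeOneInclusion, linearization_act_single, BasicOne.act]

theorem degreeOneInclusion_mem (d : ProperDegree ι) (X : FreeSym V) (v : V)
    (a : BasicOne d X v →₀ k) : degreeOneInclusion k d X v a ∈ (linearization k ι).homog X v 0 := by
  simp [linearization]

theorem isMorphism_presentation (d : ProperDegree ι) :
    (freeOp (degreeOne k d) 0).IsMorphism (linearization k ι) (presentation k d) :=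
  isMorphism_freeLift _ 0 (linearization_isTreeOp k ι) (degreeOneInclusion k d)
    (degreeOneInclusion_act d) (degreeOneInclusion_mem d)

theorem basisGen_act (d : ProperDegree ι) {X X' : FreeSym V} {v v' : V} (g : X' ⟶ X) (h : v ⟶ v')
    (φ : BasicOne d X v) :
    (degreeOne k d).act g h (basisGen k d φ) = basisGen k d (BasicOne.act g h φ) :=
  Finsupp.mapDomain_single

theorem span_basisGen (d : ProperDegree ι) (X : FreeSym V) (v : V) :
    Submodule.span k (Set.range (basisGen k d : BasicOne d X v → _)) = ⊤ := by
  rw [eq_top_iff]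
  rintro x -
  rw [← Finsupp.sum_single x]
  refine Submodule.sum_mem _ fun φ _ => ?_
  rw [← mul_one (x φ), ← smul_eq_mul, ← Finsupp.smul_single]
  exact Submodule.smul_mem _ _ (Submodule.subset_span ⟨φ, rfl⟩)

/-- The presentation sends the reading of a chain to the composition of the chain. -/
theorem presentation_reads {d : ProperDegree ι} {X : FreeSym V} {v : V}
    {x : FreeOp (degreeOne k d) 0 X v} {γ : d.Chain ((FreeSym.lift ι).obj X) (ι.obj v)}
    (h : Reads (basisGen k d) x γ) : presentation k d X v x = Finsupp.single γ.value 1 := by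
  induction h with
  | one v => exact (isMorphism_presentation d).map_one v
  | act g h _ ih =>
    rw [(isMorphism_presentation d).map_act, ih, linearization_act_single, value_comp, value_comp,
      value_single, value_single, Category.assoc]
    rfl
  | @comp B C w v x γ φ _ ih =>
    have h₁ : presentation k d C w (freeGen _ 0 (basisGen k d φ)) = Finsupp.single φ.1 1 :=
      (freeLift_freeGen _ 0 (linearization_isTreeOp k ι) (degreeOneInclusion k d)
        (degreeOneInclusion_act d) (degreeOneInclusion_mem d) _).trans Finsupp.mapDomain_single
    rw [(isMorphism_presentation d).map_comp, ih, h₁, linearization_comp_single, mul_one]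
    congr 1
    have aux {C w B v : F} (φ : C ⟶ w) (γ : d.Chain (w ⊗ B) v) :
        φ ▷ B ≫ γ.value = (((single d φ).whiskerRight B).comp γ).value := by
      rw [value_comp, value_whiskerRight, value_single]
    exact aux φ.1 γ

variable {c : CubicalStructure ι}

theorem presentation_surjective (hF : IsFeynman ι) (X : FreeSym V) (v : V) :
    Function.Surjective (presentation k c.toProperDegree X v) := by
  rw [← LinearMap.range_eq_top, eq_top_iff]
  rintro x -
  rw [← Finsupp.sum_single x]
  refine Submodule.sum_mem _ fun φ _ => ?_
  obtain ⟨γ, hγ, hφ⟩ := c.value_surjective (X := (FreeSym.lift ι).obj X) φ rfl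
  obtain ⟨y, hy⟩ := hF.exists_reads (degreeOne k c.toProperDegree) 0
    (basisGen k c.toProperDegree) γ.1 hγ
  rw [← mul_one (x φ), ← smul_eq_mul, ← Finsupp.smul_single, ← hφ]
  exact Submodule.smul_mem _ _ ⟨y, presentation_reads hy⟩

theorem koszulSign_zero : koszulSign 0 0 = 1 := by
  simp [koszulSign]

/-- The kernel of the presentation is contained in each operadic ideal which contains the quadratic
relations. -/
theorem ker_presentation_le (hF : IsFeynman ι)
    {J : ∀ X v, Submodule k (FreeOp (degreeOne k c.toProperDegree) 0 X v)}
    (hJ : (freeOp (degreeOne k c.toProperDegree) 0).IsIdeal J)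
    (h : ∀ X v, quadraticRel k c X v ⊆ J X v) (X : FreeSym V) (v : V) :
    LinearMap.ker (presentation k c.toProperDegree X v) ≤ J X v := by
  -- Fix a reading `r` of one chain with composition `φ`. Any other chain with this composition is a
  -- permutation of it, so its reading is congruent to `r`.
  have key : ∀ φ : Basic ι X v, ∃ r : FreeOp (degreeOne k c.toProperDegree) 0 X v,
      ∀ x γ, Reads (basisGen k c.toProperDegree) x γ → γ.value = φ → x - r ∈ J X v := by
    intro φ
    obtain ⟨γ, hγ, hφ⟩ := c.value_surjective (X := (FreeSym.lift ι).obj X) φ rfl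
    obtain ⟨r, hr⟩ := hF.exists_reads (degreeOne k c.toProperDegree) 0
      (basisGen k c.toProperDegree) γ.1 hγ
    refine ⟨r, fun x δ hx hδ => ?_⟩
    obtain ⟨ε, hε⟩ := CubicalStructure.exists_signRel hγ hx.isPlus (hφ.trans hδ.symm)
    -- Generators of degree 0 have trivial Koszul sign, hence the trivial character.
    have := hF.reads_sub_mem_of_signRel hJ (basisGen_act _) (fun β x y hx hy => by
      rw [koszulSign_zero, one_smul]
      exact h _ _ ⟨β, x, y, hx, hy, rfl⟩) 1 (by rw [koszulSign_zero]; rfl) hε hr hx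
    simpa using this
  choose r hr using key
  let s := Finsupp.linearCombination k r
  -- Modulo `J`, the map `s` is a left inverse of the presentation: this holds on readings, which
  -- span. An element of the kernel is therefore congruent to 0.
  have key₂ : ∀ x, x - s (presentation k c.toProperDegree X v x) ∈ J X v := by
    intro x
    have hx : x ∈ Submodule.span k {x : FreeOp (degreeOne k c.toProperDegree) 0 X v |
        ∃ γ, Reads (basisGen k c.toProperDegree) x γ} := by
      rw [Reads.span_eq_top (span_basisGen _)]; trivial
    induction hx using Submodule.span_induction with
    | mem x hx =>
      obtain ⟨γ, hx⟩ := hx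
      rw [presentation_reads hx]
      simpa [s] using hr _ x γ hx rfl
    | zero => simp
    | add x y _ _ hx hy =>
      rw [map_add, map_add, add_sub_add_comm]
      exact add_mem hx hy
    | smul a x _ hx =>
      rw [map_smul, map_smul, ← smul_sub]
      exact Submodule.smul_mem _ _ hx
  intro x hx
  have := key₂ x
  rwa [LinearMap.mem_ker.1 hx, map_zero, sub_zero] at this

/-- One statement covers the three families of the theorem: all quadratic relations, all
transpositions, and transpositions of chains of length two. -/
theorem ker_presentation_eq (hF : IsFeynman ι)
    {S : ∀ X v, Set (FreeOp (degreeOne k c.toProperDegree) 0 X v)}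
    (h : ∀ X v, quadraticRel k c X v ⊆ S X v)
    (h' : ∀ X v, S X v ⊆ LinearMap.ker (presentation k c.toProperDegree X v)) (X : FreeSym V)
    (v : V) : LinearMap.ker (presentation k c.toProperDegree X v) =
      (freeOp (degreeOne k c.toProperDegree) 0).ideal S X v :=
  le_antisymm (ker_presentation_le hF (TreeOpData.isIdeal_ideal _ S)
    (fun X v => (h X v).trans (TreeOpData.subset_ideal _ S X v)) X v)
    ((isMorphism_presentation _).isIdeal_ker.ideal_le h' X v)

theorem quadraticRel_subset_transpositionRel (X : FreeSym V) (v : V) :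
    quadraticRel k c X v ⊆ transpositionRel k c X v := by
  rintro _ ⟨γ, x, y, hx, hy, rfl⟩
  exact ⟨2, 0, 1, γ, x, y, by decide, hx, hy, rfl⟩

theorem transpositionRel_subset_ker (X : FreeSym V) (v : V) :
    transpositionRel k c X v ⊆ LinearMap.ker (presentation k c.toProperDegree X v) := by
  rintro _ ⟨n, i, j, γ, x, y, -, hx, hy, rfl⟩
  rw [SetLike.mem_coe, LinearMap.mem_ker, map_sub, presentation_reads hx, presentation_reads hy,
    c.value_permute _ _ hx.isPlus, sub_self]

theorem quadraticRel_subset_weight (X : FreeSym V) (v : V) :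
    quadraticRel k c X v ⊆ {x | x ∈ freeWeight (degreeOne k c.toProperDegree) 0 2 X v ∧
      presentation k c.toProperDegree X v x = 0} := by
  intro r hr
  refine ⟨?_, transpositionRel_subset_ker X v (quadraticRel_subset_transpositionRel X v hr)⟩
  obtain ⟨γ, x, y, hx, hy, rfl⟩ := hr
  have h₁ := hx.mem_freeWeight
  have h₂ := hy.mem_freeWeight
  rw [γ.2] at h₁
  rw [(c.permute _ γ).2] at h₂
  exact sub_mem h₂ h₁

theorem isQuadraticPresentation (hF : IsFeynman ι) (c : CubicalStructure ι) :
    IsQuadraticPresentation (degreeOne k c.toProperDegree) 0 (linearization k ι)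
      (presentation k c.toProperDegree) where
  isMorphism := isMorphism_presentation _
  surjective := presentation_surjective hF
  ker_eq := ker_presentation_eq hF quadraticRel_subset_weight (fun _ _ _ h => h.2)

end Presentation

/-! ### The Koszul twist -/

section KoszulTwist

variable {k : Type w'} [Field k] {V : Type u₁} [Groupoid.{v₁} V] {F : Type u₂} [Category.{v₂} F]
  [MonoidalCategory F] [SymmetricCategory F] {ι : V ⥤ F} {c : CubicalStructure ι}

open ProperDegree ProperDegree.Chain

namespace Twist

theorem mk_congr {X : FreeSym V} {v : V} {γ δ : c.Chain ((FreeSym.lift ι).obj X) (ι.obj v)}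
    (h : γ = δ) (hγ : γ.IsPlus) (hδ : δ.IsPlus) : Twist.mk k c γ hγ = Twist.mk k c δ hδ := by
  subst h; rfl

theorem mk_eq_of_signRel {X : FreeSym V} {v : V}
    {γ δ : c.Chain ((FreeSym.lift ι).obj X) (ι.obj v)} {ε : ℤˣ} (h : c.SignRel ε γ δ)
    (hγ : γ.IsPlus) (hδ : δ.IsPlus) : Twist.mk k c δ hδ = (ε : ℤ) • Twist.mk k c γ hγ := by
  obtain ⟨n, γ, σ, rfl, rfl, rfl⟩ := h
  unfold Twist.mk
  rw [← Submodule.Quotient.mk_smul, Submodule.Quotient.eq]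
  exact Submodule.subset_span ⟨n, σ, γ, hγ, rfl⟩

theorem induction {X : FreeSym V} {v : V} {P : Twist k c X v → Prop}
    (mk : ∀ γ hγ, P (Twist.mk k c γ hγ)) (zero : P 0) (add : ∀ x y, P x → P y → P (x + y))
    (smul : ∀ (a : k) x, P x → P (a • x)) (x : Twist k c X v) : P x := by
  induction x using Submodule.Quotient.induction_on with | _ x
  induction x using Finsupp.induction_linear with
  | zero => exact zero
  | add x y hx hy => exact add _ _ hx hy
  | single γ a =>
    have : (Submodule.Quotient.mk (Finsupp.single γ a) : Twist k c X v) =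
        a • Twist.mk k c γ.1 γ.2 := by
      rw [Twist.mk, ← Submodule.Quotient.mk_smul, Finsupp.smul_single, smul_eq_mul, mul_one]
    rw [this]
    exact smul a _ (mk _ _)

/-- Linear maps out of the Koszul twist. -/
noncomputable def lift {X : FreeSym V} {v : V} {N : Type*} [AddCommGroup N] [Module k N]
    (f : PlusChain c.toProperDegree X v → N)
    (hf : ∀ (γ δ : PlusChain c.toProperDegree X v) (ε : ℤˣ), c.SignRel ε γ.1 δ.1 →
      f δ = (ε : ℤ) • f γ) : Twist k c X v →ₗ[k] N :=
  (twistRel k c X v).liftQ (Finsupp.linearCombination k f) (Submodule.span_le.2 (by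
    rintro _ ⟨n, σ, γ, hγ, rfl⟩
    rw [SetLike.mem_coe, LinearMap.mem_ker, map_sub, map_zsmul, Finsupp.linearCombination_single,
      Finsupp.linearCombination_single, one_smul, one_smul, sub_eq_zero]
    exact hf ⟨γ.1, hγ⟩ ⟨(c.permute σ γ).1, _⟩ _ (CubicalStructure.signRel_permute σ γ)))

theorem lift_mk {X : FreeSym V} {v : V} {N : Type*} [AddCommGroup N] [Module k N]
    (f : PlusChain c.toProperDegree X v → N)
    (hf : ∀ (γ δ : PlusChain c.toProperDegree X v) (ε : ℤˣ), c.SignRel ε γ.1 δ.1 →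
      f δ = (ε : ℤ) • f γ) (γ : c.Chain ((FreeSym.lift ι).obj X) (ι.obj v)) (hγ : γ.IsPlus) :
    lift f hf (Twist.mk k c γ hγ) = f ⟨γ, hγ⟩ := by
  refine (Finsupp.linearCombination_single k _ _).trans ?_
  rw [one_smul]

theorem hom_ext {X : FreeSym V} {v : V} {N : Type*} [AddCommGroup N] [Module k N]
    {f g : Twist k c X v →ₗ[k] N} (h : ∀ γ hγ, f (Twist.mk k c γ hγ) = g (Twist.mk k c γ hγ)) :
    f = g := by
  ext ⟨γ, hγ⟩
  exact h γ hγ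

end Twist

theorem isPlus_act (d : ProperDegree ι) {X X' : FreeSym V} {v v' : V} (g : X' ⟶ X) (h : v ⟶ v')
    {γ : d.Chain ((FreeSym.lift ι).obj X) (ι.obj v)} (hγ : γ.IsPlus) :
    (((single d ((FreeSym.lift ι).map g)).comp γ).comp (single d (ι.map h))).IsPlus :=
  .comp (.comp (.single (d.deg_map_le _ _)) hγ) (.single (d.deg_map_le _ _))

variable (k) in
/-- The homogeneous elements of the Koszul twist. -/
noncomputable def twistHomog (c : CubicalStructure ι) (X : FreeSym V) (v : V) (n : ℤ) :
    Submodule k (Twist k c X v) :=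
  Submodule.span k {x | ∃ (γ : c.Chain ((FreeSym.lift ι).obj X) (ι.obj v)) (hγ : γ.IsPlus),
    -(γ.length : ℤ) = n ∧ x = Twist.mk k c γ hγ}

theorem mk_mem_twistHomog {X : FreeSym V} {v : V}
    (γ : c.Chain ((FreeSym.lift ι).obj X) (ι.obj v)) (hγ : γ.IsPlus) {n : ℤ}
    (h : -(γ.length : ℤ) = n) : Twist.mk k c γ hγ ∈ twistHomog k c X v n :=
  Submodule.subset_span ⟨γ, hγ, h, rfl⟩

variable (k) in
open Classical in
/-- The projection of the Koszul twist to its part of degree `n`. -/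
noncomputable def twistProj (c : CubicalStructure ι) (X : FreeSym V) (v : V) (n : ℤ) :
    Twist k c X v →ₗ[k] Twist k c X v :=
  Twist.lift (fun γ => if -(γ.1.length : ℤ) = n then Twist.mk k c γ.1 γ.2 else 0)
    (fun γ δ ε h => by
      rw [h.length_eq]
      split_ifs
      · exact Twist.mk_eq_of_signRel h _ _
      · rw [smul_zero])

theorem twistProj_of_mem {X : FreeSym V} {v : V} {n : ℤ} {x : Twist k c X v}
    (hx : x ∈ twistHomog k c X v n) : twistProj k c X v n x = x := by
  induction hx using Submodule.span_induction with
  | mem x hx =>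
    obtain ⟨γ, hγ, hn, rfl⟩ := hx
    exact (Twist.lift_mk _ _ γ hγ).trans (if_pos hn)
  | zero => exact map_zero _
  | add x y _ _ hx hy => rw [map_add, hx, hy]
  | smul a x _ hx => rw [map_smul, hx]

theorem twistProj_of_mem_of_ne {X : FreeSym V} {v : V} {n m : ℤ} (h : m ≠ n) {x : Twist k c X v}
    (hx : x ∈ twistHomog k c X v m) : twistProj k c X v n x = 0 := by
  induction hx using Submodule.span_induction with
  | mem x hx =>
    obtain ⟨γ, hγ, rfl, rfl⟩ := hx
    exact (Twist.lift_mk _ _ γ hγ).trans (if_neg h)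
  | zero => exact map_zero _
  | add x y _ _ hx hy => rw [map_add, hx, hy, add_zero]
  | smul a x _ hx => rw [map_smul, hx, smul_zero]

/-- Permutations preserve the length, so the coinvariants are graded by it. The projections show
that the pieces are independent. -/
theorem isInternal_twistHomog (X : FreeSym V) (v : V) :
    DirectSum.IsInternal (twistHomog k c X v) := by
  refine DirectSum.isInternal_submodule_of_iSupIndep_of_iSup_eq_top ?_ ?_
  · intro n
    rw [Submodule.disjoint_def]
    intro x hx hx'
    have h : ⨆ (m) (_ : m ≠ n), twistHomog k c X v m ≤ LinearMap.ker (twistProj k c X v n) :=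
      iSup₂_le fun m hm y hy => twistProj_of_mem_of_ne hm hy
    rw [← twistProj_of_mem hx]
    exact h hx'
  · rw [eq_top_iff]
    rintro x -
    induction x using Twist.induction with
    | mk γ hγ => exact Submodule.mem_iSup_of_mem _ (mk_mem_twistHomog γ hγ rfl)
    | zero => exact zero_mem _
    | add x y hx hy => exact add_mem hx hy
    | smul a x hx => exact Submodule.smul_mem _ a hx

variable (k) in
/-- The action of isomorphisms on the Koszul twist. -/
noncomputable def twistAct {X X' : FreeSym V} {v v' : V} (g : X' ⟶ X) (h : v ⟶ v') :
    Twist k c X v →ₗ[k] Twist k c X' v' :=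
  Twist.lift (fun γ => Twist.mk k c _ (isPlus_act _ g h γ.2))
    (fun _ _ _ hε => Twist.mk_eq_of_signRel (.comp_right (.comp_left _ hε) _) _ _)

theorem signRel_comp_whiskerRight (hF : IsFeynman ι) {B C : FreeSym V} {w v : V}
    (γ : c.Chain ((FreeSym.lift ι).obj (.of w ⊗ B)) (ι.obj v))
    {δ δ' : c.Chain ((FreeSym.lift ι).obj C) (ι.obj w)} {ε : ℤˣ} (hδ : δ.IsPlus)
    (hε : c.SignRel ε δ δ') :
    c.SignRel ε ((δ.whiskerRight ((FreeSym.lift ι).obj B)).comp γ)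
      ((δ'.whiskerRight ((FreeSym.lift ι).obj B)).comp γ) :=
  .comp_right (hε.whiskerRight hF hδ _) _

variable (k) in
/-- The composition of the class of a chain with classes of chains. -/
noncomputable def twistCompMk (hF : IsFeynman ι) {B C : FreeSym V} {w v : V}
    (γ : PlusChain c.toProperDegree (.of w ⊗ B) v) :
    Twist k c C w →ₗ[k] Twist k c (C ⊗ B) v :=
  Twist.lift
    (fun δ => Twist.mk k c (X := C ⊗ B)
      ((δ.1.whiskerRight ((FreeSym.lift ι).obj B)).comp γ.1) (.comp (δ.2.whiskerRight _) γ.2))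
    (fun δ _ _ hε => Twist.mk_eq_of_signRel (signRel_comp_whiskerRight hF γ.1 δ.2 hε) _ _)

variable (k) in
theorem twistCompMk_mk (hF : IsFeynman ι) {B C : FreeSym V} {w v : V}
    (γ : PlusChain c.toProperDegree (.of w ⊗ B) v)
    (δ : c.Chain ((FreeSym.lift ι).obj C) (ι.obj w)) (hδ : δ.IsPlus) :
    twistCompMk k hF γ (Twist.mk k c δ hδ) = Twist.mk k c (X := C ⊗ B)
      ((δ.whiskerRight ((FreeSym.lift ι).obj B)).comp γ.1) (.comp (hδ.whiskerRight _) γ.2) := by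
  unfold twistCompMk
  exact Twist.lift_mk _ (fun δ _ _ hε =>
    Twist.mk_eq_of_signRel (signRel_comp_whiskerRight hF γ.1 δ.2 hε) _ _) δ hδ

variable (k) in
theorem twistCompMk_of_signRel (hF : IsFeynman ι) {B C : FreeSym V} {w v : V}
    (γ γ' : PlusChain c.toProperDegree (.of w ⊗ B) v) (ε : ℤˣ) (h : c.SignRel ε γ.1 γ'.1) :
    (twistCompMk k hF γ' : Twist k c C w →ₗ[k] _) = (ε : ℤ) • twistCompMk k hF γ :=
  Twist.hom_ext fun δ hδ => by
    rw [LinearMap.smul_apply, twistCompMk_mk, twistCompMk_mk]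
    exact Twist.mk_eq_of_signRel (.comp_left (δ.whiskerRight ((FreeSym.lift ι).obj B)) h) _ _

variable (k c) in
/-- The operad structure on the Koszul twist induced by the composition of chains. -/
noncomputable def koszulTwist (hF : IsFeynman ι) : TreeOpData k V (Twist k c) where
  homog X v n := twistHomog k c X v n
  act g h := twistAct k g h
  one v := Twist.mk k c (X := .of v) (.nil c.toProperDegree (ι.obj v)) .nil
  comp := Twist.lift (twistCompMk k hF) (twistCompMk_of_signRel k hF)

theorem koszulTwist_act (hF : IsFeynman ι) {X X' : FreeSym V} {v v' : V} (g : X' ⟶ X) (h : v ⟶ v')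
    (γ : c.Chain ((FreeSym.lift ι).obj X) (ι.obj v)) (hγ : γ.IsPlus) :
    (koszulTwist k c hF).act g h (Twist.mk k c γ hγ) = Twist.mk k c _ (isPlus_act _ g h hγ) := by
  change twistAct k g h _ = _
  unfold twistAct
  exact Twist.lift_mk (fun γ => Twist.mk k c _ (isPlus_act _ g h γ.2))
    (fun _ _ _ hε => Twist.mk_eq_of_signRel (.comp_right (.comp_left _ hε) _) _ _) γ hγ

theorem koszulTwist_comp (hF : IsFeynman ι) {B C : FreeSym V} {w v : V}
    (γ : c.Chain ((FreeSym.lift ι).obj (.of w ⊗ B)) (ι.obj v)) (hγ : γ.IsPlus)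
    (δ : c.Chain ((FreeSym.lift ι).obj C) (ι.obj w)) (hδ : δ.IsPlus) :
    (koszulTwist k c hF).comp (Twist.mk k c γ hγ) (Twist.mk k c δ hδ) =
      Twist.mk k c (X := C ⊗ B) ((δ.whiskerRight ((FreeSym.lift ι).obj B)).comp γ)
        (.comp (hδ.whiskerRight _) hγ) :=
  (LinearMap.congr_fun (Twist.lift_mk (twistCompMk k hF) (twistCompMk_of_signRel k hF) γ hγ)
    _).trans (twistCompMk_mk k hF ⟨γ, hγ⟩ δ hδ)

theorem koszulTwist_one (hF : IsFeynman ι) (v : V) : (koszulTwist k c hF).one v =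
    Twist.mk k c (X := .of v) (.nil c.toProperDegree (ι.obj v)) .nil := rfl

theorem koszulSign_neg_natCast (n m : ℕ) :
    koszulSign (-(n : ℤ)) (-(m : ℤ)) = (((-1) ^ (n * m) : ℤˣ) : ℤ) := by
  rw [koszulSign, neg_mul_neg, ← Nat.cast_mul, Int.negOnePow_def, zpow_natCast]

/-- Both chains execute `δ` and `η` on different tensor factors, in opposite orders. Once `leftComm`
has been moved past the whiskered chains, this is `signRel_exchange` for `δ` and `η ⊗ B`. -/
theorem signRel_parallel (hF : IsFeynman ι) {B C D u w v : F} (γ : c.Chain (w ⊗ (u ⊗ B)) v)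
    (δ : c.Chain C w) (hδ : δ.IsPlus) (η : c.Chain D u) (hη : η.IsPlus) :
    c.SignRel ((-1) ^ (δ.length * η.length))
      ((single _ (leftComm D C B)).comp ((δ.whiskerRight (D ⊗ B)).comp
        ((single _ (leftComm w D B)).comp ((η.whiskerRight (w ⊗ B)).comp
          ((single _ (leftComm u w B)).comp γ)))))
      ((η.whiskerRight (C ⊗ B)).comp
        ((single _ (leftComm u C B)).comp ((δ.whiskerRight (u ⊗ B)).comp γ))) := by
  have h := CubicalStructure.SignRel.comp_right (CubicalStructure.SignRel.comp_left
    (single _ (leftComm D C B)) (CubicalStructure.signRel_exchange hF δ hδ (η.whiskerRight B)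
      (hη.whiskerRight B))) γ
  rw [length_whiskerRight] at h
  convert h using 1
  · rw [← comp_assoc (η.whiskerRight (w ⊗ B)), whiskerRight_comp_leftComm, comp_assoc,
      single_comp_single_comp_of_left, leftComm_leftComm, single_id, nil_comp]
    simp only [comp_assoc]
  · rw [← comp_assoc, whiskerRight_comp_leftComm]
    simp only [comp_assoc]

end KoszulTwist

/-! ### The operad axioms at the level of chains -/

section ChainIdentities

variable {V : Type u₁} [Groupoid.{v₁} V] {F : Type u₂} [Category.{v₂} F]
  [MonoidalCategory F] [SymmetricCategory F] {ι : V ⥤ F} {d : ProperDegree ι}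

namespace ProperDegree.Chain

theorem comp_single_id {X Y : F} (γ : d.Chain X Y) : γ.comp (single d (𝟙 Y)) = γ := by
  rw [single_id, comp_nil]

theorem single_id_comp {X Y : F} (γ : d.Chain X Y) : (single d (𝟙 X)).comp γ = γ := by
  rw [single_id, nil_comp]

/-- Here and below, a morphism equal to an identity stands for the image of an identity of `V` or of
a word in `V`, so that the identities can be stated for arbitrary objects of `F`. -/
theorem act_one {X v : F} {p : v ⟶ v} (hp : p = 𝟙 v) (g : X ⟶ v) :
    ((single d g).comp (nil d v)).comp (single d p) =
      ((single d (𝟙 X)).comp (nil d X)).comp (single d g) := by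
  rw [hp, comp_single_id, comp_nil, comp_nil, single_id_comp]

theorem act_id {X Y : F} {p : X ⟶ X} (hp : p = 𝟙 X) {q : Y ⟶ Y} (hq : q = 𝟙 Y)
    (γ : d.Chain X Y) : ((single d p).comp γ).comp (single d q) = γ := by
  rw [hp, hq, comp_single_id, single_id_comp]

theorem act_act {W W' X Y Z Z' : F} (γ : d.Chain X Y) (g : W ⟶ X) (h : Y ⟶ Z) (g' : W' ⟶ W)
    (h' : Z ⟶ Z') (_ : IsIso g') (_ : IsIso h') :
    ((single d g').comp (((single d g).comp γ).comp (single d h))).comp (single d h') =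
      ((single d (g' ≫ g)).comp γ).comp (single d (h ≫ h')) := by
  simp only [comp_assoc]
  rw [single_comp_single_of_right h h', single_comp_single_comp_of_left g' g]

/-- The chain `δ` and the isomorphism `g` act on different tensor factors and commute without a
sign, because `g` has degree 0. -/
theorem comp_act {B B' C C' w w' v v' : F} (f : w ⟶ w') (g : B' ⟶ B) (h : v ⟶ v') (a : C' ⟶ C)
    (_ : IsIso f) (_ : IsIso g) (_ : IsIso a) {p : w ⟶ w} (hp : p = 𝟙 w) {q : C ⟶ C} (hq : q = 𝟙 C)
    {r : w ⊗ B' ⟶ w' ⊗ B} (hr : r = f ⊗ₘ g) {s : C' ⊗ B' ⟶ C ⊗ B} (hs : s = a ⊗ₘ g)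
    (γ : d.Chain (w' ⊗ B) v) (δ : d.Chain C w) :
    ((((single d a).comp δ).comp (single d p)).whiskerRight B').comp
        (((single d r).comp γ).comp (single d h)) =
      ((single d s).comp
        (((((single d q).comp δ).comp (single d f)).whiskerRight B).comp γ)).comp
          (single d h) := by
  subst hp hq hr hs
  rw [comp_single_id, single_id_comp]
  simp only [ProperDegree.Chain.comp_whiskerRight, comp_assoc, single_whiskerRight]
  rw [MonoidalCategory.tensorHom_def' f g, MonoidalCategory.tensorHom_def a g,
    ← single_comp_single_comp_of_left (w ◁ g) (f ▷ B),
    ← comp_assoc (δ.whiskerRight B'), whiskerRight_comp_single_whiskerLeft,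
    ← single_comp_single_comp_of_left (a ▷ B') (C ◁ g)]
  simp only [comp_assoc]

theorem one_comp {C v : F} {p : v ⟶ v} (hp : p = 𝟙 v) (δ : d.Chain C v) :
    (δ.whiskerRight (𝟙_ F)).comp
        (((single d (ρ_ v).hom).comp (nil d v)).comp (single d p)) =
      ((single d (ρ_ C).hom).comp δ).comp (single d p) := by
  subst hp
  rw [comp_single_id, comp_single_id, comp_nil, whiskerRight_unit]

theorem assoc_comp {B C D u w v : F} {p : v ⟶ v} (hp : p = 𝟙 v) (γ : d.Chain (w ⊗ B) v) (δ : d.Chain (u ⊗ C) w)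
    (η : d.Chain D u) :
    (η.whiskerRight (C ⊗ B)).comp
        (((single d (α_ u C B).inv).comp ((δ.whiskerRight B).comp γ)).comp (single d p)) =
      ((single d (α_ D C B).inv).comp
        ((((η.whiskerRight C).comp δ).whiskerRight B).comp γ)).comp (single d p) := by
  subst hp
  rw [comp_single_id, comp_single_id, ← comp_assoc, whiskerRight_tensor,
    ProperDegree.Chain.comp_whiskerRight]
  simp only [comp_assoc]

end ProperDegree.Chain

end ChainIdentities

/-! ### The operad axioms for the twist -/

section KoszulTwist

variable {k : Type w'} [Field k] {V : Type u₁} [Groupoid.{v₁} V] {F : Type u₂} [Category.{v₂} F]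
  [MonoidalCategory F] [SymmetricCategory F] {ι : V ⥤ F} {c : CubicalStructure ι}

open ProperDegree ProperDegree.Chain

/-- The chain obtained by attaching a chain to the first tensor factor of the source. -/
def graft {B C : FreeSym V} {w v : V} (γ : c.Chain ((FreeSym.lift ι).obj (.of w ⊗ B)) (ι.obj v))
    (δ : c.Chain ((FreeSym.lift ι).obj C) (ι.obj w)) :
    c.Chain ((FreeSym.lift ι).obj (C ⊗ B)) (ι.obj v) :=
  (δ.whiskerRight ((FreeSym.lift ι).obj B)).comp γ

theorem isPlus_graft {B C : FreeSym V} {w v : V}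
    {γ : c.Chain ((FreeSym.lift ι).obj (.of w ⊗ B)) (ι.obj v)} (hγ : γ.IsPlus)
    {δ : c.Chain ((FreeSym.lift ι).obj C) (ι.obj w)} (hδ : δ.IsPlus) : (graft γ δ).IsPlus :=
  .comp (hδ.whiskerRight _) hγ

theorem length_graft {B C : FreeSym V} {w v : V}
    (γ : c.Chain ((FreeSym.lift ι).obj (.of w ⊗ B)) (ι.obj v))
    (δ : c.Chain ((FreeSym.lift ι).obj C) (ι.obj w)) :
    (graft γ δ).length = δ.length + γ.length :=
  (length_comp _ _).trans (congrArg (· + γ.length) (length_whiskerRight _ _))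

theorem koszulTwist_graft (hF : IsFeynman ι) {B C : FreeSym V} {w v : V}
    (γ : c.Chain ((FreeSym.lift ι).obj (.of w ⊗ B)) (ι.obj v)) (hγ : γ.IsPlus)
    (δ : c.Chain ((FreeSym.lift ι).obj C) (ι.obj w)) (hδ : δ.IsPlus) :
    (koszulTwist k c hF).comp (Twist.mk k c γ hγ) (Twist.mk k c δ hδ) =
      Twist.mk k c (graft γ δ) (isPlus_graft hγ hδ) :=
  koszulTwist_comp hF γ hγ δ hδ

variable (c) in
/-- The empty chain. -/
def nilOf (v : V) : c.Chain ((FreeSym.lift ι).obj (.of v)) (ι.obj v) :=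
  .nil c.toProperDegree (ι.obj v)

theorem isPlus_nilOf (v : V) : (nilOf c v).IsPlus :=
  IsPlus.nil (d := c.toProperDegree) (X := ι.obj v)

theorem koszulTwist_one' (hF : IsFeynman ι) (v : V) : (koszulTwist k c hF).one v =
    Twist.mk k c (nilOf c v) (isPlus_nilOf v) := rfl

theorem length_act {W X Y Z : F} (γ : c.Chain X Y) (g : W ⟶ X) (h : Y ⟶ Z) (_ : IsIso g)
    (_ : IsIso h) : (((single _ g).comp γ).comp (single _ h)).length = γ.length := by
  simp [length_comp]

theorem koszulTwist_act_act (hF : IsFeynman ι) {X X' X'' : FreeSym V} {v v' v'' : V} (g : X' ⟶ X)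
    (h : v ⟶ v') (g' : X'' ⟶ X') (h' : v' ⟶ v'') (x : Twist k c X v) :
    (koszulTwist k c hF).act g' h' ((koszulTwist k c hF).act g h x) =
      (koszulTwist k c hF).act (g' ≫ g) (h ≫ h') x := by
  induction x using Twist.induction with
  | zero => simp only [map_zero]
  | add x y hx hy => simp only [map_add, hx, hy]
  | smul a x hx => simp only [map_smul, hx]
  | mk γ hγ =>
    rw [koszulTwist_act, koszulTwist_act, koszulTwist_act]
    refine Twist.mk_congr ?_ _ _
    rw [Functor.map_comp, Functor.map_comp]
    exact Chain.act_act γ _ _ _ _ (Functor.map_isIso _ _) (Functor.map_isIso _ _)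

theorem koszulTwist_act_id (hF : IsFeynman ι) {X : FreeSym V} {v : V} (x : Twist k c X v) :
    (koszulTwist k c hF).act (𝟙 X) (𝟙 v) x = x := by
  induction x using Twist.induction with
  | zero => simp only [map_zero]
  | add x y hx hy => simp only [map_add, hx, hy]
  | smul a x hx => simp only [map_smul, hx]
  | mk γ hγ =>
    rw [koszulTwist_act]
    refine Twist.mk_congr ?_ _ _
    exact Chain.act_id (CategoryTheory.Functor.map_id _ _) (CategoryTheory.Functor.map_id _ _) γ

theorem koszulTwist_comp_act (hF : IsFeynman ι) {B B' C C' : FreeSym V} {w w' v v' : V}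
    (f : w ⟶ w') (g : B' ⟶ B) (h : v ⟶ v') (a : C' ⟶ C) (x : Twist k c (.of w' ⊗ B) v)
    (y : Twist k c C w) :
    (koszulTwist k c hF).comp ((koszulTwist k c hF).act (FreeSym.ofMap f ⊗ₘ g) h x)
        ((koszulTwist k c hF).act a (𝟙 w) y) =
      (koszulTwist k c hF).act (a ⊗ₘ g) h
        ((koszulTwist k c hF).comp x ((koszulTwist k c hF).act (𝟙 C) f y)) := by
  induction x using Twist.induction with
  | zero => simp only [map_zero, LinearMap.zero_apply]
  | add x y hx hy => simp only [map_add, LinearMap.add_apply, hx, hy]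
  | smul a x hx => simp only [map_smul, LinearMap.smul_apply, hx]
  | mk γ hγ =>
    induction y using Twist.induction with
    | zero => simp only [map_zero]
    | add x y hx hy => simp only [map_add, hx, hy]
    | smul a x hx => simp only [map_smul, hx]
    | mk δ hδ =>
      rw [koszulTwist_act, koszulTwist_act, koszulTwist_act, koszulTwist_graft, koszulTwist_graft,
        koszulTwist_act]
      refine Twist.mk_congr ?_ _ _
      exact Chain.comp_act (ι.map f) ((FreeSym.lift ι).map g) (ι.map h) ((FreeSym.lift ι).map a)
        (Functor.map_isIso _ _) (Functor.map_isIso _ _) (Functor.map_isIso _ _)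
        (CategoryTheory.Functor.map_id _ _) (CategoryTheory.Functor.map_id _ _)
        (FreeSym.lift_map_tensorHom ι _ _) (FreeSym.lift_map_tensorHom ι _ _) γ δ

theorem koszulTwist_one_comp (hF : IsFeynman ι) {C : FreeSym V} {v : V} (y : Twist k c C v) :
    (koszulTwist k c hF).comp ((koszulTwist k c hF).act (ρ_ (FreeSym.of v)).hom (𝟙 v)
      ((koszulTwist k c hF).one v)) y = (koszulTwist k c hF).act (ρ_ C).hom (𝟙 v) y := by
  induction y using Twist.induction with
  | zero => simp only [map_zero]
  | add x y hx hy => simp only [map_add, hx, hy]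
  | smul a x hx => simp only [map_smul, hx]
  | mk δ hδ =>
    rw [koszulTwist_one', koszulTwist_act, koszulTwist_graft, koszulTwist_act]
    refine Twist.mk_congr ?_ _ _
    exact Chain.one_comp (CategoryTheory.Functor.map_id _ _) δ

theorem koszulTwist_comp_one (hF : IsFeynman ι) {B : FreeSym V} {w v : V}
    (x : Twist k c (.of w ⊗ B) v) :
    (koszulTwist k c hF).comp x ((koszulTwist k c hF).one w) = x := by
  induction x using Twist.induction with
  | zero => simp only [map_zero, LinearMap.zero_apply]
  | add x y hx hy => simp only [map_add, LinearMap.add_apply, hx, hy]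
  | smul a x hx => simp only [map_smul, LinearMap.smul_apply, hx]
  | mk γ hγ =>
    rw [koszulTwist_one', koszulTwist_graft]
    exact Twist.mk_congr (nil_comp γ) _ _

theorem koszulTwist_assoc (hF : IsFeynman ι) {B C D : FreeSym V} {u w v : V}
    (x : Twist k c (.of w ⊗ B) v) (y : Twist k c (.of u ⊗ C) w) (z : Twist k c D u) :
    (koszulTwist k c hF).comp ((koszulTwist k c hF).act (α_ (.of u) C B).inv (𝟙 v)
        ((koszulTwist k c hF).comp x y)) z =
      (koszulTwist k c hF).act (α_ D C B).inv (𝟙 v)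
        ((koszulTwist k c hF).comp x ((koszulTwist k c hF).comp y z)) := by
  induction x using Twist.induction with
  | zero => simp only [map_zero, LinearMap.zero_apply]
  | add x y hx hy => simp only [map_add, LinearMap.add_apply, hx, hy]
  | smul a x hx => simp only [map_smul, LinearMap.smul_apply, hx]
  | mk γ hγ =>
    induction y using Twist.induction with
    | zero => simp only [map_zero, LinearMap.zero_apply]
    | add x y hx hy => simp only [map_add, LinearMap.add_apply, hx, hy]
    | smul a x hx => simp only [map_smul, LinearMap.smul_apply, hx]
    | mk δ hδ =>
      induction z using Twist.induction with
      | zero => simp only [map_zero]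
      | add x y hx hy => simp only [map_add, hx, hy]
      | smul a x hx => simp only [map_smul, hx]
      | mk η hη =>
        rw [koszulTwist_graft, koszulTwist_graft, koszulTwist_act, koszulTwist_graft,
          koszulTwist_graft, koszulTwist_act]
        refine Twist.mk_congr ?_ _ _
        exact Chain.assoc_comp (CategoryTheory.Functor.map_id _ _) γ δ η

theorem signRel_parallel' (hF : IsFeynman ι) {B C D u w v : F} {p : v ⟶ v} (hp : p = 𝟙 v)
    (γ : c.Chain (w ⊗ (u ⊗ B)) v)
    (δ : c.Chain C w) (hδ : δ.IsPlus) (η : c.Chain D u) (hη : η.IsPlus) :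
    c.SignRel ((-1) ^ (δ.length * η.length))
      (((single _ (leftComm D C B)).comp ((δ.whiskerRight (D ⊗ B)).comp
        (((single _ (leftComm w D B)).comp ((η.whiskerRight (w ⊗ B)).comp
          (((single _ (leftComm u w B)).comp γ).comp (single _ p)))).comp (single _ p)))).comp
            (single _ p))
      ((η.whiskerRight (C ⊗ B)).comp
        (((single _ (leftComm u C B)).comp ((δ.whiskerRight (u ⊗ B)).comp γ)).comp
          (single _ p))) := by
  subst hp
  rw [comp_single_id, comp_single_id, comp_single_id, comp_single_id]
  exact signRel_parallel hF γ δ hδ η hη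

theorem koszulTwist_parallel_mk (hF : IsFeynman ι) {B C D : FreeSym V} {u w v : V}
    (x : Twist k c (.of w ⊗ (.of u ⊗ B)) v)
    (δ : c.Chain ((FreeSym.lift ι).obj C) (ι.obj w)) (hδ : δ.IsPlus)
    (η : c.Chain ((FreeSym.lift ι).obj D) (ι.obj u)) (hη : η.IsPlus) :
    (koszulTwist k c hF).comp ((koszulTwist k c hF).act (leftComm (.of u) C B) (𝟙 v)
        ((koszulTwist k c hF).comp x (Twist.mk k c δ hδ))) (Twist.mk k c η hη) =
      koszulSign (-δ.length) (-η.length) •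
        (koszulTwist k c hF).act (leftComm D C B) (𝟙 v)
        ((koszulTwist k c hF).comp ((koszulTwist k c hF).act (leftComm (.of w) D B) (𝟙 v)
          ((koszulTwist k c hF).comp ((koszulTwist k c hF).act (leftComm (.of u) (.of w) B) (𝟙 v) x)
            (Twist.mk k c η hη))) (Twist.mk k c δ hδ)) := by
  induction x using Twist.induction with
  | zero => simp only [map_zero, LinearMap.zero_apply, smul_zero]
  | add x y hx hy => simp only [map_add, LinearMap.add_apply, hx, hy, smul_add]
  | smul a x hx =>
    simp only [map_smul, LinearMap.smul_apply, hx]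
    exact (smul_comm _ _ _)
  | mk γ hγ =>
    rw [koszulTwist_graft, koszulTwist_act, koszulTwist_graft, koszulTwist_act, koszulTwist_graft,
      koszulTwist_act, koszulTwist_graft, koszulTwist_act, koszulSign_neg_natCast]
    -- The Koszul sign for the degrees `-δ.length` and `-η.length` is the sign of the permutation
    -- that exchanges the two chains.
    refine Twist.mk_eq_of_signRel ?_ _ _
    exact signRel_parallel' hF (CategoryTheory.Functor.map_id _ _) γ δ hδ η hη

theorem koszulTwist_isTreeOp (hF : IsFeynman ι) : (koszulTwist k c hF).IsTreeOp where
  internal := isInternal_twistHomog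
  act_mem {X X' v v'} g h n x hx := by
    induction hx using Submodule.span_induction with
    | zero => rw [map_zero]; exact zero_mem _
    | add x y _ _ hx hy => rw [map_add]; exact add_mem hx hy
    | smul a x _ hx => rw [map_smul]; exact Submodule.smul_mem _ a hx
    | mem x hx =>
      obtain ⟨γ, hγ, rfl, rfl⟩ := hx
      rw [koszulTwist_act]
      refine mk_mem_twistHomog _ _ ?_
      rw [length_act γ _ _ (Functor.map_isIso _ _) (Functor.map_isIso _ _)]
  one_mem v := mk_mem_twistHomog _ _ rfl
  comp_mem {B C w v p q x y} hx hy := by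
    induction hx using Submodule.span_induction with
    | zero => rw [map_zero]; exact zero_mem _
    | add x y _ _ hx hy => rw [map_add]; exact add_mem hx hy
    | smul a x _ hx => rw [map_smul]; exact Submodule.smul_mem _ a hx
    | mem x hx =>
      obtain ⟨γ, hγ, rfl, rfl⟩ := hx
      induction hy using Submodule.span_induction with
      | zero => rw [map_zero]; exact zero_mem _
      | add x y _ _ hx hy => rw [map_add]; exact add_mem hx hy
      | smul a x _ hx => rw [map_smul]; exact Submodule.smul_mem _ a hx
      | mem x hx =>
        obtain ⟨δ, hδ, rfl, rfl⟩ := hx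
        rw [koszulTwist_graft]
        refine mk_mem_twistHomog _ _ ?_
        rw [length_graft]
        push_cast
        ring
  act_id := koszulTwist_act_id hF
  act_act := koszulTwist_act_act hF
  comp_act := koszulTwist_comp_act hF
  one_act {v v'} f := by
    rw [koszulTwist_one', koszulTwist_one', koszulTwist_act, koszulTwist_act]
    refine Twist.mk_congr ?_ _ _
    exact Chain.act_one (CategoryTheory.Functor.map_id _ _) (ι.map f)
  comp_one := koszulTwist_comp_one hF
  one_comp := koszulTwist_one_comp hF
  assoc := koszulTwist_assoc hF
  parallel {B C D u w v p q} x y z hy hz := by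
    induction hy using Submodule.span_induction with
    | zero => simp only [map_zero, LinearMap.zero_apply, smul_zero]
    | add x y _ _ hx hy => simp only [map_add, LinearMap.add_apply, hx, hy, smul_add]
    | smul a x _ hx =>
      simp only [map_smul, LinearMap.smul_apply, hx]
      exact (smul_comm _ _ _)
    | mem y hy =>
      obtain ⟨δ, hδ, rfl, rfl⟩ := hy
      induction hz using Submodule.span_induction with
      | zero => simp only [map_zero, LinearMap.zero_apply, smul_zero]
      | add x y _ _ hx hy => simp only [map_add, LinearMap.add_apply, hx, hy, smul_add]
      | smul a x _ hx =>
        simp only [map_smul, LinearMap.smul_apply, hx]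
        exact (smul_comm _ _ _)
      | mem z hz =>
        obtain ⟨η, hη, rfl, rfl⟩ := hz
        exact koszulTwist_parallel_mk hF x δ hδ η hη

theorem isKoszulTwist_koszulTwist (hF : IsFeynman ι) : IsKoszulTwist k c (koszulTwist k c hF) where
  isTreeOp := koszulTwist_isTreeOp hF
  homog_eq _ _ _ := rfl
  act_mk := koszulTwist_act hF
  one_eq := koszulTwist_one hF
  comp_mk := koszulTwist_comp hF

end KoszulTwist

/-! ### Morphisms out of quotients -/

namespace TreeOpData

variable {k : Type w'} [Field k] {V : Type u₁} [Groupoid.{v₁} V]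
  {P : FreeSym V → V → Type w} [∀ X v, AddCommGroup (P X v)] [∀ X v, Module k (P X v)]
  {Q : FreeSym V → V → Type*} [∀ X v, AddCommGroup (Q X v)] [∀ X v, Module k (Q X v)]

/-- A morphism which vanishes on the ideal generated by `S` descends to the quotient. -/
theorem IsMorphism.liftQ {O : TreeOpData k V P} {O' : TreeOpData k V Q}
    {φ : ∀ X v, P X v →ₗ[k] Q X v} (hφ : O.IsMorphism O' φ) {S : ∀ X v, Set (P X v)}
    (hS : ∀ X v, O.ideal S X v ≤ LinearMap.ker (φ X v)) :
    (O.quo S).IsMorphism O' (fun X v => (O.ideal S X v).liftQ (φ X v) (hS X v)) where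
  map_homog := by
    rintro X v n _ ⟨x, hx, rfl⟩
    exact hφ.map_homog hx
  map_act g h x := by
    induction x using Submodule.Quotient.induction_on with | _ x
    exact hφ.map_act g h x
  map_one v := hφ.map_one v
  map_comp x y := by
    induction x using Submodule.Quotient.induction_on with | _ x
    induction y using Submodule.Quotient.induction_on with | _ y
    exact hφ.map_comp x y

end TreeOpData

/-! ### The quadratic dual -/

section DualGenerators

variable {k : Type w'} [Field k] {V : Type u₁} [Groupoid.{v₁} V] {F : Type u₂} [Category.{v₂} F]
  [MonoidalCategory F] [SymmetricCategory F] {ι : V ⥤ F}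

theorem BasicOne.act_inv_eq_iff {d : ProperDegree ι} {X X' : FreeSym V} {v v' : V} (g : X' ⟶ X)
    [IsIso g] (h : v ⟶ v') (φ : BasicOne d X v) (ψ : BasicOne d X' v') :
    BasicOne.act (inv g) (inv h) ψ = φ ↔ ψ = BasicOne.act g h φ := by
  rw [Subtype.ext_iff, Subtype.ext_iff]
  simp only [BasicOne.act, Basic.act, Functor.map_inv]
  rw [IsIso.inv_comp_eq, IsIso.comp_inv_eq, Category.assoc]

/-- The groupoid permutes the basis of `A`, and the contragredient action permutes the dual basis in
the same way. -/
theorem dualGen_act (d : ProperDegree ι) {X X' : FreeSym V} {v v' : V} (g : X' ⟶ X) (h : v ⟶ v')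
    (φ : BasicOne d X v) :
    (degreeOne k d).dual.act g h (dualGen k d φ) = dualGen k d (BasicOne.act g h φ) := by
  classical
  refine Finsupp.lhom_ext' fun ψ => LinearMap.ext_ring ?_
  change dualGen k d φ ((degreeOne k d).act (inv g) (inv h) (basisGen k d ψ)) = _
  rw [basisGen_act, basisGen, dualGen, dualGen]
  simp only [Finsupp.lapply_apply, LinearMap.comp_apply, Finsupp.lsingle_apply,
    Finsupp.single_apply, BasicOne.act_inv_eq_iff]

variable [∀ X Y : F, Finite (X ⟶ Y)]

variable (k) in
open Classical in
/-- The dual basis of the basis of the generators. -/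
noncomputable def dualGenBasis (d : ProperDegree ι) (X : FreeSym V) (v : V) :
    Module.Basis (BasicOne d X v) k (Module.Dual k (BasicOne d X v →₀ k)) :=
  Finsupp.basisSingleOne.dualBasis

theorem dualGenBasis_apply (d : ProperDegree ι) {X : FreeSym V} {v : V} (φ : BasicOne d X v) :
    dualGenBasis k d X v φ = dualGen k d φ := by
  classical
  refine Finsupp.lhom_ext' fun ψ => LinearMap.ext_ring ?_
  simp [dualGenBasis, dualGen, Finsupp.single_apply]

/-- Finiteness of the morphism sets enters here: the coordinate functionals span the whole dual. -/
theorem span_dualGen (d : ProperDegree ι) (X : FreeSym V) (v : V) :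
    Submodule.span k (Set.range (dualGen k d : BasicOne d X v → _)) = ⊤ := by
  rw [← (dualGenBasis k d X v).span_eq]
  congr 2
  funext φ
  exact (dualGenBasis_apply d φ).symm

end DualGenerators

section QuadraticDual

variable {k : Type w'} [Field k] {V : Type u₁} [Groupoid.{v₁} V] {F : Type u₂} [Category.{v₂} F]
  [MonoidalCategory F] [SymmetricCategory F] {ι : V ⥤ F}
  {c : CubicalStructure ι}

open ProperDegree ProperDegree.Chain

variable (c) in
/-- The chains of two morphisms of degree one from `v₁ ⊗ ⋯ ⊗ vₙ` to `v₀`. -/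
abbrev PlusChainTwo (X : FreeSym V) (v : V) :=
  {γ : c.ChainN 2 ((FreeSym.lift ι).obj X) (ι.obj v) // γ.1.IsPlus}

/-- The transposition of chains of length two. -/
def PlusChainTwo.swap {X : FreeSym V} {v : V} (γ : PlusChainTwo c X v) : PlusChainTwo c X v :=
  ⟨c.swap γ.1, c.isPlus_permute _ _ γ.2⟩

theorem PlusChainTwo.eq_or_eq_swap {X : FreeSym V} {v : V} {γ δ : PlusChainTwo c X v}
    (h : γ.1.1.value = δ.1.1.value) : δ = γ ∨ δ = γ.swap := by
  rcases CubicalStructure.eq_or_eq_swap γ.2 δ.2 h with h | h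
  · exact .inl (Subtype.ext h)
  · exact .inr (Subtype.ext h)

theorem PlusChainTwo.swap_ne {X : FreeSym V} {v : V} (γ : PlusChainTwo c X v) : γ.swap ≠ γ :=
  fun h => CubicalStructure.swap_ne γ.1 (congrArg Subtype.val h)

/-- A tree which reads a given chain. -/
noncomputable def dualReading (hF : IsFeynman ι) {X : FreeSym V} {v : V}
    (γ : PlusChain c.toProperDegree X v) : DualFree k c X v :=
  (hF.exists_reads (degreeOne k c.toProperDegree).dual (-1) (dualGen k c.toProperDegree)
    γ.1 γ.2).choose

theorem reads_dualReading (hF : IsFeynman ι) {X : FreeSym V} {v : V}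
    (γ : PlusChain c.toProperDegree X v) :
    Reads (dualGen k c.toProperDegree) (dualReading hF γ) γ.1 :=
  (hF.exists_reads (degreeOne k c.toProperDegree).dual (-1) (dualGen k c.toProperDegree)
    γ.1 γ.2).choose_spec

variable [∀ X Y : F, Finite (X ⟶ Y)]

variable (k c) in
/-- The map from the generators of the quadratic dual to the Koszul twist. -/
noncomputable def dualGenToTwist (X : FreeSym V) (v : V) :
    Module.Dual k (BasicOne c.toProperDegree X v →₀ k) →ₗ[k] Twist k c X v :=
  (dualGenBasis k c.toProperDegree X v).constr k
    fun φ => Twist.mk k c (.single _ φ.1) (.single φ.2.le)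

theorem dualGenToTwist_dualGen {X : FreeSym V} {v : V} (φ : BasicOne c.toProperDegree X v) :
    dualGenToTwist k c X v (dualGen k _ φ) = Twist.mk k c (.single _ φ.1) (.single φ.2.le) := by
  rw [← dualGenBasis_apply, dualGenToTwist, Module.Basis.constr_basis]

theorem dualGenToTwist_act (hF : IsFeynman ι) {X X' : FreeSym V} {v v' : V} (g : X' ⟶ X)
    (h : v ⟶ v') (ξ : Module.Dual k (BasicOne c.toProperDegree X v →₀ k)) :
    dualGenToTwist k c X' v' ((degreeOne k c.toProperDegree).dual.act g h ξ) =
      (koszulTwist k c hF).act g h (dualGenToTwist k c X v ξ) := by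
  refine LinearMap.congr_fun (f := dualGenToTwist k c X' v' ∘ₗ
    (degreeOne k c.toProperDegree).dual.act g h)
    (g := (koszulTwist k c hF).act g h ∘ₗ dualGenToTwist k c X v)
    ((dualGenBasis k c.toProperDegree X v).ext fun φ => ?_) ξ
  rw [LinearMap.comp_apply, LinearMap.comp_apply, dualGenBasis_apply, dualGen_act,
    dualGenToTwist_dualGen, dualGenToTwist_dualGen, koszulTwist_act]
  refine Twist.mk_congr ?_ _ _
  have aux {W X Y Z : F} (p : W ⟶ X) (f : X ⟶ Y) (q : Y ⟶ Z) (_ : IsIso p) (_ : IsIso q) :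
      single c.toProperDegree (p ≫ f ≫ q) = ((single _ p).comp (single _ f)).comp (single _ q) := by
    rw [single_comp_single_of_left, single_comp_single_of_right, Category.assoc]
  exact aux _ φ.1 _ (Functor.map_isIso _ _) (Functor.map_isIso _ _)

theorem dualGenToTwist_mem (hF : IsFeynman ι) (X : FreeSym V) (v : V)
    (ξ : Module.Dual k (BasicOne c.toProperDegree X v →₀ k)) :
    dualGenToTwist k c X v ξ ∈ (koszulTwist k c hF).homog X v (-1) := by
  have : ξ ∈ Submodule.span k (Set.range (dualGen k c.toProperDegree : BasicOne _ X v → _)) := by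
    rw [span_dualGen]; trivial
  induction this using Submodule.span_induction with
  | zero => rw [map_zero]; exact zero_mem _
  | add x y _ _ hx hy => rw [map_add]; exact add_mem hx hy
  | smul a x _ hx => rw [map_smul]; exact Submodule.smul_mem _ a hx
  | mem x hx =>
    obtain ⟨φ, rfl⟩ := hx
    rw [dualGenToTwist_dualGen]
    refine mk_mem_twistHomog _ _ ?_
    rw [length_single_of_ne _ (by rw [φ.2]; decide)]
    rfl

/-- The morphism from the free operad on the dual of the generators to the Koszul twist. -/
noncomputable def dualFreeToTwist (hF : IsFeynman ι) (X : FreeSym V) (v : V) :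
    DualFree k c X v →ₗ[k] Twist k c X v :=
  freeLift _ (-1) (koszulTwist_isTreeOp hF) (dualGenToTwist k c) (dualGenToTwist_act hF)
    (dualGenToTwist_mem hF) X v

theorem isMorphism_dualFreeToTwist (hF : IsFeynman ι) :
    (freeOp (degreeOne k c.toProperDegree).dual (-1)).IsMorphism (koszulTwist k c hF)
      (dualFreeToTwist hF) :=
  isMorphism_freeLift _ (-1) (koszulTwist_isTreeOp hF) (dualGenToTwist k c) (dualGenToTwist_act hF)
    (dualGenToTwist_mem hF)

theorem dualFreeToTwist_dualGen (hF : IsFeynman ι) {X : FreeSym V} {v : V}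
    (φ : BasicOne c.toProperDegree X v) :
    dualFreeToTwist hF X v (freeGen _ (-1) (dualGen k c.toProperDegree φ)) =
      Twist.mk k c (.single _ φ.1) (.single φ.2.le) :=
  (freeLift_freeGen _ (-1) (koszulTwist_isTreeOp hF) (dualGenToTwist k c) (dualGenToTwist_act hF)
    (dualGenToTwist_mem hF) _).trans (dualGenToTwist_dualGen φ)

theorem dualFreeToTwist_reads (hF : IsFeynman ι) {X : FreeSym V} {v : V} {x : DualFree k c X v}
    {γ : c.Chain ((FreeSym.lift ι).obj X) (ι.obj v)}
    (h : Reads (dualGen k c.toProperDegree) x γ) :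
    dualFreeToTwist hF X v x = Twist.mk k c γ h.isPlus := by
  induction h with
  | one v => exact (isMorphism_dualFreeToTwist hF).map_one v
  | act g h _ ih => rw [(isMorphism_dualFreeToTwist hF).map_act, ih, koszulTwist_act]
  | comp φ _ ih =>
    rw [(isMorphism_dualFreeToTwist hF).map_comp, ih, dualFreeToTwist_dualGen]
    exact koszulTwist_comp hF _ _ _ _

/-- There are finitely many compositions, and each is shared by at most two chains of length two. -/
instance {X : FreeSym V} {v : V} : Finite (PlusChainTwo c X v) := by
  rw [← Set.finite_univ_iff]
  refine Set.Finite.of_finite_fibers (fun γ : PlusChainTwo c X v => γ.1.1.value)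
    (Set.toFinite _) ?_
  rintro _ ⟨γ, -, rfl⟩
  exact (Set.toFinite {γ, γ.swap}).subset fun δ hδ => PlusChainTwo.eq_or_eq_swap (Eq.symm hδ.2)

/-- The functional takes the same value on `γ` and on its transpose, while the classes of these
chains in the twist are opposite. As the transposition is an involution without fixed points, the
sum cancels in pairs. -/
theorem dualRel_subset_ker (hF : IsFeynman ι) (X : FreeSym V) (v : V) :
    dualRel k c X v ⊆ LinearMap.ker (dualFreeToTwist (k := k) (c := c) hF X v) := by
  rintro _ ⟨t, t', ξ, ht, ht', hξ, rfl⟩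
  have := Fintype.ofFinite (PlusChainTwo c X v)
  rw [finsum_eq_sum_of_fintype, SetLike.mem_coe, LinearMap.mem_ker, map_sum]
  refine Finset.sum_involution (fun γ _ => PlusChainTwo.swap γ) (fun γ _ => ?_)
    (fun γ _ _ => PlusChainTwo.swap_ne γ) (fun _ _ => Finset.mem_univ _)
    (fun γ _ => Subtype.ext (CubicalStructure.swap_swap γ.1))
  have h₁ : ξ (t (PlusChainTwo.swap γ)) = ξ (t γ) :=
    sub_eq_zero.1 ((map_sub ξ _ _).symm.trans (hξ _ ⟨γ.1, _, _, ht γ, ht (PlusChainTwo.swap γ), rfl⟩))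
  rw [map_smul, map_smul, h₁, dualFreeToTwist_reads hF (ht' γ),
    dualFreeToTwist_reads hF (ht' (PlusChainTwo.swap γ)),
    Twist.mk_eq_of_signRel (δ := (PlusChainTwo.swap γ).1.1) (CubicalStructure.signRel_swap γ.1) γ.2
      (PlusChainTwo.swap γ).2, ← smul_add]
  simp

theorem ideal_dualRel_le_ker (hF : IsFeynman ι) (X : FreeSym V) (v : V) :
    (freeOp (degreeOne k c.toProperDegree).dual (-1)).ideal (dualRel k c) X v ≤
      LinearMap.ker (dualFreeToTwist hF X v) :=
  (isMorphism_dualFreeToTwist hF).isIdeal_ker.ideal_le (dualRel_subset_ker hF) X v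

/-- Take for `ξ` the coefficient of the composition of `β` in the image under π. It vanishes on the
quadratic relations, and among the readings of chains of length two it is non-zero, with value 1,
exactly for `β` and its transpose. -/
theorem add_mem_dualRel (hF : IsFeynman ι) {X : FreeSym V} {v : V}
    (β : c.ChainN 2 ((FreeSym.lift ι).obj X) (ι.obj v)) {x y : DualFree k c X v}
    (hx : Reads (dualGen k c.toProperDegree) x β.1)
    (hy : Reads (dualGen k c.toProperDegree) y (c.swap β).1) : x + y ∈ dualRel k c X v := by
  classical
  have := Fintype.ofFinite (PlusChainTwo c X v)
  choose t ht using fun γ : PlusChainTwo c X v => hF.exists_reads (degreeOne k c.toProperDegree) 0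
    (basisGen k c.toProperDegree) γ.1.1 γ.2
  choose t' ht' using fun γ : PlusChainTwo c X v =>
    hF.exists_reads (degreeOne k c.toProperDegree).dual (-1) (dualGen k c.toProperDegree) γ.1.1 γ.2
  refine ⟨t, t', Finsupp.lapply β.1.value ∘ₗ presentation k c.toProperDegree X v, ht, ht',
    fun r hr => ?_, ?_⟩
  · rw [LinearMap.comp_apply, LinearMap.mem_ker.1 (transpositionRel_subset_ker X v
      (quadraticRel_subset_transpositionRel X v hr)), map_zero]
  · let β' : PlusChainTwo c X v := ⟨β, hx.isPlus⟩
    have hval : β'.swap.1.1.value = β.1.value := c.value_permute _ β hx.isPlus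
    have hξ (γ : PlusChainTwo c X v) :
        (Finsupp.lapply β.1.value ∘ₗ presentation k c.toProperDegree X v) (t γ) =
          if γ.1.1.value = β.1.value then 1 else 0 := by
      rw [LinearMap.comp_apply, presentation_reads (ht γ), Finsupp.lapply_apply,
        Finsupp.single_apply]
    rw [finsum_eq_sum_of_fintype, Fintype.sum_eq_add β' β'.swap β'.swap_ne.symm, hξ, hξ,
      if_pos rfl, if_pos hval, one_smul, one_smul, hF.reads_unique (dualGen_act _) hx (ht' β'),
      hF.reads_unique (dualGen_act _) hy (ht' β'.swap)]
    rintro γ ⟨h₁, h₂⟩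
    rw [hξ, if_neg, zero_smul]
    intro h
    rcases PlusChainTwo.eq_or_eq_swap (γ := β') (δ := γ) h.symm with h | h
    · exact h₁ h
    · exact h₂ h

theorem koszulSign_neg_one : koszulSign (-1) (-1) = -1 := by
  simp [koszulSign]

/-- Generators of degree -1 have Koszul sign -1, so the relations `x + y` of `add_mem_dualRel` are
the required base case and the character is the sign itself. -/
theorem mk_reads_eq_of_signRel (hF : IsFeynman ι) {X : FreeSym V} {v : V}
    {γ δ : c.Chain ((FreeSym.lift ι).obj X) (ι.obj v)} {ε : ℤˣ} (h : c.SignRel ε γ δ)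
    {x y : DualFree k c X v} (hx : Reads (dualGen k c.toProperDegree) x γ)
    (hy : Reads (dualGen k c.toProperDegree) y δ) :
    (Submodule.Quotient.mk y : (freeOp (degreeOne k c.toProperDegree).dual (-1)).Quo
      (dualRel k c) X v) = (ε : ℤ) • Submodule.Quotient.mk x := by
  rw [← Submodule.Quotient.mk_smul, Submodule.Quotient.eq]
  refine hF.reads_sub_mem_of_signRel (TreeOpData.isIdeal_ideal _ (dualRel k c)) (dualGen_act _)
    (fun β x y hx hy => ?_) (MonoidHom.id _) koszulSign_neg_one.symm h hx hy
  rw [koszulSign_neg_one, neg_one_smul, sub_neg_eq_add, add_comm]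
  exact TreeOpData.subset_ideal _ _ _ _ (add_mem_dualRel hF β hx hy)

/-- The map from the Koszul twist to the quadratic dual which reads chains as trees. -/
noncomputable def twistToQuadraticDual (hF : IsFeynman ι) (X : FreeSym V) (v : V) :
    Twist k c X v →ₗ[k]
      (freeOp (degreeOne k c.toProperDegree).dual (-1)).Quo (dualRel k c) X v :=
  Twist.lift (fun γ => Submodule.Quotient.mk (dualReading hF γ))
    fun γ δ _ h => mk_reads_eq_of_signRel hF h (reads_dualReading hF γ) (reads_dualReading hF δ)

theorem twistToQuadraticDual_mk (hF : IsFeynman ι) {X : FreeSym V} {v : V}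
    (γ : c.Chain ((FreeSym.lift ι).obj X) (ι.obj v)) (hγ : γ.IsPlus) :
    twistToQuadraticDual hF X v (Twist.mk k c γ hγ) =
      Submodule.Quotient.mk (dualReading hF ⟨γ, hγ⟩) :=
  Twist.lift_mk (fun γ => Submodule.Quotient.mk (dualReading hF γ)) (fun γ δ _ h =>
    mk_reads_eq_of_signRel hF h (reads_dualReading hF γ) (reads_dualReading hF δ)) γ hγ

/-- The isomorphism of the quadratic dual with the Koszul twist. -/
noncomputable def quadraticDualEquiv (hF : IsFeynman ι) (X : FreeSym V) (v : V) :
    (freeOp (degreeOne k c.toProperDegree).dual (-1)).Quo (dualRel k c) X v ≃ₗ[k]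
      Twist k c X v :=
  LinearEquiv.ofLinearMap
    (Submodule.liftQ _ (dualFreeToTwist hF X v) (ideal_dualRel_le_ker hF X v))
    (twistToQuadraticDual hF X v)
    (Twist.hom_ext fun γ hγ => by
      rw [LinearMap.comp_apply, twistToQuadraticDual_mk, Submodule.liftQ_apply,
        dualFreeToTwist_reads hF (reads_dualReading hF ⟨γ, hγ⟩)]
      rfl)
    -- This composite need only be checked on readings, which span the free operad; there it is
    -- uniqueness of readings.
    (Submodule.linearMap_qext _ (LinearMap.ext_on_range
      (v := fun p : {p : DualFree k c X v × c.Chain ((FreeSym.lift ι).obj X) (ι.obj v) //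
        Reads (dualGen k c.toProperDegree) p.1 p.2} => p.1.1)
      (by
        rw [← Reads.span_eq_top (M := (degreeOne k c.toProperDegree).dual) (n := -1)
          (span_dualGen c.toProperDegree) X v]
        congr 1
        ext x
        exact ⟨fun ⟨p, hp⟩ => ⟨p.1.2, hp ▸ p.2⟩, fun ⟨γ, h⟩ => ⟨⟨(x, γ), h⟩, rfl⟩⟩)
      fun p => by
        change twistToQuadraticDual hF X v (dualFreeToTwist hF X v p.1.1) =
          Submodule.Quotient.mk p.1.1
        rw [dualFreeToTwist_reads hF p.2, twistToQuadraticDual_mk]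
        exact congrArg _ (hF.reads_unique (dualGen_act _) (reads_dualReading hF _) p.2)))

theorem isMorphism_quadraticDualEquiv (hF : IsFeynman ι) :
    (quadraticDual k c).IsMorphism (koszulTwist k c hF)
      (fun X v => (quadraticDualEquiv hF X v).toLinearMap) :=
  (isMorphism_dualFreeToTwist hF).liftQ (ideal_dualRel_le_ker hF)

end QuadraticDual

theorem lemma3p3 {k : Type w'} [Field k] [CharZero k] {V : Type u₁} [Groupoid.{v₁} V]
    {F : Type u₂} [Category.{v₂} F] [MonoidalCategory F] [SymmetricCategory F]
    [∀ X Y : F, Finite (X ⟶ Y)] (ι : V ⥤ F) (hF : IsFeynman ι) (c : CubicalStructure ι) :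
    IsQuadraticPresentation (degreeOne k c.toProperDegree) 0 (linearization k ι)
        (presentation k c.toProperDegree) ∧
      (∀ X v, LinearMap.ker (presentation k c.toProperDegree X v) =
        (freeOp (degreeOne k c.toProperDegree) 0).ideal (transpositionRel k c) X v) ∧
      (∀ X v, LinearMap.ker (presentation k c.toProperDegree X v) =
        (freeOp (degreeOne k c.toProperDegree) 0).ideal (quadraticRel k c) X v) ∧
      ∃ K : TreeOpData k V (Twist k c), IsKoszulTwist k c K ∧
        ∃ e : ∀ X v, (freeOp (degreeOne k c.toProperDegree).dual (-1)).Quo (dualRel k c) X v ≃ₗ[k]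
            Twist k c X v,
          (quadraticDual k c).IsMorphism K (fun X v => (e X v).toLinearMap) ∧
          ∀ X v (φ : BasicOne c.toProperDegree X v),
            e X v (Submodule.Quotient.mk (freeGen _ (-1) (dualGen k c.toProperDegree φ))) =
              Twist.mk k c (.single _ φ.1) (.single φ.2.le) := by
  exact ⟨isQuadraticPresentation hF c,
    ker_presentation_eq hF quadraticRel_subset_transpositionRel transpositionRel_subset_ker,
    ker_presentation_eq hF (fun _ _ => subset_rfl) fun X v =>
      (quadraticRel_subset_transpositionRel X v).trans (transpositionRel_subset_ker X v),
    koszulTwist k c hF, isKoszulTwist_koszulTwist hF, quadraticDualEquiv hF,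
    isMorphism_quadraticDualEquiv hF, fun X v φ => dualFreeToTwist_dualGen hF φ⟩
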